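/- **Setting.** Let $P$ be a probability distribution and let $f(x)=\mathbb E_{\xi\sim P}[f_\xi(x)]$ on $\mathbb R^d$, where the $f_\xi$ and $f$ are twice differentiable, $f$ is bounded below, and $\|\nabla^2 f(x)-\nabla^2 f(y)\|\le L\|x-y\|$ for all $x,y$ (spectral norm, $L\ge 0$). Fix $x_0$ and put $F_0=f(x_0)-\inf f$. Assume there are $\sigma_g,\sigma_h,\delta_h>0$ such that for all $x$: $\mathbb E\nabla f_\xi(x)=\nabla f(x)$, $\mathbb E\|\nabla f_\xi(x)-\nabla f(x)\|^2\le\sigma_g^2$, $\mathbb E\nabla^2 f_\xi(x)=\nabla^2 f(x)$, $\mathbb E\|\nabla^2 f_\xi(x)-\nabla^2 f(x)\|^2\le\sigma_h^2$, and $\|\nabla^2 f_\xi(x)-\nabla^2 f(x)\|\le\delta_h$ almost surely. At the initial point let $0\le\sigma_{g,0}\le\sigma_g$ and $0\le\sigma_{h,0}\le\sigma_h$ satisfy $\mathbb E\|\nabla f_\xi(x_0)-\nabla f(x_0)\|^2\le\sigma_{g,0}^2$ and $\mathbb E\|\nabla^2 f_\xi(x_0)-\nabla^2 f(x_0)\|^3\le\sigma_{h,0}^3$.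 Put $a_g=\sigma_{g,0}/\sigma_g$, $a_h=\sigma_{h,0}/\sigma_h$, and for $b\ge 0$ $$\tilde\sigma_h(b)^3=(1+\log d)^{3/2}\sigma_h^3+(1+\log d)^3\,b^{3/2}\,\delta_h^3 .$$ **Algorithm.** Let $T\ge1$, $M>0$, and $\alpha,\beta>0$. For $t=0,\dots,T-1$ draw samples $\xi^g_t,\xi^h_t\sim P$ (one of each, possibly equal), independently of the past; set $g_0=\nabla f_{\xi^g_0}(x_0)$, $H_0=\nabla^2 f_{\xi^h_0}(x_0)$, and for $t\ge1$ $$g_t=(1-\alpha)g_{t-1}+\alpha\nabla f_{\xi^g_t}\Big(x_t+\tfrac{1-\alpha}{\alpha}(x_t-x_{t-1})\Big),\qquad H_t=(1-\beta)H_{t-1}+\beta\nabla^2 f_{\xi^h_t}(x_t);$$ then let $x_{t+1}$ be a global minimizer of $y\mapsto\langle g_t,y-x_t\rangle+\frac12\langle H_t(y-x_t),y-x_t\rangle+\frac M6\|y-x_t\|^3$. The output $x_{out}$ is chosen uniformly at random from $x_1,\dots,x_T$, independently of the iterates. Let $\mu_M(x)=\max\big(\|\nabla f(x)\|^{3/2},\,-\lambda_{\min}(\nabla^2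 f(x))^3/M^{3/2}\big)$. The momentum parameters are $$\alpha=\max\Big(\frac{a_g^{6/7}}{T^{4/7}},10\sqrt{\frac LM}\Big),\qquad \beta=\max\Big(\frac{a_h^{6/5}}{T^{2/5}},46\frac LM\Big),$$ and are assumed to be positive (which is automatic if $L>0$). **Theorem.** There is a universal numerical constant $C$ such that the following hold. 1. For every $M>0$ with $M\ge100L$ and every $T\ge1$, $\mu_M(x_{out})$ is integrable and $$\mathbb E\mu_M(x_{out})\le C\Big(\frac{\sqrt M F_0}{T}+\frac{L^{3/2}\tilde\sigma_h(\beta)^3}{M^3}+\frac{L^{3/8}}{M^{3/8}}\sigma_g^{3/2}+\frac{a_g^{9/14}\sigma_g^{3/2}}{T^{3/7}}+\frac{a_h^{9/5}\tilde\sigma_h(\beta)^3}{M^{3/2}T^{3/5}}\Big).$$ 2. Suppose $F_0>0$ and write $\tilde\sigma_1=\tilde\sigma_h\big(L^{4/7}F_0^{2/7}\sigma_h^{-6/7}T^{-2/7}\big)$ and $\tilde\sigma_2=\tilde\sigma_h\big(a_h^{6/5}T^{-2/5}\big)$. With $$M=M_T:=\max\Big(100L,\ \frac{L^{3/7}\sigma_g^{12/7}T^{8/7}}{F_0^{8/7}},\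 \frac{L^{3/7}\tilde\sigma_1^{6/7}T^{2/7}}{F_0^{2/7}},\ \frac{a_h^{9/10}\tilde\sigma_2^{3/2}T^{1/5}}{F_0^{1/2}}\Big)$$ (assumed positive) and $\alpha,\beta$ as above for this $M$, for every $T\ge 1$, $\mu_M(x_{out})$ is integrable and $$\mathbb E\mu_M(x_{out})\le C\Big(\frac{\sqrt LF_0}{T}+\frac{L^{3/14}F_0^{6/7}\tilde\sigma_1^{3/7}}{T^{6/7}}+\frac{L^{3/14}F_0^{3/7}\sigma_g^{6/7}}{T^{3/7}}+\frac{a_g^{9/14}\sigma_g^{3/2}}{T^{3/7}}+\frac{a_h^{9/20}\tilde\sigma_2^{3/4}F_0^{3/4}}{T^{9/10}}\Big).$$ 3. Consequently the method converges with a single sample per iteration: for every fixed problem with $F_0>0$ and every $\varepsilon>0$ there is $T_0$ such that $\mathbb E\mu_{M_T}(x_{out})\le\varepsilon$ for all $T\ge T_0$, with the parameters of part 2. -/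

import Mathlib

open MeasureTheory ProbabilityTheory

universe u v

noncomputable section

namespace CubicMomentum

/-- `ℝ^d` with its Euclidean norm. -/
abbrev Vec (d : ℕ) : Type := EuclideanSpace ℝ (Fin d)

/-- Matrices `ℝ^{d × d}` as operators on `ℝ^d`; the norm is the spectral norm. -/
abbrev Op (d : ℕ) : Type := Vec d →L[ℝ] Vec d

/-- The Hessian of `f` at `x`: the derivative of the gradient. -/
def hess {d : ℕ} (f : Vec d → ℝ) (x : Vec d) : Op d := fderiv ℝ (gradient f) x

/-- `f` is twice (Fréchet) differentiable on `ℝ^d`. -/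
def TwiceDifferentiable {d : ℕ} (f : Vec d → ℝ) : Prop :=
  Differentiable ℝ f ∧ Differentiable ℝ (gradient f)

/-- The smallest (real) eigenvalue. -/
def lambdaMin {d : ℕ} (A : Op d) : ℝ :=
  sInf {l : ℝ | Module.End.HasEigenvalue (A : Vec d →ₗ[ℝ] Vec d) l}

/-- The accuracy measure
`μ_c(x) = max (‖∇f(x)‖^{3/2}, - λ_min(∇²f(x))³ / c^{3/2})`. -/
def mu {d : ℕ} (f : Vec d → ℝ) (c : ℝ) (x : Vec d) : ℝ :=
  max (‖gradient f x‖ ^ (3 / 2 : ℝ)) (-(lambdaMin (hess f x) ^ 3) / c ^ (3 / 2 : ℝ))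

/-- The stochastic objective `f(x) = E_{ξ ∼ P} f_ξ(x)`. -/
def objective {d : ℕ} {Ξ : Type*} [MeasurableSpace Ξ] (P : Measure Ξ) (F : Ξ → Vec d → ℝ)
    (x : Vec d) : ℝ :=
  ∫ ξ, F ξ x ∂P

/-- The initial residual `F₀ = f(x₀) - inf f`. -/
def initialGap {d : ℕ} (f : Vec d → ℝ) (x₀ : Vec d) : ℝ := f x₀ - ⨅ x, f x

/-- The cubically regularized quadratic model `Ω_{M,g,H}(y, x)`. -/
def cubicModel {d : ℕ} (M : ℝ) (g : Vec d) (H : Op d) (x y : Vec d) : ℝ :=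
  inner ℝ g (y - x) + 1 / 2 * inner ℝ (H (y - x)) (y - x) + M / 6 * ‖y - x‖ ^ 3

/-- The constants of the problem class: the Lipschitz constant of the Hessian of the objective,
and the gradient and Hessian noise levels, globally (`σg`, `σh`, `δh`) and at the initial point
(`σg₀`, `σh₀`). -/
structure Constants where
  L : ℝ
  σg : ℝ
  σg₀ : ℝ
  σh : ℝ
  σh₀ : ℝ
  δh : ℝ

/-- `a_g = σ_{g,0} / σ_g`. -/
def Constants.ag (c : Constants) : ℝ := c.σg₀ / c.σg

/-- `a_h = σ_{h,0} / σ_h`. -/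
def Constants.ah (c : Constants) : ℝ := c.σh₀ / c.σh

/-- The standing assumptions on the problem `min_x E_{ξ ∼ P} f_ξ(x)`, on the initial point and on
the noise of the stochastic gradients and Hessians. -/
structure Assumptions {d : ℕ} {Ξ : Type*} [MeasurableSpace Ξ] (P : Measure Ξ)
    (F : Ξ → Vec d → ℝ) (x₀ : Vec d) (c : Constants) : Prop where
  sample_measurable : ∀ x, Measurable fun ξ => F ξ x
  sample_twiceDifferentiable : ∀ ξ, TwiceDifferentiable (F ξ)
  sample_integrable : ∀ x, Integrable (fun ξ => F ξ x) P
  twiceDifferentiable : TwiceDifferentiable (objective P F)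
  L_nonneg : 0 ≤ c.L
  hess_lipschitz : ∀ x y,
    ‖hess (objective P F) x - hess (objective P F) y‖ ≤ c.L * ‖x - y‖
  bddBelow : BddBelow (Set.range (objective P F))
  σg_pos : 0 < c.σg
  σh_pos : 0 < c.σh
  δh_pos : 0 < c.δh
  grad_unbiased : ∀ x, ∫ ξ, gradient (F ξ) x ∂P = gradient (objective P F) x
  grad_noise : ∀ x,
    ∫⁻ ξ, ENNReal.ofReal (‖gradient (F ξ) x - gradient (objective P F) x‖ ^ 2) ∂P
      ≤ ENNReal.ofReal (c.σg ^ 2)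
  hess_unbiased : ∀ x, ∫ ξ, hess (F ξ) x ∂P = hess (objective P F) x
  hess_noise : ∀ x,
    ∫⁻ ξ, ENNReal.ofReal (‖hess (F ξ) x - hess (objective P F) x‖ ^ 2) ∂P
      ≤ ENNReal.ofReal (c.σh ^ 2)
  hess_noise_bdd : ∀ x, ∀ᵐ ξ ∂P, ‖hess (F ξ) x - hess (objective P F) x‖ ≤ c.δh
  σg₀_nonneg : 0 ≤ c.σg₀
  σg₀_le : c.σg₀ ≤ c.σg
  σh₀_nonneg : 0 ≤ c.σh₀
  σh₀_le : c.σh₀ ≤ c.σh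
  grad_noise_init :
    ∫⁻ ξ, ENNReal.ofReal (‖gradient (F ξ) x₀ - gradient (objective P F) x₀‖ ^ 2) ∂P
      ≤ ENNReal.ofReal (c.σg₀ ^ 2)
  hess_noise_init :
    ∫⁻ ξ, ENNReal.ofReal (‖hess (F ξ) x₀ - hess (objective P F) x₀‖ ^ 3) ∂P
      ≤ ENNReal.ofReal (c.σh₀ ^ 3)

/-- `T` steps of the stochastic Cubic Newton method with momentum, with constant parameters
`M`, `α`, `β`, started at `x₀`. At step `t` one sample `ξg t` for the gradient and one sample
`ξh t` for the Hessian are drawn from `P`, independently of the past `ℱ t`; the two samples may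
be dependent on each other, in particular equal. The global minimizer of the cubic model may be
selected in any measurable (possibly randomized) way. -/
structure IsCubicNewtonRun {d : ℕ} {Ξ Ω : Type*} [MeasurableSpace Ξ] [mΩ : MeasurableSpace Ω]
    (P : Measure Ξ) (F : Ξ → Vec d → ℝ) (x₀ : Vec d) (M α β : ℝ) (T : ℕ)
    (μ : Measure Ω) (ℱ : Filtration ℕ mΩ) (ξg ξh : ℕ → Ω → Ξ)
    (x g : ℕ → Ω → Vec d) (H : ℕ → Ω → Op d) : Prop where
  M_pos : 0 < M
  α_pos : 0 < α
  β_pos : 0 < β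
  x_adapted : ∀ t ≤ T, Measurable[ℱ t] (x t)
  ξg_adapted : ∀ t < T, Measurable[ℱ (t + 1)] (ξg t)
  ξh_adapted : ∀ t < T, Measurable[ℱ (t + 1)] (ξh t)
  ξg_law : ∀ t < T, μ.map (ξg t) = P
  ξh_law : ∀ t < T, μ.map (ξh t) = P
  sample_indep : ∀ t < T,
    Indep (MeasurableSpace.comap (fun ω => (ξg t ω, ξh t ω)) inferInstance) (ℱ t) μ
  x_zero : ∀ ω, x 0 ω = x₀
  g_zero : ∀ ω, g 0 ω = gradient (F (ξg 0 ω)) (x 0 ω)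
  H_zero : ∀ ω, H 0 ω = hess (F (ξh 0 ω)) (x 0 ω)
  g_succ : ∀ t, t + 1 < T → ∀ ω, g (t + 1) ω = (1 - α) • g t ω +
    α • gradient (F (ξg (t + 1) ω))
      (x (t + 1) ω + ((1 - α) / α) • (x (t + 1) ω - x t ω))
  H_succ : ∀ t, t + 1 < T → ∀ ω, H (t + 1) ω = (1 - β) • H t ω +
    β • hess (F (ξh (t + 1) ω)) (x (t + 1) ω)
  x_succ : ∀ t < T, ∀ ω,
    IsMinOn (cubicModel M (g t ω) (H t ω) (x t ω)) Set.univ (x (t + 1) ω)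

/-- `τ` is a uniformly random index in `{1, …, T}`, independent of the iterates `x_0, …, x_T`. -/
structure IsUniformIndex {d : ℕ} {Ω : Type*} [MeasurableSpace Ω] (T : ℕ) (μ : Measure Ω)
    (x : ℕ → Ω → Vec d) (τ : Ω → ℕ) : Prop where
  measurable : Measurable τ
  law : μ.map τ = uniformOn (Set.Icc 1 T)
  indep : IndepFun τ (fun ω (i : Fin (T + 1)) => x i ω) μ

/-- `α = max (a_g^{6/7} / T^{4/7}, 10 √(L/M))`. -/
def Constants.alpha (c : Constants) (M : ℝ) (T : ℕ) : ℝ :=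
  max (c.ag ^ (6 / 7 : ℝ) / (T : ℝ) ^ (4 / 7 : ℝ)) (10 * √(c.L / M))

/-- `β = max (a_h^{6/5} / T^{2/5}, 46 L/M)`. -/
def Constants.beta (c : Constants) (M : ℝ) (T : ℕ) : ℝ :=
  max (c.ah ^ (6 / 5 : ℝ) / (T : ℝ) ^ (2 / 5 : ℝ)) (46 * (c.L / M))

/-- The effective Hessian noise level after averaging with momentum parameter `b`:
`σ̃_h(b)³ = (1 + log d)^{3/2} σ_h³ + (1 + log d)³ b^{3/2} δ_h³`; this is `σ̃_h(b)`. -/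
def Constants.sigmaTilde (c : Constants) (d : ℕ) (b : ℝ) : ℝ :=
  ((1 + Real.log d) ^ (3 / 2 : ℝ) * c.σh ^ 3
    + (1 + Real.log d) ^ 3 * b ^ (3 / 2 : ℝ) * c.δh ^ 3) ^ (1 / 3 : ℝ)

/-- The right-hand side of the rate for a given regularization parameter `M`. -/
def Constants.rate (c : Constants) (d : ℕ) (F₀ M : ℝ) (T : ℕ) : ℝ :=
  √M * F₀ / T
    + c.L ^ (3 / 2 : ℝ) * c.sigmaTilde d (c.beta M T) ^ 3 / M ^ 3
    + (c.L / M) ^ (3 / 8 : ℝ) * c.σg ^ (3 / 2 : ℝ)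
    + c.ag ^ (9 / 14 : ℝ) * c.σg ^ (3 / 2 : ℝ) / (T : ℝ) ^ (3 / 7 : ℝ)
    + c.ah ^ (9 / 5 : ℝ) * c.sigmaTilde d (c.beta M T) ^ 3
        / (M ^ (3 / 2 : ℝ) * (T : ℝ) ^ (3 / 5 : ℝ))

/-- `σ̃_h(b₁)` with `b₁ = L^{4/7} F₀^{2/7} / (σ_h^{6/7} T^{2/7})`. -/
def Constants.sigmaTilde₁ (c : Constants) (d : ℕ) (F₀ : ℝ) (T : ℕ) : ℝ :=
  c.sigmaTilde d (c.L ^ (4 / 7 : ℝ) * F₀ ^ (2 / 7 : ℝ)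
    / (c.σh ^ (6 / 7 : ℝ) * (T : ℝ) ^ (2 / 7 : ℝ)))

/-- `σ̃_h(b₂)` with `b₂ = a_h^{6/5} / T^{2/5}`. -/
def Constants.sigmaTilde₂ (c : Constants) (d : ℕ) (T : ℕ) : ℝ :=
  c.sigmaTilde d (c.ah ^ (6 / 5 : ℝ) / (T : ℝ) ^ (2 / 5 : ℝ))

/-- The regularization parameter that balances the terms of the rate. -/
def Constants.optM (c : Constants) (d : ℕ) (F₀ : ℝ) (T : ℕ) : ℝ :=
  max (max (100 * c.L)
      (c.L ^ (3 / 7 : ℝ) * c.σg ^ (12 / 7 : ℝ) * (T : ℝ) ^ (8 / 7 : ℝ) / F₀ ^ (8 / 7 : ℝ)))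
    (max (c.L ^ (3 / 7 : ℝ) * c.sigmaTilde₁ d F₀ T ^ (6 / 7 : ℝ) * (T : ℝ) ^ (2 / 7 : ℝ)
        / F₀ ^ (2 / 7 : ℝ))
      (c.ah ^ (9 / 10 : ℝ) * c.sigmaTilde₂ d T ^ (3 / 2 : ℝ) * (T : ℝ) ^ (1 / 5 : ℝ)
        / F₀ ^ (1 / 2 : ℝ)))

/-- The rate for the balanced choice of the regularization parameter. -/
def Constants.optRate (c : Constants) (d : ℕ) (F₀ : ℝ) (T : ℕ) : ℝ :=
  √c.L * F₀ / T
    + c.L ^ (3 / 14 : ℝ) * F₀ ^ (6 / 7 : ℝ) * c.sigmaTilde₁ d F₀ T ^ (3 / 7 : ℝ)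
        / (T : ℝ) ^ (6 / 7 : ℝ)
    + c.L ^ (3 / 14 : ℝ) * F₀ ^ (3 / 7 : ℝ) * c.σg ^ (6 / 7 : ℝ) / (T : ℝ) ^ (3 / 7 : ℝ)
    + c.ag ^ (9 / 14 : ℝ) * c.σg ^ (3 / 2 : ℝ) / (T : ℝ) ^ (3 / 7 : ℝ)
    + c.ah ^ (9 / 20 : ℝ) * c.sigmaTilde₂ d T ^ (3 / 4 : ℝ) * F₀ ^ (3 / 4 : ℝ)
        / (T : ℝ) ^ (9 / 10 : ℝ)

/-- The output `x_τ` of `T ≥ 1` steps of the method, run on the given problem with regularization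
parameter `M` and the momentum parameters `c.alpha M T`, `c.beta M T`, satisfies
`E μ_M(x_τ) ≤ B`, for every run on a probability space in `Type v`. -/
def OutputBound {d : ℕ} {Ξ : Type u} [MeasurableSpace Ξ] (P : Measure Ξ)
    (F : Ξ → Vec d → ℝ) (x₀ : Vec d) (c : Constants) (M : ℝ) (T : ℕ) (B : ℝ) : Prop :=
  ∀ (Ω : Type v) (mΩ : MeasurableSpace Ω) (μ : Measure Ω) (_ : IsProbabilityMeasure μ)
    (ℱ : Filtration ℕ mΩ) (ξg ξh : ℕ → Ω → Ξ) (x g : ℕ → Ω → Vec d) (H : ℕ → Ω → Op d)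
    (τ : Ω → ℕ),
    IsCubicNewtonRun P F x₀ M (c.alpha M T) (c.beta M T) T μ ℱ ξg ξh x g H →
    IsUniformIndex T μ x τ →
    Integrable (fun ω => mu (objective P F) M (x (τ ω) ω)) μ ∧
      ∫ ω, mu (objective P F) M (x (τ ω) ω) ∂μ ≤ B

end CubicMomentum

end

open CubicMomentum

/-! The errors of g_t and H_t split into a bias, caused by the motion of the iterates, and an
exponential moving average of the sample noise (`ema`). A cubic step of length r decreases f by
about M r³/4 up to these errors, and μ_M at the new point is bounded by M^{3/2} r³ plus the 3/2
power of the gradient error and the cube of the Hessian error over M^{3/2} (`cubic_step_decrease`,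
`cubic_step_mu_le`). Sampling the gradient at the extrapolated point cancels the first-order terms,
so the gradient bias is driven by L r²/α and the Hessian bias by L r. The lower bounds 10√(L/M) on α
and 46 L/M on β make the accumulated biases a small fraction of ∑ M^{3/2} r³, which the decrease of
f absorbs. `sum_mu_le_of_path` is the resulting pathwise estimate, in which only the initial gap and
the noise averages remain.

For the gradient noise the parallelogram law gives a second moment of order α σ_g². The spectral
norm of the Hessian noise has no such law. It is replaced by a Schatten norm of exponent 2^(k+1), of
order 1 + log d, which lies within a factor e of the spectral norm and whose square is uniformly
smooth with modulus κ of the same order. Smoothness comes from Hölder's inequality for traces: the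
trace powers of A ± X are expanded into words and compared termwise with the scalar inequality
`two_point_pow_le`. Since each new sample is centred and independent of the past, smoothness yields
recursions for the second and fourth moments of the average, and the third moment follows by
interpolation. The first sample is kept apart: its weight decays like (1 - γ)^t, so its own noise
level enters with total weight at most 1/γ.

The rest is arithmetic of exponents. `Constants.le_rate` inserts α and β, `Constants.rate_optM_le`
balances the rate in M, and every power of T in the balanced rate is at least 3/7, which gives
convergence. -/

noncomputable section

namespace CubicMomentum

/-! ### Schatten norms of dyadic exponent: Hölder, Minkowski and uniform smoothness. -/

section Schatten

open Matrix

variable {n : Type*} [Fintype n]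

lemma trace_mul_transpose_self_nonneg (A : Matrix n n ℝ) : 0 ≤ (A * Aᵀ).trace := by
  simp only [trace, diag, mul_apply, transpose_apply]
  exact Finset.sum_nonneg fun i _ => Finset.sum_nonneg fun j _ => mul_self_nonneg _

/-- Cauchy–Schwarz for the Frobenius inner product; the base case of Hölder's inequality below. -/
lemma trace_mul_sq_le (A B : Matrix n n ℝ) :
    (A * B).trace ^ 2 ≤ (A * Aᵀ).trace * (B * Bᵀ).trace := by
  have h1 : (A * B).trace = ∑ p : n × n, A p.1 p.2 * B p.2 p.1 := by
    simp only [trace, diag, mul_apply, Fintype.sum_prod_type]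
  have h2 : (A * Aᵀ).trace = ∑ p : n × n, A p.1 p.2 ^ 2 := by
    simp only [trace, diag, mul_apply, Fintype.sum_prod_type, transpose_apply, pow_two]
  have h3 : (B * Bᵀ).trace = ∑ p : n × n, B p.2 p.1 ^ 2 := by
    rw [Fintype.sum_prod_type, Finset.sum_comm]
    simp only [trace, diag, mul_apply, transpose_apply, pow_two]
  rw [h1, h2, h3]
  exact Finset.sum_mul_sq_le_sq_mul_sq _ _ _

variable [DecidableEq n]

/-- The `2^(k+1)`-th power of the Schatten norm of exponent `2^(k+1)`. -/
def schattenPow (k : ℕ) (A : Matrix n n ℝ) : ℝ := ((A * Aᵀ) ^ 2 ^ k).trace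

lemma pow_mul_transpose_pow (A : Matrix n n ℝ) (k : ℕ) :
    (A * Aᵀ) ^ 2 ^ (k + 1) = (A * Aᵀ) ^ 2 ^ k * ((A * Aᵀ) ^ 2 ^ k)ᵀ := by
  rw [transpose_pow, transpose_mul, transpose_transpose, ← pow_add, pow_succ, mul_two]

lemma schattenPow_nonneg (k : ℕ) (A : Matrix n n ℝ) : 0 ≤ schattenPow k A := by
  unfold schattenPow
  cases k with
  | zero => simpa using trace_mul_transpose_self_nonneg A
  | succ k => rw [pow_mul_transpose_pow]; exact trace_mul_transpose_self_nonneg _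

lemma trace_mul_pow_comm (X Y : Matrix n n ℝ) (m : ℕ) :
    ((X * Y) ^ m).trace = ((Y * X) ^ m).trace := by
  cases m with
  | zero => simp
  | succ m =>
    have h : X * (Y * X) ^ m = (X * Y) ^ m * X :=
      (show SemiconjBy X (Y * X) (X * Y) by simp [SemiconjBy, mul_assoc]).pow_right m
    rw [pow_succ, ← mul_assoc, ← h, trace_mul_comm, ← mul_assoc, ← pow_succ']

lemma schattenPow_transpose (k : ℕ) (A : Matrix n n ℝ) : schattenPow k Aᵀ = schattenPow k A := by
  unfold schattenPow
  rw [transpose_transpose, trace_mul_pow_comm]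

/-- The singular values of `A * Aᵀ` are the squares of those of `A`, so the exponent doubles. This
drives the induction on `k`. -/
lemma schattenPow_mul_transpose (k : ℕ) (A : Matrix n n ℝ) :
    schattenPow k (A * Aᵀ) = schattenPow (k + 1) A := by
  unfold schattenPow
  rw [transpose_mul, transpose_transpose, ← pow_two, ← pow_mul, pow_succ, mul_comm]

lemma prod_range_pairs {R : Type*} [Monoid R] (B : ℕ → R) (m : ℕ) :
    ((List.range (2 * m)).map B).prod
      = ((List.range m).map fun j => B (2 * j) * B (2 * j + 1)).prod := by
  induction m with
  | zero => simp
  | succ m ih =>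
    rw [mul_add, mul_one, List.range_succ, List.range_succ, List.range_succ]
    simp [ih]

lemma finset_prod_range_pairs {R : Type*} [CommMonoid R] (B : ℕ → R) (m : ℕ) :
    ∏ i ∈ Finset.range (2 * m), B i = ∏ j ∈ Finset.range m, B (2 * j) * B (2 * j + 1) := by
  induction m with
  | zero => simp
  | succ m ih =>
    rw [mul_add, mul_one, Finset.prod_range_succ, Finset.prod_range_succ, Finset.prod_range_succ,
      ih, mul_assoc]

/-- The alternating word `X Y X Y ⋯`. -/
def alternate {R : Type*} (X Y : R) (i : ℕ) : R := if i % 2 = 0 then X else Y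

lemma prod_alternate {R : Type*} [Monoid R] (X Y : R) (m : ℕ) :
    ((List.range (2 * m)).map (alternate X Y)).prod = (X * Y) ^ m := by
  rw [prod_range_pairs]
  have : (fun j => alternate X Y (2 * j) * alternate X Y (2 * j + 1)) = fun _ => X * Y := by
    funext j
    simp [alternate, Nat.add_mod]
  rw [this]
  simp

/-- Hölder's inequality for the trace of a product of `2^(k+1)` matrices. -/
theorem abs_trace_prod_pow_le (k : ℕ) (B : ℕ → Matrix n n ℝ) :
    |(((List.range (2 ^ (k + 1))).map B).prod).trace| ^ 2 ^ (k + 1)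
      ≤ ∏ i ∈ Finset.range (2 ^ (k + 1)), schattenPow k (B i) := by
  induction k generalizing B with
  | zero =>
    have := trace_mul_sq_le (B 0) (B 1)
    simpa [schattenPow, List.range_succ, Finset.prod_range_succ] using this
  | succ k ih =>
    -- By cyclicity of the trace, `schattenPow k (X * Y)` is the trace of a word alternating `Y *
    -- Yᵀ` and `Xᵀ * X`. The induction hypothesis for this word, followed by a `2^k`-th root, bounds
    -- a product of two matrices at the next level.
    have key : ∀ X Y : Matrix n n ℝ,
        schattenPow k (X * Y) ^ 2 ≤ schattenPow (k + 1) X * schattenPow (k + 1) Y := by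
      intro X Y
      have h := ih (alternate (Y * Yᵀ) (Xᵀ * X))
      rw [pow_succ' 2 k, prod_alternate, finset_prod_range_pairs] at h
      have e : ∀ j, schattenPow k (alternate (Y * Yᵀ) (Xᵀ * X) (2 * j)) *
          schattenPow k (alternate (Y * Yᵀ) (Xᵀ * X) (2 * j + 1))
          = schattenPow (k + 1) X * schattenPow (k + 1) Y := by
        intro j
        have h1 : alternate (Y * Yᵀ) (Xᵀ * X) (2 * j) = Y * Yᵀ := by simp [alternate]
        have h2 : alternate (Y * Yᵀ) (Xᵀ * X) (2 * j + 1) = Xᵀ * X := by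
          simp [alternate, Nat.add_mod]
        have h3 := schattenPow_mul_transpose k Xᵀ
        rw [transpose_transpose, schattenPow_transpose] at h3
        rw [h1, h2, schattenPow_mul_transpose, h3, mul_comm]
      simp only [e, Finset.prod_const, Finset.card_range] at h
      have h4 : ((Y * Yᵀ * (Xᵀ * X)) ^ 2 ^ k).trace = schattenPow k (X * Y) := by
        unfold schattenPow
        rw [transpose_mul, mul_assoc X, trace_mul_pow_comm X, mul_assoc, mul_assoc, mul_assoc]
      rw [h4, abs_of_nonneg (schattenPow_nonneg _ _), pow_mul] at h
      exact (pow_le_pow_iff_left₀ (sq_nonneg _)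
        (mul_nonneg (schattenPow_nonneg _ _) (schattenPow_nonneg _ _)) (by positivity)).1 h
    -- Consecutive letters are multiplied in pairs, which halves the length of the word; the
    -- induction hypothesis applies to the pairs and `key` splits each of them.
    rw [pow_succ' 2 (k + 1), prod_range_pairs, finset_prod_range_pairs, mul_comm 2, pow_mul]
    refine (pow_le_pow_left₀ (by positivity) (ih _) 2).trans ?_
    rw [← Finset.prod_pow]
    exact Finset.prod_le_prod (fun _ _ => sq_nonneg _) fun j _ => key _ _

/-- The Schatten norm of exponent `2^(k+1)`. -/
def schatten (k : ℕ) (A : Matrix n n ℝ) : ℝ := schattenPow k A ^ (((2 ^ (k + 1) : ℕ) : ℝ)⁻¹)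

lemma schatten_nonneg (k : ℕ) (A : Matrix n n ℝ) : 0 ≤ schatten k A :=
  Real.rpow_nonneg (schattenPow_nonneg _ _) _

lemma schatten_pow (k : ℕ) (A : Matrix n n ℝ) : schatten k A ^ 2 ^ (k + 1) = schattenPow k A :=
  Real.rpow_inv_natCast_pow (schattenPow_nonneg _ _) (by positivity)

lemma schatten_transpose (k : ℕ) (A : Matrix n n ℝ) : schatten k Aᵀ = schatten k A := by
  rw [schatten, schattenPow_transpose, schatten]

lemma abs_trace_prod_le (k : ℕ) (B : ℕ → Matrix n n ℝ) :
    |(((List.range (2 ^ (k + 1))).map B).prod).trace|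
      ≤ ∏ i ∈ Finset.range (2 ^ (k + 1)), schatten k (B i) := by
  rw [← pow_le_pow_iff_left₀ (abs_nonneg _) (Finset.prod_nonneg fun _ _ => schatten_nonneg _ _)
    (n := 2 ^ (k + 1)) (by positivity), ← Finset.prod_pow]
  simpa only [schatten_pow] using abs_trace_prod_pow_le k B

/-- The expansion of the power of the Schatten norm along a line, by the words in two letters. -/
theorem exists_schattenPow_add_smul (k : ℕ) (A X : Matrix n n ℝ) :
    ∃ c : Finset (Fin (2 ^ (k + 1))) → ℝ,
      (∀ t : ℝ, schattenPow k (A + t • X) = ∑ s, t ^ s.card * c s) ∧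
      ∀ s, |c s| ≤ schatten k X ^ s.card * schatten k A ^ (2 ^ (k + 1) - s.card) := by
  -- The trace of the alternating word in A and Aᵀ is a multilinear function of its letters, so
  -- replacing A by A + tX expands it over the sets of positions that receive X.
  let f : MultilinearMap ℝ (fun _ : Fin (2 ^ (k + 1)) => Matrix n n ℝ) ℝ :=
    (traceLinearMap n ℝ ℝ).compMultilinearMap
      (MultilinearMap.mkPiAlgebraFin ℝ (2 ^ (k + 1)) (Matrix n n ℝ))
  let w : Matrix n n ℝ → Fin (2 ^ (k + 1)) → Matrix n n ℝ := fun Z i => alternate Z Zᵀ i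
  have hf : ∀ B : ℕ → Matrix n n ℝ, f (fun i => B i)
      = (((List.range (2 ^ (k + 1))).map B).prod).trace := by
    intro B
    simp only [f, LinearMap.compMultilinearMap_apply, MultilinearMap.mkPiAlgebraFin_apply,
      traceLinearMap_apply, List.ofFn_eq_map, ← List.map_coe_finRange_eq_range, List.map_map]
    rfl
  have hw : ∀ Z, f (w Z) = schattenPow k Z := by
    intro Z
    rw [hf, pow_succ', prod_alternate, schattenPow]
  refine ⟨fun s => f (s.piecewise (w X) (w A)), fun t => ?_, fun s => ?_⟩
  · have e : w (A + t • X) = (fun i => t • w X i) + w A := by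
      funext i
      simp only [w, alternate, Pi.add_apply]
      split_ifs <;> simp [add_comm]
    rw [← hw, e, MultilinearMap.map_add_univ]
    refine Finset.sum_congr rfl fun s _ => ?_
    have h := f.map_piecewise_smul (fun _ => t) (s.piecewise (w X) (w A)) s
    rw [Finset.prod_const, smul_eq_mul] at h
    rw [← h]
    congr 1
    funext i
    by_cases hi : i ∈ s <;> simp [hi]
  · change |f (s.piecewise (w X) (w A))| ≤ _
    -- Hölder's inequality takes letters indexed by ℕ; the value 0 beyond the length of the word is
    -- never read.
    let B : ℕ → Matrix n n ℝ := fun i =>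
      if h : i < 2 ^ (k + 1) then s.piecewise (w X) (w A) ⟨i, h⟩ else 0
    have hB : s.piecewise (w X) (w A) = fun i : Fin (2 ^ (k + 1)) => B i := by
      funext i; simp [B]
    rw [hB, hf]
    refine (abs_trace_prod_le k B).trans (le_of_eq ?_)
    have hwn : ∀ Z i, schatten k (w Z i) = schatten k Z := by
      intro Z i
      simp only [w, alternate]
      split_ifs
      · rfl
      · exact schatten_transpose _ _
    rw [Finset.prod_range]
    have : ∀ i : Fin (2 ^ (k + 1)), schatten k (B i)
        = s.piecewise (fun _ => schatten k X) (fun _ => schatten k A) i := by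
      intro i
      rw [← congrFun hB i]
      by_cases hi : i ∈ s <;> simp [hi, hwn]
    rw [Finset.prod_congr rfl fun i _ => this i, Finset.prod_piecewise]
    simp [Finset.card_sdiff]

/-- Minkowski's inequality: Hölder bounds the words in A and X termwise by the binomial expansion of
the power of the sum of the norms. -/
theorem schatten_add_le (k : ℕ) (A X : Matrix n n ℝ) :
    schatten k (A + X) ≤ schatten k A + schatten k X := by
  obtain ⟨c, hc, hb⟩ := exists_schattenPow_add_smul k A X
  rw [← pow_le_pow_iff_left₀ (schatten_nonneg _ _)
    (add_nonneg (schatten_nonneg _ _) (schatten_nonneg _ _)) (n := 2 ^ (k + 1)) (by positivity),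
    schatten_pow, add_comm (schatten k A), ← Fin.sum_pow_mul_eq_add_pow]
  have := hc 1
  simp only [one_smul, one_pow, one_mul] at this
  rw [this]
  exact Finset.sum_le_sum fun s _ => (le_abs_self _).trans (hb s)

/-- The recursion for the sum of the two powers produces a multiple of their difference, so the
induction carries a bound for the difference as well. That bound is multiplied by `W` to avoid a
division. The term 4m x² in `W` pays for all m steps, since step i needs only (4i + 1) x². -/
lemma two_point_pow_le (a x : ℝ) (m j : ℕ) (hj : j ≤ m) :
    (a + x) ^ (2 * j) + (a - x) ^ (2 * j) ≤ 2 * (a ^ 2 + 4 * m * x ^ 2) ^ j := by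
  set W := a ^ 2 + 4 * m * x ^ 2 with hW
  have hW0 : 0 ≤ W := by positivity
  have main : ∀ i ≤ m, (a + x) ^ (2 * i) + (a - x) ^ (2 * i) ≤ 2 * W ^ i ∧
      a * x * ((a + x) ^ (2 * i) - (a - x) ^ (2 * i)) * W ≤ 4 * i * (a * x) ^ 2 * W ^ i := by
    intro i
    induction i with
    | zero => intro _; norm_num
    | succ i ih =>
      intro hi
      obtain ⟨h1, h2⟩ := ih (by omega)
      have hi' : (i : ℝ) + 1 ≤ m := by exact_mod_cast hi
      set p := (a + x) ^ (2 * i)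
      set q := (a - x) ^ (2 * i)
      have ep : (a + x) ^ (2 * (i + 1)) = (a + x) ^ 2 * p := by ring
      have eq : (a - x) ^ (2 * (i + 1)) = (a - x) ^ 2 * q := by ring
      have hWi : 0 ≤ W ^ i := by positivity
      rw [ep, eq]
      have hsum : (a + x) ^ 2 * p + (a - x) ^ 2 * q
          = (a ^ 2 + x ^ 2) * (p + q) + 2 * (a * x * (p - q)) := by ring
      have hdiff : a * x * ((a + x) ^ 2 * p - (a - x) ^ 2 * q)
          = (a ^ 2 + x ^ 2) * (a * x * (p - q)) + 2 * (a * x) ^ 2 * (p + q) := by ring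
      have hax : (a * x) ^ 2 ≤ x ^ 2 * W := by
        rw [hW]; nlinarith [mul_nonneg (Nat.cast_nonneg (α := ℝ) m) (sq_nonneg (x ^ 2))]
      have hx : a ^ 2 + (4 * i + 1) * x ^ 2 ≤ W := by
        rw [hW]; nlinarith [sq_nonneg x]
      have hle : a ^ 2 + x ^ 2 ≤ W := by
        refine le_trans ?_ hx
        nlinarith [mul_nonneg (Nat.cast_nonneg (α := ℝ) i) (sq_nonneg x)]
      constructor
      · rcases hW0.eq_or_lt with h0 | hpos
        · have ha : a ^ 2 + x ^ 2 ≤ 0 := h0 ▸ hle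
          have ha' : a = 0 := by nlinarith [sq_nonneg a, sq_nonneg x]
          have hx' : x = 0 := by nlinarith [sq_nonneg a, sq_nonneg x]
          have : 0 ≤ 2 * W ^ (i + 1) := by positivity
          simpa [ha', hx'] using this
        · have h3 : a * x * (p - q) ≤ 4 * i * x ^ 2 * W ^ i := by
            refine le_of_mul_le_mul_right (h2.trans ?_) hpos
            have : 0 ≤ 4 * (i : ℝ) * W ^ i := by positivity
            nlinarith [mul_le_mul_of_nonneg_left hax this]
          rw [hsum]
          calc (a ^ 2 + x ^ 2) * (p + q) + 2 * (a * x * (p - q))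
              ≤ (a ^ 2 + x ^ 2) * (2 * W ^ i) + 2 * (4 * i * x ^ 2 * W ^ i) := by gcongr
            _ = 2 * W ^ i * (a ^ 2 + (4 * i + 1) * x ^ 2) := by ring
            _ ≤ 2 * W ^ i * W := by gcongr
            _ = 2 * W ^ (i + 1) := by ring
      · rw [hdiff]
        calc ((a ^ 2 + x ^ 2) * (a * x * (p - q)) + 2 * (a * x) ^ 2 * (p + q)) * W
            = (a ^ 2 + x ^ 2) * (a * x * (p - q) * W) + 2 * (a * x) ^ 2 * W * (p + q) := by ring
          _ ≤ (a ^ 2 + x ^ 2) * (4 * i * (a * x) ^ 2 * W ^ i)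
              + 2 * (a * x) ^ 2 * W * (2 * W ^ i) := by gcongr
          _ ≤ W * (4 * i * (a * x) ^ 2 * W ^ i) + 2 * (a * x) ^ 2 * W * (2 * W ^ i) := by gcongr
          _ = 4 * ((i + 1 : ℕ) : ℝ) * (a * x) ^ 2 * W ^ (i + 1) := by push_cast; ring
  exact (main j hj).1

/-- Uniform smoothness of the square of the Schatten norm. -/
theorem schattenPow_add_add_sub_le (k : ℕ) (A X : Matrix n n ℝ) :
    schattenPow k (A + X) + schattenPow k (A - X)
      ≤ 2 * (schatten k A ^ 2 + 4 * 2 ^ k * schatten k X ^ 2) ^ 2 ^ k := by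
  obtain ⟨c, hc, hb⟩ := exists_schattenPow_add_smul k A X
  have h1 := hc 1
  have h2 := hc (-1)
  simp only [one_smul, one_pow, one_mul, neg_smul] at h1 h2
  have h3 := two_point_pow_le (schatten k A) (schatten k X) (2 ^ k) (2 ^ k) le_rfl
  have e1 := Fin.sum_pow_mul_eq_add_pow (n := 2 ^ (k + 1)) (schatten k X) (schatten k A)
  have e2 := Fin.sum_pow_mul_eq_add_pow (n := 2 ^ (k + 1)) (-schatten k X) (schatten k A)
  push_cast at h3
  rw [← pow_succ', add_comm (schatten k A), sub_eq_neg_add, ← e1, ← e2] at h3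
  rw [sub_eq_add_neg, h1, h2]
  refine le_trans ?_ h3
  rw [← Finset.sum_add_distrib, ← Finset.sum_add_distrib]
  refine Finset.sum_le_sum fun s _ => ?_
  rw [neg_pow (schatten k X)]
  -- Words with an odd number of letters X cancel between A + X and A - X, and the others count
  -- twice. All weights are thus nonnegative, and the bounds on the words give a termwise comparison
  -- with the scalar expansion.
  have h5 : 0 ≤ 1 + (-1 : ℝ) ^ s.card := by
    rcases neg_one_pow_eq_or ℝ s.card with h | h <;> rw [h] <;> norm_num
  nlinarith [mul_le_mul_of_nonneg_left ((le_abs_self _).trans (hb s)) h5]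

lemma schattenPow_smul (k : ℕ) (t : ℝ) (A : Matrix n n ℝ) :
    schattenPow k (t • A) = t ^ 2 ^ (k + 1) * schattenPow k A := by
  unfold schattenPow
  rw [transpose_smul, smul_mul_smul_comm, ← pow_two, smul_pow, trace_smul, smul_eq_mul, ← pow_mul,
    ← pow_succ']

lemma schatten_smul (k : ℕ) (t : ℝ) (A : Matrix n n ℝ) :
    schatten k (t • A) = |t| * schatten k A := by
  rw [← pow_left_inj₀ (schatten_nonneg _ _) (mul_nonneg (abs_nonneg _) (schatten_nonneg _ _))
    (n := 2 ^ (k + 1)) (by positivity), mul_pow, schatten_pow, schatten_pow, schattenPow_smul,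
    Even.pow_abs ((even_two).pow_of_ne_zero (by omega))]

lemma continuous_schatten (k : ℕ) : Continuous (schatten k : Matrix n n ℝ → ℝ) := by
  unfold schatten schattenPow
  refine Continuous.rpow_const ?_ fun _ => Or.inr (by positivity)
  fun_prop

end Schatten

/-! ### A smooth substitute for the squared spectral norm, with modulus of order 1 + log d. -/

section SmoothNorm

open Matrix

variable {d : ℕ}

/-- The matrix of an operator in the standard basis. -/
def opMatrix (A : Op d) : Matrix (Fin d) (Fin d) ℝ := (toEuclideanCLM (𝕜 := ℝ)).symm A

lemma toEuclideanCLM_opMatrix (A : Op d) : toEuclideanCLM (𝕜 := ℝ) (opMatrix A) = A :=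
  (toEuclideanCLM (𝕜 := ℝ)).apply_symm_apply A

lemma continuous_opMatrix : Continuous (opMatrix : Op d → Matrix (Fin d) (Fin d) ℝ) :=
  LinearMap.continuous_of_finiteDimensional
    ((toEuclideanCLM (𝕜 := ℝ) (n := Fin d)).symm.toAlgEquiv.toLinearMap)

lemma norm_toEuclideanCLM_sq_le (C : Matrix (Fin d) (Fin d) ℝ) :
    ‖toEuclideanCLM (𝕜 := ℝ) C‖ ^ 2 ≤ (C * Cᵀ).trace := by
  have h0 := trace_mul_transpose_self_nonneg C
  refine (pow_le_pow_left₀ (norm_nonneg _) ?_ 2).trans_eq (Real.sq_sqrt h0)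
  refine ContinuousLinearMap.opNorm_le_bound _ (Real.sqrt_nonneg _) fun x => ?_
  refine (pow_le_pow_iff_left₀ (norm_nonneg _) (by positivity) two_ne_zero).1 ?_
  rw [mul_pow, Real.sq_sqrt h0, EuclideanSpace.norm_sq_eq, EuclideanSpace.norm_sq_eq]
  simp only [trace, diag, mul_apply, transpose_apply, ofLp_toEuclideanCLM, Real.norm_eq_abs,
    sq_abs, mulVec, dotProduct, ← pow_two]
  rw [Finset.sum_mul]
  exact Finset.sum_le_sum fun i _ => Finset.sum_mul_sq_le_sq_mul_sq _ _ _

/-- The C*-identity for the self-adjoint matrix `B * Bᵀ`. It reduces the comparison of Schatten and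
spectral norms to bounds on the trace of a single matrix. -/
lemma norm_toEuclideanCLM_mul_transpose_pow (B : Matrix (Fin d) (Fin d) ℝ) (k : ℕ) :
    ‖toEuclideanCLM (n := Fin d) (𝕜 := ℝ) ((B * Bᵀ) ^ 2 ^ k)‖
      = ‖toEuclideanCLM (n := Fin d) (𝕜 := ℝ) B‖ ^ 2 ^ (k + 1) := by
  have hs : IsSelfAdjoint (toEuclideanCLM (n := Fin d) (𝕜 := ℝ) (B * Bᵀ)) := by
    rw [← conjTranspose_eq_transpose_of_trivial, ← star_eq_conjTranspose]
    exact (IsSelfAdjoint.mul_star_self B).map (toEuclideanCLM (n := Fin d) (𝕜 := ℝ))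
  have h := IsSelfAdjoint.nnnorm_pow_two_pow (E := Op d) hs k
  rw [map_pow, ← coe_nnnorm, h, NNReal.coe_pow, coe_nnnorm, map_mul,
    ← conjTranspose_eq_transpose_of_trivial, ← star_eq_conjTranspose, map_star]
  have h2 := CStarRing.norm_self_mul_star (E := Op d) (x := toEuclideanCLM (𝕜 := ℝ) B)
  refine (congrArg (· ^ 2 ^ k) h2).trans ?_
  rw [← pow_two, ← pow_mul, pow_succ']

lemma norm_pow_le_schattenPow (k : ℕ) (B : Matrix (Fin d) (Fin d) ℝ) :
    ‖toEuclideanCLM (𝕜 := ℝ) B‖ ^ 2 ^ (k + 1) ≤ schattenPow k B := by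
  cases k with
  | zero => simpa [schattenPow] using norm_toEuclideanCLM_sq_le B
  | succ k =>
    rw [schattenPow, pow_mul_transpose_pow, pow_succ, pow_mul,
      ← norm_toEuclideanCLM_mul_transpose_pow]
    exact norm_toEuclideanCLM_sq_le _

/-- Each of the d diagonal entries of a matrix is at most its spectral norm. -/
lemma schattenPow_le (k : ℕ) (B : Matrix (Fin d) (Fin d) ℝ) :
    schattenPow k B ≤ d * ‖toEuclideanCLM (𝕜 := ℝ) B‖ ^ 2 ^ (k + 1) := by
  rw [schattenPow, trace, ← norm_toEuclideanCLM_mul_transpose_pow]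
  set D := (B * Bᵀ) ^ 2 ^ k
  have h : ∀ i ∈ Finset.univ, diag D i ≤ ‖toEuclideanCLM (𝕜 := ℝ) D‖ := by
    intro i _
    have h1 : diag D i = inner ℝ (EuclideanSpace.single i (1 : ℝ))
        (toEuclideanCLM (𝕜 := ℝ) D (EuclideanSpace.single i (1 : ℝ))) := by
      rw [EuclideanSpace.inner_single_left, ofLp_toEuclideanCLM]
      simp
    rw [h1]
    refine (real_inner_le_norm _ _).trans ?_
    have := (toEuclideanCLM (𝕜 := ℝ) D).le_opNorm (EuclideanSpace.single i (1 : ℝ))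
    simpa using this
  refine (Finset.sum_le_card_nsmul _ _ _ h).trans_eq ?_
  simp

/-- The square of the Schatten norm of exponent `2^(k+1)` of an operator. -/
def schattenSq (k : ℕ) (A : Op d) : ℝ := schatten k (opMatrix A) ^ 2

lemma opMatrix_add (A B : Op d) : opMatrix (A + B) = opMatrix A + opMatrix B :=
  map_add (toEuclideanCLM (𝕜 := ℝ) (n := Fin d)).symm A B

lemma opMatrix_sub (A B : Op d) : opMatrix (A - B) = opMatrix A - opMatrix B :=
  map_sub (toEuclideanCLM (𝕜 := ℝ) (n := Fin d)).symm A B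

lemma opMatrix_smul (t : ℝ) (A : Op d) : opMatrix (t • A) = t • opMatrix A :=
  map_smul (toEuclideanCLM (𝕜 := ℝ) (n := Fin d)).symm t A

lemma convexOn_schatten (k : ℕ) :
    ConvexOn ℝ Set.univ fun A : Op d => schatten k (opMatrix A) := by
  refine ⟨convex_univ, fun A _ B _ a b ha hb _ => ?_⟩
  simp only [opMatrix_add, opMatrix_smul, smul_eq_mul]
  refine (schatten_add_le _ _ _).trans ?_
  rw [schatten_smul, schatten_smul, abs_of_nonneg ha, abs_of_nonneg hb]

/-- Midpoint convexity of the j-th power; it strips the outer power from the smoothness inequality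
for Schatten powers. -/
lemma half_pow_add_pow_le {u v W : ℝ} (hu : 0 ≤ u) (hv : 0 ≤ v) (hW : 0 ≤ W) (j : ℕ) (hj : j ≠ 0)
    (h : u ^ j + v ^ j ≤ 2 * W ^ j) : u + v ≤ 2 * W := by
  have hc : ConvexOn ℝ (Set.Ici 0) fun x : ℝ => x ^ j := convexOn_pow j
  have h1 := hc.2 (Set.mem_Ici.2 hu) (Set.mem_Ici.2 hv)
    (by norm_num : (0 : ℝ) ≤ 1 / 2) (by norm_num : (0 : ℝ) ≤ 1 / 2) (by norm_num)
  simp only [smul_eq_mul] at h1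
  have h2 : (1 / 2 * u + 1 / 2 * v) ^ j ≤ W ^ j := by linarith
  have := (pow_le_pow_iff_left₀ (by positivity) hW hj).1 h2
  linarith

/-- A smooth function comparable with the square of the operator norm, with smoothness modulus
`κ` of the order of `1 + log d`. -/
structure IsSmoothNormSq (κ : ℝ) (ψ : Op d → ℝ) : Prop where
  continuous : Continuous ψ
  norm_sq_le : ∀ A, ‖A‖ ^ 2 ≤ ψ A
  le_norm_sq : ∀ A, ψ A ≤ 8 * ‖A‖ ^ 2
  smul : ∀ (t : ℝ) A, ψ (t • A) = t ^ 2 * ψ A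
  convexOn : ConvexOn ℝ Set.univ ψ
  convexOn_sq : ConvexOn ℝ Set.univ fun A => ψ A ^ 2
  smooth : ∀ A X, ψ (A + X) + ψ (A - X) ≤ 2 * (ψ A + κ * ψ X)
  smooth_sq : ∀ A X, ψ (A + X) ^ 2 + ψ (A - X) ^ 2 ≤ 2 * (ψ A + κ * ψ X) ^ 2

/-- When the exponent p = 2^(k+1) is at least log d, the dimensional factor d^{1/p} is at most e,
and e² < 8. The smoothness inequality carries the outer power 2^k of the squared norm: stripping all
of it gives `smooth`, and stripping 2^(k-1) of it, possible since k ≥ 1, gives `smooth_sq`. -/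
lemma isSmoothNormSq_schattenSq {k : ℕ} (hk : 1 ≤ k) (hd : Real.log d ≤ 2 ^ (k + 1)) :
    IsSmoothNormSq (4 * 2 ^ k) (schattenSq k : Op d → ℝ) where
  continuous := ((continuous_schatten k).comp continuous_opMatrix).pow 2
  norm_sq_le A := by
    refine pow_le_pow_left₀ (norm_nonneg _) ?_ 2
    refine (pow_le_pow_iff_left₀ (norm_nonneg _) (schatten_nonneg _ _)
      (n := 2 ^ (k + 1)) (by positivity)).1 ?_
    rw [schatten_pow]
    simpa only [toEuclideanCLM_opMatrix] using norm_pow_le_schattenPow k (opMatrix A)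
  le_norm_sq A := by
    have h1 : schatten k (opMatrix A) ≤ Real.exp 1 * ‖A‖ := by
      refine (pow_le_pow_iff_left₀ (schatten_nonneg _ _) (by positivity)
        (n := 2 ^ (k + 1)) (by positivity)).1 ?_
      rw [schatten_pow]
      refine (schattenPow_le k (opMatrix A)).trans ?_
      rw [toEuclideanCLM_opMatrix, mul_pow]
      gcongr
      rw [← Real.exp_nat_mul, mul_one]
      rcases Nat.eq_zero_or_pos d with rfl | hpos
      · simpa using (Real.exp_pos _).le
      · rw [← Real.log_le_iff_le_exp (by exact_mod_cast hpos)]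
        exact_mod_cast hd
    have h2 := Real.exp_one_lt_d9
    calc schatten k (opMatrix A) ^ 2 ≤ (Real.exp 1 * ‖A‖) ^ 2 :=
          pow_le_pow_left₀ (schatten_nonneg _ _) h1 2
      _ = Real.exp 1 ^ 2 * ‖A‖ ^ 2 := mul_pow _ _ _
      _ ≤ 8 * ‖A‖ ^ 2 := by
        gcongr
        nlinarith [Real.exp_pos 1]
  smul t A := by
    simp only [schattenSq, opMatrix_smul, schatten_smul, mul_pow, sq_abs]
  convexOn := (convexOn_schatten k).pow (fun _ _ => schatten_nonneg _ _) 2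
  convexOn_sq := by
    have := (convexOn_schatten (d := d) k).pow (fun _ _ => schatten_nonneg _ _) 4
    refine this.congr fun A _ => ?_
    simp only [schattenSq, Pi.pow_apply, ← pow_mul]
  smooth A X := by
    have h := schattenPow_add_add_sub_le k (opMatrix A) (opMatrix X)
    rw [← opMatrix_add, ← opMatrix_sub, ← schatten_pow, ← schatten_pow, pow_succ' 2 k, pow_mul,
      pow_mul] at h
    exact half_pow_add_pow_le (sq_nonneg _) (sq_nonneg _)
      (add_nonneg (sq_nonneg _) (mul_nonneg (by positivity) (sq_nonneg _))) (2 ^ k) (by positivity) h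
  smooth_sq A X := by
    have h := schattenPow_add_add_sub_le k (opMatrix A) (opMatrix X)
    rw [← opMatrix_add, ← opMatrix_sub, ← schatten_pow, ← schatten_pow, pow_succ' 2 k, pow_mul,
      pow_mul] at h
    obtain ⟨j, rfl⟩ := Nat.exists_eq_add_of_le' hk
    rw [pow_succ' (2 : ℕ) j, pow_mul _ 2, pow_mul _ 2, pow_mul _ 2] at h
    exact half_pow_add_pow_le (sq_nonneg _) (sq_nonneg _) (sq_nonneg _) (2 ^ j) (by positivity) h

theorem exists_isSmoothNormSq (d : ℕ) :
    ∃ (κ : ℝ) (ψ : Op d → ℝ), 0 ≤ κ ∧ κ ≤ 12 * (1 + Real.log d) ∧ IsSmoothNormSq κ ψ := by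
  have hlog : 0 ≤ Real.log d := Real.log_natCast_nonneg d
  -- The exponent is 2^(k+1) with 2^k the largest power of 2 not exceeding n. Then 2^(k+1) > n ≥ log
  -- d, while 4 · 2^k ≤ 4 (log d + 3) ≤ 12 (1 + log d). The summand 2 ensures k ≥ 1.
  set n := ⌈Real.log d⌉₊ + 2 with hn
  have hn0 : n ≠ 0 := by omega
  have h1 : 2 ^ Nat.log 2 n ≤ n := Nat.pow_log_le_self 2 hn0
  have h2 : n < 2 ^ (Nat.log 2 n + 1) := Nat.lt_pow_succ_log_self (by norm_num) n
  have h3 : (n : ℝ) ≤ Real.log d + 3 := by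
    have := Nat.ceil_lt_add_one hlog
    rw [hn]; push_cast; linarith
  have h1' : (2 : ℝ) ^ Nat.log 2 n ≤ n := by exact_mod_cast h1
  refine ⟨4 * 2 ^ Nat.log 2 n, schattenSq (Nat.log 2 n), by positivity, by linarith,
    isSmoothNormSq_schattenSq (Nat.log_pos (by norm_num) (by omega)) ?_⟩
  have h4 : (n : ℝ) ≤ 2 ^ (Nat.log 2 n + 1) := by exact_mod_cast h2.le
  refine le_trans ?_ h4
  have := Nat.le_ceil (Real.log d)
  rw [hn]; push_cast; linarith

end SmoothNorm

/-! ### One cubic step with inexact gradient and Hessian. -/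

section Deterministic

variable {d : ℕ}

/-- The mean value inequality on the ball of radius ‖y - x‖, where the Hessian deviates from its
value at x by at most L‖y - x‖. The sharp constant L/2 is not needed. -/
lemma norm_gradient_sub_sub_le {f : Vec d → ℝ} {L : ℝ} (hf : TwiceDifferentiable f) (hL0 : 0 ≤ L)
    (hL : ∀ x y, ‖hess f x - hess f y‖ ≤ L * ‖x - y‖) (x y : Vec d) :
    ‖gradient f y - gradient f x - hess f x (y - x)‖ ≤ L * ‖y - x‖ ^ 2 := by
  have h := Convex.norm_image_sub_le_of_norm_hasFDerivWithin_le' (𝕜 := ℝ)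
    (s := Metric.closedBall x ‖y - x‖) (x := x) (y := y) (C := L * ‖y - x‖) (φ := hess f x)
    (fun z _ => ((hf.2 z).hasFDerivAt).hasFDerivWithinAt)
    (fun z hz => (hL z x).trans (by
      rw [mem_closedBall_iff_norm] at hz; gcongr))
    (convex_closedBall _ _) (Metric.mem_closedBall_self (norm_nonneg _))
    (by rw [mem_closedBall_iff_norm])
  rwa [mul_assoc, ← pow_two] at h

lemma hasFDerivAt_innerSL_gradient {f : Vec d → ℝ} (hf : Differentiable ℝ f) (x : Vec d) :
    HasFDerivAt f (innerSL ℝ (gradient f x)) x :=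
  (hf x).hasGradientAt.hasFDerivAt

lemma hess_symm {f : Vec d → ℝ} (hf : TwiceDifferentiable f) (x u v : Vec d) :
    inner ℝ (hess f x u) v = inner ℝ u (hess f x v) := by
  have h1 : HasFDerivAt (fun y => innerSL ℝ (gradient f y)) ((innerSL ℝ).comp (hess f x)) x :=
    (innerSL ℝ : Vec d →L[ℝ] _).hasFDerivAt.comp x (hf.2 x).hasFDerivAt
  have h2 := second_derivative_symmetric (hasFDerivAt_innerSL_gradient hf.1) h1 u v
  have h3 : inner ℝ (hess f x u) v = inner ℝ (hess f x v) u := h2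
  rw [h3, real_inner_comm]

lemma le_cubic_upper_model {f : Vec d → ℝ} {L : ℝ} (hf : TwiceDifferentiable f) (hL0 : 0 ≤ L)
    (hL : ∀ x y, ‖hess f x - hess f y‖ ≤ L * ‖x - y‖) (x y : Vec d) :
    f y ≤ f x + inner ℝ (gradient f x) (y - x) + 1 / 2 * inner ℝ (hess f x (y - x)) (y - x)
      + L * ‖y - x‖ ^ 3 := by
  set h := y - x with hh
  set A := hess f x
  -- φ(1) - φ(0) is the error of the quadratic Taylor model, and φ'(t) is the first-order remainder
  -- of the gradient paired with h.
  let φ : ℝ → ℝ := fun t => f (x + t • h) - t ^ 2 / 2 * inner ℝ (A h) h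
    - t * inner ℝ (gradient f x) h
  have hd : ∀ t : ℝ, HasDerivAt φ (inner ℝ (gradient f (x + t • h) - gradient f x - A (t • h)) h) t := by
    intro t
    have h1 : HasDerivAt (fun t : ℝ => x + t • h) h t := by
      simpa using ((hasDerivAt_id t).smul_const h).const_add x
    have h2 := (hasFDerivAt_innerSL_gradient hf.1 (x + t • h)).comp_hasDerivAt t h1
    have h3 := (((hasDerivAt_id t).pow 2).div_const 2).mul_const (inner ℝ (A h) h)
    have h4 := (hasDerivAt_id t).mul_const (inner ℝ (gradient f x) h)
    refine ((h2.sub h3).sub h4).congr_deriv ?_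
    simp [inner_sub_left, inner_smul_left]
    ring
  have hb : ∀ t ∈ Set.Icc (0 : ℝ) 1,
      ‖inner ℝ (gradient f (x + t • h) - gradient f x - A (t • h)) h‖ ≤ L * ‖h‖ ^ 3 := by
    intro t ht
    have h1 := norm_gradient_sub_sub_le hf hL0 hL x (x + t • h)
    rw [add_sub_cancel_left, norm_smul, Real.norm_of_nonneg ht.1] at h1
    have h2 : t * ‖h‖ ≤ ‖h‖ := mul_le_of_le_one_left (norm_nonneg _) ht.2
    calc _ ≤ ‖gradient f (x + t • h) - gradient f x - A (t • h)‖ * ‖h‖ := norm_inner_le_norm _ _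
      _ ≤ (L * (t * ‖h‖) ^ 2) * ‖h‖ := by gcongr
      _ ≤ (L * ‖h‖ ^ 2) * ‖h‖ := by
        have : 0 ≤ t * ‖h‖ := mul_nonneg ht.1 (norm_nonneg _)
        gcongr
      _ = L * ‖h‖ ^ 3 := by ring
  have key := Convex.norm_image_sub_le_of_norm_hasDerivWithin_le
    (fun t _ => (hd t).hasDerivWithinAt) hb (convex_Icc 0 1)
    (Set.left_mem_Icc.2 zero_le_one) (Set.right_mem_Icc.2 zero_le_one)
  have e1 : φ 1 = f y - 1 / 2 * inner ℝ (A h) h - inner ℝ (gradient f x) h := by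
    simp [φ, hh]
  have e0 : φ 0 = f x := by simp [φ]
  rw [e1, e0, sub_zero, norm_one, mul_one] at key
  have := (le_abs_self _).trans key
  linarith

section CubicStep

variable {M : ℝ} {g : Vec d} {H : Op d} {x y : Vec d}

lemma cubicModel_first_order (hH : ∀ u v, inner ℝ (H u) v = inner ℝ u (H v))
    (hmin : IsMinOn (cubicModel M g H x) Set.univ y) :
    g + H (y - x) + (M / 2 * ‖y - x‖) • (y - x) = 0 := by
  set h := y - x with hh
  have hs : HasFDerivAt (fun z : Vec d => z - x) (ContinuousLinearMap.id ℝ (Vec d)) y :=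
    (hasFDerivAt_id y).sub_const x
  have h1 : HasFDerivAt (fun z => inner ℝ g (z - x)) ((innerSL ℝ g).comp (.id ℝ (Vec d))) y :=
    (innerSL ℝ g).hasFDerivAt.comp y hs
  have h2 := ((H.hasFDerivAt.comp y hs).inner ℝ hs).const_mul (1 / 2 : ℝ)
  have h3 := ((hasFDerivAt_norm_rpow (y - x) (p := 3) (by norm_num)).comp y hs).const_mul (M / 6)
  have h4 := (h1.add h2).add h3
  have h5 : HasFDerivAt (cubicModel M g H x) _ y := h4.congr_of_eventuallyEq
    (Filter.Eventually.of_forall fun z => by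
      simp [cubicModel])
  have h6 := (hmin.isLocalMin Filter.univ_mem).hasFDerivAt_eq_zero h5
  refine ext_inner_right ℝ fun v => ?_
  have h7 := DFunLike.congr_fun h6 v
  have e : (3 - 2 : ℝ) = 1 := by norm_num
  have hs' : inner ℝ (H h) v = inner ℝ (H v) h := by rw [hH, real_inner_comm]
  simp [e, ← hh] at h7
  simp only [inner_add_left, inner_smul_left, inner_zero_left, conj_trivial]
  rw [hs']
  linarith

/-- Reflecting the step, y - x ↦ -(y - x), changes only the linear term of the model. -/
lemma cubicModel_inner_nonpos (hmin : IsMinOn (cubicModel M g H x) Set.univ y) :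
    inner ℝ g (y - x) ≤ 0 := by
  have h := hmin (Set.mem_univ (x - (y - x)))
  have e : x - (y - x) - x = -(y - x) := by abel
  simp only [Set.mem_ofPred_eq, cubicModel, e, inner_neg_right, map_neg, inner_neg_left,
    norm_neg] at h
  linarith

/-- The minimality inequalities at y + w and y - w are added: the terms linear in w cancel and the
quadratic form at w remains. -/
lemma cubicModel_inner_ge_aux (hM : 0 ≤ M) (hmin : IsMinOn (cubicModel M g H x) Set.univ y)
    (w : Vec d) :
    -(M / 3 * ((‖y - x‖ + ‖w‖) ^ 3 - ‖y - x‖ ^ 3)) ≤ inner ℝ (H w) w := by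
  have h1 := hmin (Set.mem_univ (y + w))
  have h2 := hmin (Set.mem_univ (y - w))
  have e1 : y + w - x = (y - x) + w := by abel
  have e2 : y - w - x = (y - x) - w := by abel
  simp only [Set.mem_ofPred_eq, cubicModel, e1, e2] at h1 h2
  set h := y - x
  have h3 : ‖h + w‖ ^ 3 ≤ (‖h‖ + ‖w‖) ^ 3 := pow_le_pow_left₀ (norm_nonneg _) (norm_add_le _ _) 3
  have h4 : ‖h - w‖ ^ 3 ≤ (‖h‖ + ‖w‖) ^ 3 := pow_le_pow_left₀ (norm_nonneg _) (norm_sub_le _ _) 3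
  simp only [inner_add_left, inner_add_right, inner_sub_left, inner_sub_right, map_add,
    map_sub] at h1 h2
  nlinarith [mul_le_mul_of_nonneg_left h3 hM, mul_le_mul_of_nonneg_left h4 hM]

/-- The test vector parallel to v of length ‖y - x‖ gives (2³ - 1)/3 = 7/3. When y = x, a short
multiple of v rules out negative curvature. -/
lemma cubicModel_second_order (hM : 0 ≤ M) (hmin : IsMinOn (cubicModel M g H x) Set.univ y)
    (v : Vec d) : -(7 / 3 * M * ‖y - x‖ * ‖v‖ ^ 2) ≤ inner ℝ (H v) v := by
  rcases eq_or_ne v 0 with rfl | hv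
  · simp
  have hn : 0 < ‖v‖ := norm_pos_iff.2 hv
  have key : ∀ t : ℝ, 0 < t →
      -(M / 3 * (3 * ‖y - x‖ ^ 2 * ‖v‖ + 3 * ‖y - x‖ * t * ‖v‖ ^ 2 + t ^ 2 * ‖v‖ ^ 3))
        ≤ t * inner ℝ (H v) v := by
    intro t ht
    have h := cubicModel_inner_ge_aux hM hmin (t • v)
    rw [map_smul, inner_smul_left, inner_smul_right, norm_smul, Real.norm_of_nonneg ht.le] at h
    refine le_of_mul_le_mul_left ?_ ht
    simp only [conj_trivial] at h
    linarith
  rcases (norm_nonneg (y - x)).eq_or_lt with h0 | hr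
  · rw [← h0] at key ⊢
    by_contra! hlt
    simp only [mul_zero, zero_mul, neg_zero] at hlt
    have hMn : 0 ≤ M / 3 * ‖v‖ ^ 3 := by positivity
    set I := inner ℝ (H v) v
    have h1 := key (-I / (M / 3 * ‖v‖ ^ 3 + 1)) (div_pos (by linarith) (by linarith))
    set t := -I / (M / 3 * ‖v‖ ^ 3 + 1) with ht
    have htp : 0 < t := div_pos (by linarith) (by linarith)
    have h2 : t * (M / 3 * ‖v‖ ^ 3 + 1) = -I := by rw [ht]; field_simp
    nlinarith [mul_pos htp htp]
  · have h := key (‖y - x‖ / ‖v‖) (div_pos hr hn)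
    refine le_of_mul_le_mul_left (le_trans (le_of_eq ?_) h) (div_pos hr hn)
    field_simp
    ring

lemma lambdaMin_ge {A : Op d} {c : ℝ} (hc : 0 ≤ c)
    (h : ∀ v, -(c * ‖v‖ ^ 2) ≤ inner ℝ (A v) v) : -c ≤ lambdaMin A := by
  rw [lambdaMin]
  rcases Set.eq_empty_or_nonempty
    {l : ℝ | Module.End.HasEigenvalue (A : Vec d →ₗ[ℝ] Vec d) l} with he | hne
  -- Without real eigenvalues `lambdaMin` takes the value sInf ∅ = 0; this is where `0 ≤ c` enters.
  · rw [he, Real.sInf_empty]; linarith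
  · refine le_csInf hne fun l hl => ?_
    obtain ⟨v, hv⟩ := hl.exists_hasEigenvector
    have h1 := h v
    have h2 : A v = l • v := hv.apply_eq_smul
    rw [h2, inner_smul_left, real_inner_self_eq_norm_sq] at h1
    have hn : 0 < ‖v‖ ^ 2 := by have := norm_pos_iff.2 hv.2; positivity
    simp only [conj_trivial] at h1
    nlinarith

lemma rpow_three_halves_sq {t : ℝ} (ht : 0 ≤ t) : (t ^ 2) ^ (3 / 2 : ℝ) = t ^ 3 := by
  rw [← Real.rpow_natCast, ← Real.rpow_mul ht, ← Real.rpow_natCast]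
  norm_num

lemma rpow_three_halves_eq_sqrt {t : ℝ} (ht : 0 ≤ t) : t ^ (3 / 2 : ℝ) = √t ^ 3 := by
  rw [← rpow_three_halves_sq (Real.sqrt_nonneg t), Real.sq_sqrt ht]

lemma three_add_rpow_le {a b c : ℝ} (ha : 0 ≤ a) (hb : 0 ≤ b) (hc : 0 ≤ c) :
    (a + b + c) ^ (3 / 2 : ℝ) ≤ 6 * (a ^ (3 / 2 : ℝ) + b ^ (3 / 2 : ℝ) + c ^ (3 / 2 : ℝ)) := by
  have h3 : (3 : ℝ) ^ (3 / 2 : ℝ) ≤ 6 := by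
    rw [rpow_three_halves_eq_sqrt (by norm_num)]
    have h1 : √(3 : ℝ) ≤ 7 / 4 := Real.sqrt_le_iff.2 (by norm_num)
    have h2 := pow_le_pow_left₀ (Real.sqrt_nonneg 3) h1 3
    norm_num at h2 ⊢
    linarith
  have key : ∀ m : ℝ, 0 ≤ m → a + b + c ≤ 3 * m →
      (a + b + c) ^ (3 / 2 : ℝ) ≤ 6 * m ^ (3 / 2 : ℝ) := by
    intro m hm h
    calc _ ≤ (3 * m) ^ (3 / 2 : ℝ) := by gcongr
      _ = 3 ^ (3 / 2 : ℝ) * m ^ (3 / 2 : ℝ) := Real.mul_rpow (by norm_num) hm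
      _ ≤ _ := by gcongr
  have ha' : 0 ≤ a ^ (3 / 2 : ℝ) := by positivity
  have hb' : 0 ≤ b ^ (3 / 2 : ℝ) := by positivity
  have hc' : 0 ≤ c ^ (3 / 2 : ℝ) := by positivity
  rcases le_total a b with h1 | h1 <;> rcases le_total b c with h2 | h2 <;>
    rcases le_total a c with h4 | h4 <;>
    first
    | (have := key a ha (by linarith); linarith)
    | (have := key b hb (by linarith); linarith)
    | (have := key c hc (by linarith); linarith)

/-- The progress of one cubic step with inexact gradient and Hessian. -/
theorem cubic_step_decrease {f : Vec d → ℝ} {L : ℝ} (hf : TwiceDifferentiable f) (hL0 : 0 ≤ L)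
    (hL : ∀ x y, ‖hess f x - hess f y‖ ≤ L * ‖x - y‖)
    (hH : ∀ u v, inner ℝ (H u) v = inner ℝ u (H v))
    (hmin : IsMinOn (cubicModel M g H x) Set.univ y) :
    (M / 4 - L) * ‖y - x‖ ^ 3 - ‖g - gradient f x‖ * ‖y - x‖
      - 1 / 2 * ‖H - hess f x‖ * ‖y - x‖ ^ 2 ≤ f x - f y := by
  have h1 := le_cubic_upper_model hf hL0 hL x y
  have h2 := cubicModel_first_order hH hmin
  have h3 := cubicModel_inner_nonpos hmin
  set h := y - x
  -- Stationarity along h eliminates the quadratic term of the upper model. What is left is M/4 ‖h‖³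
  -- - ½⟨g, h⟩ plus errors, and ⟨g, h⟩ ≤ 0, so no curvature condition is needed for the decrease.
  have h4 : inner ℝ g h + inner ℝ (H h) h + M / 2 * ‖h‖ ^ 3 = 0 := by
    have := congrArg (fun z => inner ℝ z h) h2
    simp only [inner_add_left, inner_smul_left, inner_zero_left, real_inner_self_eq_norm_sq,
      conj_trivial] at this
    linarith
  have h5 : -(‖g - gradient f x‖ * ‖h‖) ≤ inner ℝ (g - gradient f x) h :=
    (abs_le.1 (abs_real_inner_le_norm _ _)).1
  have h6 : -(‖H - hess f x‖ * ‖h‖ ^ 2) ≤ inner ℝ ((H - hess f x) h) h := by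
    have a1 := (abs_le.1 (abs_real_inner_le_norm ((H - hess f x) h) h)).1
    have a2 := mul_le_mul_of_nonneg_right ((H - hess f x).le_opNorm h) (norm_nonneg h)
    linarith
  simp only [inner_sub_left, _root_.sub_apply] at h5 h6
  linarith

/-- The accuracy measure after one cubic step with inexact gradient and Hessian. -/
theorem cubic_step_mu_le {f : Vec d → ℝ} {L : ℝ} (hf : TwiceDifferentiable f) (hL0 : 0 ≤ L)
    (hL : ∀ x y, ‖hess f x - hess f y‖ ≤ L * ‖x - y‖) (hM : 0 < M) (hLM : L ≤ M / 4)
    (hH : ∀ u v, inner ℝ (H u) v = inner ℝ u (H v))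
    (hmin : IsMinOn (cubicModel M g H x) Set.univ y) :
    mu f M y ≤ 108 * (√M ^ 3 * ‖y - x‖ ^ 3 + ‖g - gradient f x‖ ^ (3 / 2 : ℝ)
      + ‖H - hess f x‖ ^ 3 / √M ^ 3) := by
  have h2 := cubicModel_first_order hH hmin
  have h3 := cubicModel_second_order hM.le hmin
  have h4 := norm_gradient_sub_sub_le hf hL0 hL x y
  have h5 := hL y x
  set h := y - x
  set r := ‖h‖
  set m := √M with hm
  have hm0 : 0 < m := Real.sqrt_pos.2 hM
  have hmM : m ^ 2 = M := Real.sq_sqrt hM.le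
  set a := ‖g - gradient f x‖
  set b := ‖H - hess f x‖
  have hr : 0 ≤ r := norm_nonneg _
  have ha : 0 ≤ a := norm_nonneg _
  have hb : 0 ≤ b := norm_nonneg _
  have hX : 0 ≤ m ^ 3 * r ^ 3 := by positivity
  have hY : 0 ≤ a ^ (3 / 2 : ℝ) := by positivity
  have hZ : 0 ≤ b ^ 3 / m ^ 3 := by positivity
  refine max_le ?_ ?_
  · have e : gradient f y = (gradient f y - gradient f x - hess f x h) - (g - gradient f x)
        - (H - hess f x) h - (M / 2 * r) • h := by
      have : (M / 2 * r) • h = -(g + H h) := by rw [eq_neg_iff_add_eq_zero, add_comm]; exact h2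
      rw [this, _root_.sub_apply]; abel
    -- Terms of the form of squares become cubes under the power 3/2; the product b r is split
    -- between M r² and b²/M.
    have hg : ‖gradient f y‖ ≤ (2 * (m * r)) ^ 2 + a + (b / m) ^ 2 := by
      have n1 : ‖(H - hess f x) h‖ ≤ b * r := ContinuousLinearMap.le_opNorm _ _
      have n2 : ‖(M / 2 * r) • h‖ = M / 2 * r * r := by
        rw [norm_smul, Real.norm_of_nonneg (by positivity)]
      have n3 : b * r ≤ (m * r) ^ 2 / 2 + (b / m) ^ 2 / 2 := by
        have : b * r = (m * r) * (b / m) := by field_simp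
        nlinarith [sq_nonneg (m * r - b / m)]
      have n4 : ‖gradient f y‖ ≤ L * r ^ 2 + a + b * r + M / 2 * r * r := by
        rw [e]
        refine (norm_sub_le _ _).trans (add_le_add ((norm_sub_le _ _).trans
          (add_le_add ((norm_sub_le _ _).trans (add_le_add h4 le_rfl)) n1)) n2.le)
      have n5 : L * r ^ 2 ≤ M / 4 * r ^ 2 := by gcongr
      have n6 : (m * r) ^ 2 = M * r ^ 2 := by rw [mul_pow, hmM]
      have n7 : (2 * (m * r)) ^ 2 = 4 * (M * r ^ 2) := by rw [mul_pow, n6]; norm_num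
      have n8 : 0 ≤ M * r ^ 2 := by positivity
      have n9 : 0 ≤ (b / m) ^ 2 := by positivity
      rw [n7]; rw [n6] at n3
      linarith
    calc ‖gradient f y‖ ^ (3 / 2 : ℝ)
        ≤ ((2 * (m * r)) ^ 2 + a + (b / m) ^ 2) ^ (3 / 2 : ℝ) := by gcongr
      _ ≤ 6 * (((2 * (m * r)) ^ 2) ^ (3 / 2 : ℝ) + a ^ (3 / 2 : ℝ)
          + ((b / m) ^ 2) ^ (3 / 2 : ℝ)) := three_add_rpow_le (by positivity) ha (by positivity)
      _ = 6 * (8 * (m ^ 3 * r ^ 3) + a ^ (3 / 2 : ℝ) + b ^ 3 / m ^ 3) := by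
        rw [rpow_three_halves_sq (by positivity), rpow_three_halves_sq (by positivity)]
        congr 1
        rw [div_pow]; ring
      _ ≤ _ := by linarith
  · have hlam : -(3 * M * r + b) ≤ lambdaMin (hess f y) := by
      refine lambdaMin_ge (by positivity) fun v => ?_
      have q1 : -(b * ‖v‖ ^ 2) ≤ -inner ℝ ((H - hess f x) v) v := by
        have a1 := (abs_le.1 (abs_real_inner_le_norm ((H - hess f x) v) v)).2
        have a2 := mul_le_mul_of_nonneg_right ((H - hess f x).le_opNorm v) (norm_nonneg v)
        linarith
      have q2 : -(L * r * ‖v‖ ^ 2) ≤ inner ℝ ((hess f y - hess f x) v) v := by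
        have a1 := (abs_le.1 (abs_real_inner_le_norm ((hess f y - hess f x) v) v)).1
        have a2 := mul_le_mul_of_nonneg_right ((hess f y - hess f x).le_opNorm v) (norm_nonneg v)
        have a3 := mul_le_mul_of_nonneg_right h5 (sq_nonneg ‖v‖)
        linarith
      have q3 := h3 v
      have q4 : L * r * ‖v‖ ^ 2 ≤ M / 4 * r * ‖v‖ ^ 2 := by gcongr
      have q5 : 0 ≤ M * r * ‖v‖ ^ 2 := by positivity
      simp only [inner_sub_left, _root_.sub_apply] at q1 q2
      linarith
    have hM3 : M ^ (3 / 2 : ℝ) = m ^ 3 := rpow_three_halves_eq_sqrt hM.le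
    rw [hM3, div_le_iff₀ (by positivity)]
    -- The cube is monotone on the whole line, so the sign of the eigenvalue plays no role. The
    -- constant 108 is 4 · 3³.
    have hodd : (-lambdaMin (hess f y)) ^ 3 ≤ (3 * M * r + b) ^ 3 :=
      (Odd.strictMono_pow (by decide : Odd 3)).monotone (by linarith)
    have hcube : (3 * M * r + b) ^ 3 ≤ 4 * ((3 * M * r) ^ 3 + b ^ 3) := by
      have : 0 ≤ 3 * M * r := by positivity
      nlinarith [mul_nonneg (add_nonneg this hb) (sq_nonneg (3 * M * r - b))]
    have e1 : 108 * (m ^ 3 * r ^ 3 + a ^ (3 / 2 : ℝ) + b ^ 3 / m ^ 3) * m ^ 3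
        = 108 * (M ^ 3 * r ^ 3) + 108 * (a ^ (3 / 2 : ℝ) * m ^ 3) + 108 * b ^ 3 := by
      rw [← hmM]; field_simp
    have e2 : 0 ≤ a ^ (3 / 2 : ℝ) * m ^ 3 := by positivity
    have e3 : 0 ≤ b ^ 3 := by positivity
    rw [e1]
    have e4 : (-lambdaMin (hess f y)) ^ 3 = -lambdaMin (hess f y) ^ 3 := by ring
    rw [← e4]
    linarith

end CubicStep

end Deterministic

/-! ### The pathwise estimate: absorbing the bias into the progress of the steps. -/

section Pathwise

/-- The exponential moving average of a sequence. -/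
def ema {E : Type*} [AddCommGroup E] [Module ℝ E] (γ : ℝ) (ζ : ℕ → E) : ℕ → E
  | 0 => ζ 0
  | t + 1 => (1 - γ) • ema γ ζ t + γ • ζ (t + 1)

/-- Summing the recursion over t telescopes. The forcing carries the same factor γ as the damping,
so the sum loses no factor 1/γ. -/
lemma sum_le_of_contraction {γ : ℝ} (hγ : 0 < γ) (hγ1 : γ ≤ 1) {A C : ℕ → ℝ} (hA0 : A 0 = 0)
    (hA : ∀ t, 0 ≤ A t) (hC : ∀ t, 0 ≤ C t) (T : ℕ)
    (h : ∀ t, t + 1 < T → A (t + 1) ≤ (1 - γ) * A t + γ * C t) :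
    ∑ t ∈ Finset.range T, A t ≤ ∑ t ∈ Finset.range T, C t := by
  cases T with
  | zero => simp
  | succ T =>
    have key : ∀ n ≤ T, γ * ∑ t ∈ Finset.range (n + 1), A t + (1 - γ) * A n
        ≤ γ * ∑ t ∈ Finset.range n, C t := by
      intro n
      induction n with
      | zero => intro _; simp [hA0]
      | succ n ih =>
        intro hn
        have h1 := ih (by omega)
        have h2 := h n (by omega)
        rw [Finset.sum_range_succ, Finset.sum_range_succ C]
        linarith
    have h1 := key T le_rfl
    have h2 : 0 ≤ (1 - γ) * A T := mul_nonneg (by linarith) (hA T)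
    have h3 := le_of_mul_le_mul_left (by linarith :
      γ * ∑ t ∈ Finset.range (T + 1), A t ≤ γ * ∑ t ∈ Finset.range T, C t) hγ
    rw [Finset.sum_range_succ C]
    linarith [hC T]

lemma norm_rpow_contraction {E : Type*} [SeminormedAddCommGroup E] [NormedSpace ℝ E] {γ : ℝ}
    (hγ : 0 ≤ γ) (hγ1 : γ ≤ 1) {p : ℝ} (hp : 1 ≤ p) {u v w : E} {c : ℝ} (hc : 0 ≤ c)
    (h : u = (1 - γ) • v + w) (hw : ‖w‖ ≤ γ * c) :
    ‖u‖ ^ p ≤ (1 - γ) * ‖v‖ ^ p + γ * c ^ p := by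
  have h1 : ‖u‖ ≤ (1 - γ) * ‖v‖ + γ * c := by
    rw [h]
    refine (norm_add_le _ _).trans (add_le_add ?_ hw)
    rw [norm_smul, Real.norm_of_nonneg (by linarith)]
  have hcv : ConvexOn ℝ (Set.Ici 0) fun x : ℝ => x ^ p := convexOn_rpow hp
  have h2 := hcv.2 (Set.mem_Ici.2 (norm_nonneg v)) (Set.mem_Ici.2 hc)
    (by linarith : 0 ≤ 1 - γ) hγ (by ring)
  simp only [smul_eq_mul] at h2
  exact (Real.rpow_le_rpow (norm_nonneg _) h1 (by linarith)).trans h2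

variable {d : ℕ}

/-- Young's inequality with the weight on ρ³ small enough to be absorbed; with b = √a the difference
of the two sides is (20b + ρ)(10b - ρ)²/300. -/
lemma young_three_halves {a ρ : ℝ} (ha : 0 ≤ a) (hρ : 0 ≤ ρ) :
    a * ρ ≤ 20 / 3 * a ^ (3 / 2 : ℝ) + ρ ^ 3 / 300 := by
  rw [rpow_three_halves_eq_sqrt ha]
  have hs := Real.sqrt_nonneg a
  set b := √a
  have e : a = b ^ 2 := (Real.sq_sqrt ha).symm
  rw [e]
  nlinarith [mul_nonneg (by positivity : 0 ≤ 20 * b + ρ) (sq_nonneg (10 * b - ρ))]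

lemma young_three {η ρ : ℝ} (hη : 0 ≤ η) (hρ : 0 ≤ ρ) :
    η * ρ ^ 2 ≤ 706 * η ^ 3 + ρ ^ 3 / 69 := by
  nlinarith [mul_nonneg (by positivity : 0 ≤ 46 * η + 2 * ρ) (sq_nonneg (46 * η - ρ)),
    pow_nonneg hη 3]

/-- Summation of the progress of the steps, when the errors of the gradients and the Hessians
consist of a bias that is controlled by the lengths of the steps, and of noise. -/
lemma sum_accuracy_le (T : ℕ) {φ r acc Bg Ng Bh Nh eg eh : ℕ → ℝ} {M : ℝ} (hM : 0 < M)
    (hr : ∀ t, 0 ≤ r t) (hBg : ∀ t, 0 ≤ Bg t) (hNg : ∀ t, 0 ≤ Ng t) (hBh : ∀ t, 0 ≤ Bh t)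
    (hNh : ∀ t, 0 ≤ Nh t) (heg0 : ∀ t, 0 ≤ eg t) (heh0 : ∀ t, 0 ≤ eh t)
    (heg : ∀ t, eg t ≤ Bg t + Ng t) (heh : ∀ t, eh t ≤ Bh t + Nh t)
    (hdec : ∀ t < T, 24 / 100 * M * r t ^ 3 - eg t * r t - 1 / 2 * eh t * r t ^ 2
      ≤ φ t - φ (t + 1))
    (hacc : ∀ t < T, acc (t + 1) ≤ 108 * (√M ^ 3 * r t ^ 3 + eg t ^ (3 / 2 : ℝ)
      + eh t ^ 3 / √M ^ 3))
    (hsBg : ∑ t ∈ Finset.range T, Bg t ^ (3 / 2 : ℝ)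
      ≤ ∑ t ∈ Finset.range T, √M ^ 3 * r t ^ 3 / 1000)
    (hsBh : ∑ t ∈ Finset.range T, Bh t ^ 3 / √M ^ 3
      ≤ ∑ t ∈ Finset.range T, √M ^ 3 * r t ^ 3 / 46 ^ 3) :
    ∑ t ∈ Finset.range T, acc (t + 1) ≤ 10 ^ 4 * (√M * (φ 0 - φ T)
      + 400 * ∑ t ∈ Finset.range T, Ng t ^ (3 / 2 : ℝ)
      + 400 * ∑ t ∈ Finset.range T, Nh t ^ 3 / √M ^ 3) := by
  set m := √M with hm
  have hm0 : 0 < m := Real.sqrt_pos.2 hM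
  have hmM : m ^ 2 = M := Real.sq_sqrt hM.le
  -- After multiplication by √M and with ρ = √M r, the four Young inequalities cost 2/300 + 1/69 of
  -- ρ³, less than the difference 0.24 - 0.2.
  have hdec' : ∀ t < T, 2 / 10 * (m ^ 3 * r t ^ 3) ≤ m * (φ t - φ (t + 1))
      + 20 / 3 * (Bg t ^ (3 / 2 : ℝ) + Ng t ^ (3 / 2 : ℝ))
      + 353 * (Bh t ^ 3 / m ^ 3 + Nh t ^ 3 / m ^ 3) := by
    intro t ht
    have h0 := mul_le_mul_of_nonneg_left (hdec t ht) hm0.le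
    have hρ : 0 ≤ m * r t := mul_nonneg hm0.le (hr t)
    have h1 := young_three_halves (hBg t) hρ
    have h2 := young_three_halves (hNg t) hρ
    have h3 := young_three (div_nonneg (hBh t) hm0.le) hρ
    have h4 := young_three (div_nonneg (hNh t) hm0.le) hρ
    have h5 : eg t * (m * r t) ≤ (Bg t + Ng t) * (m * r t) :=
      mul_le_mul_of_nonneg_right (heg t) hρ
    have h6 : m * (eh t * r t ^ 2) ≤ (Bh t / m) * (m * r t) ^ 2 + (Nh t / m) * (m * r t) ^ 2 := by
      have e : (Bh t / m) * (m * r t) ^ 2 + (Nh t / m) * (m * r t) ^ 2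
          = m * ((Bh t + Nh t) * r t ^ 2) := by field_simp
      rw [e]
      have := heh t
      gcongr
    have e3 : m * (M * r t ^ 3) = (m * r t) ^ 3 := by rw [← hmM]; ring
    have e4 : m ^ 3 * r t ^ 3 = (m * r t) ^ 3 := by ring
    have h7 : 0 ≤ (m * r t) ^ 3 := by positivity
    rw [div_pow] at h3 h4
    rw [e4]
    linarith
  have hacc' : ∀ t < T, acc (t + 1) ≤ 108 * (m ^ 3 * r t ^ 3 + 6 * (Bg t ^ (3 / 2 : ℝ)
      + Ng t ^ (3 / 2 : ℝ)) + 4 * (Bh t ^ 3 / m ^ 3 + Nh t ^ 3 / m ^ 3)) := by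
    intro t ht
    refine (hacc t ht).trans ?_
    have h1 : eg t ^ (3 / 2 : ℝ) ≤ 6 * (Bg t ^ (3 / 2 : ℝ) + Ng t ^ (3 / 2 : ℝ)) := by
      have h := three_add_rpow_le (hBg t) (hNg t) le_rfl
      rw [add_zero, Real.zero_rpow (by norm_num), add_zero] at h
      exact (Real.rpow_le_rpow (heg0 t) (heg t) (by norm_num)).trans h
    have h2 : eh t ^ 3 / m ^ 3 ≤ 4 * (Bh t ^ 3 / m ^ 3 + Nh t ^ 3 / m ^ 3) := by
      rw [← add_div, ← mul_div_assoc]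
      gcongr
      refine (pow_le_pow_left₀ (heh0 t) (heh t) 3).trans ?_
      nlinarith [mul_nonneg (add_nonneg (hBh t) (hNh t)) (sq_nonneg (Bh t - Nh t))]
    linarith
  -- The summed biases take up 20/3 · 1/1000 + 353/46³, about 0.01, of the sum of ρ³, well below the
  -- available 0.2. The bound on the lengths is then inserted into the bound on the accuracy.
  have hsum1 := Finset.sum_le_sum fun t ht => hdec' t (Finset.mem_range.1 ht)
  have hsum2 := Finset.sum_le_sum fun t ht => hacc' t (Finset.mem_range.1 ht)
  simp only [Finset.sum_add_distrib, ← Finset.mul_sum] at hsum1 hsum2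
  rw [Finset.sum_range_sub'] at hsum1
  have h46 : ∑ t ∈ Finset.range T, m ^ 3 * r t ^ 3 / 46 ^ 3
      = (m ^ 3 * ∑ t ∈ Finset.range T, r t ^ 3) / 46 ^ 3 := by
    rw [← Finset.sum_div, ← Finset.mul_sum]
  rw [← Finset.sum_div, ← Finset.mul_sum] at hsBg
  rw [h46] at hsBh
  have p1 : 0 ≤ ∑ t ∈ Finset.range T, Ng t ^ (3 / 2 : ℝ) :=
    Finset.sum_nonneg fun t _ => Real.rpow_nonneg (hNg t) _
  have p2 : 0 ≤ ∑ t ∈ Finset.range T, Nh t ^ 3 / m ^ 3 :=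
    Finset.sum_nonneg fun t _ => div_nonneg (pow_nonneg (hNh t) 3) (by positivity)
  have p3 : 0 ≤ m ^ 3 * ∑ t ∈ Finset.range T, r t ^ 3 :=
    mul_nonneg (by positivity) (Finset.sum_nonneg fun t _ => pow_nonneg (hr t) 3)
  norm_num at hsBh
  linarith

/-- The accumulated accuracy of a path of the method, in terms of the noise of the gradients and
the Hessians. -/
theorem sum_mu_le_of_path {f : Vec d → ℝ} {L M α β : ℝ} (hf : TwiceDifferentiable f) (hL0 : 0 ≤ L)
    (hL : ∀ x y, ‖hess f x - hess f y‖ ≤ L * ‖x - y‖) (hM : 0 < M) (hα : 0 < α) (hα1 : α ≤ 1)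
    (hβ : 0 < β) (hβ1 : β ≤ 1) (hLα : 100 * L ≤ M * α ^ 2) (hLβ : 46 * L ≤ M * β) (T : ℕ)
    {x g ζg : ℕ → Vec d} {H ζh : ℕ → Op d}
    (hH : ∀ t < T, ∀ u v, inner ℝ (H t u) v = inner ℝ u (H t v))
    (hmin : ∀ t < T, IsMinOn (cubicModel M (g t) (H t) (x t)) Set.univ (x (t + 1)))
    (hg0 : g 0 = gradient f (x 0) + ζg 0) (hH0 : H 0 = hess f (x 0) + ζh 0)
    (hg : ∀ t, t + 1 < T → g (t + 1) = (1 - α) • g t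
      + α • (gradient f (x (t + 1) + ((1 - α) / α) • (x (t + 1) - x t)) + ζg (t + 1)))
    (hHs : ∀ t, t + 1 < T → H (t + 1) = (1 - β) • H t + β • (hess f (x (t + 1)) + ζh (t + 1))) :
    ∑ t ∈ Finset.range T, mu f M (x (t + 1)) ≤ 10 ^ 4 * (√M * (f (x 0) - f (x T))
      + 400 * ∑ t ∈ Finset.range T, ‖ema α ζg t‖ ^ (3 / 2 : ℝ)
      + 400 * ∑ t ∈ Finset.range T, ‖ema β ζh t‖ ^ 3 / √M ^ 3) := by
  have hLM : 100 * L ≤ M := hLα.trans (mul_le_of_le_one_right hM.le (pow_le_one₀ hα.le hα1))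
  have hm0 : 0 < √M := Real.sqrt_pos.2 hM
  have hmM : √M ^ 2 = M := Real.sq_sqrt hM.le
  let r : ℕ → ℝ := fun t => ‖x (t + 1) - x t‖
  -- `bg` and `bh` are the errors with the averaged noise removed, hence pure bias. They vanish at t
  -- = 0, because the first estimates are evaluated at x₀ itself.
  let bg : ℕ → Vec d := fun t => g t - gradient f (x t) - ema α ζg t
  let bh : ℕ → Op d := fun t => H t - hess f (x t) - ema β ζh t
  have hr : ∀ t, 0 ≤ r t := fun t => norm_nonneg _
  refine sum_accuracy_le T (φ := fun t => f (x t)) (r := r) (acc := fun t => mu f M (x t))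
    (Bg := fun t => ‖bg t‖) (Ng := fun t => ‖ema α ζg t‖) (Bh := fun t => ‖bh t‖)
    (Nh := fun t => ‖ema β ζh t‖) (eg := fun t => ‖g t - gradient f (x t)‖)
    (eh := fun t => ‖H t - hess f (x t)‖) hM hr (fun _ => norm_nonneg _) (fun _ => norm_nonneg _)
    (fun _ => norm_nonneg _) (fun _ => norm_nonneg _) (fun _ => norm_nonneg _)
    (fun _ => norm_nonneg _) (fun t => ?_) (fun t => ?_) (fun t ht => ?_) (fun t ht => ?_) ?_ ?_
  · simpa [bg] using norm_add_le (bg t) (ema α ζg t)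
  · simpa [bh] using norm_add_le (bh t) (ema β ζh t)
  · have h := cubic_step_decrease hf hL0 hL (hH t ht) (hmin t ht)
    have h2 : 24 / 100 * M * r t ^ 3 ≤ (M / 4 - L) * r t ^ 3 :=
      mul_le_mul_of_nonneg_right (by linarith) (pow_nonneg (hr t) 3)
    linarith
  · exact cubic_step_mu_le hf hL0 hL hM (by linarith) (hH t ht) (hmin t ht)
  · refine sum_le_of_contraction hα hα1 (A := fun t => ‖bg t‖ ^ (3 / 2 : ℝ))
      (C := fun t => √M ^ 3 * r t ^ 3 / 1000) (by simp [bg, hg0, ema])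
      (fun t => by positivity) (fun t => by have := hr t; positivity) T fun t ht => ?_
    have e : √M ^ 3 * r t ^ 3 / 1000 = ((√M * r t / 10) ^ 2) ^ (3 / 2 : ℝ) := by
      rw [rpow_three_halves_sq (by have := hr t; positivity)]; ring
    rw [e]
    set h := x (t + 1) - x t with hh
    set z := x (t + 1) + ((1 - α) / α) • h with hz
    have e1 : bg (t + 1) = (1 - α) • bg t
        + ((1 - α) • (gradient f (x t) - gradient f (x (t + 1))
            - hess f (x (t + 1)) (x t - x (t + 1)))
          + α • (gradient f z - gradient f (x (t + 1)) - hess f (x (t + 1)) (z - x (t + 1)))) := by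
      -- The extrapolated point z satisfies (1 - α)(x_t - x_{t+1}) + α(z - x_{t+1}) = 0. The linear
      -- terms of both Taylor expansions around x_{t+1} therefore cancel, leaving a forcing
      -- quadratic in the step.
      have hlin : (1 - α) • hess f (x (t + 1)) (x t - x (t + 1))
          + α • hess f (x (t + 1)) (z - x (t + 1)) = 0 := by
        rw [← map_smul, ← map_smul, ← map_add, hz, add_sub_cancel_left, smul_smul,
          mul_div_cancel₀ _ hα.ne', ← smul_add, hh]
        simp
      simp only [bg, hg t ht, ema]
      linear_combination (norm := module) hlin
    refine norm_rpow_contraction hα.le hα1 (by norm_num) (sq_nonneg _) e1 ?_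
    have n1 := norm_gradient_sub_sub_le hf hL0 hL (x (t + 1)) (x t)
    have n2 := norm_gradient_sub_sub_le hf hL0 hL (x (t + 1)) z
    rw [norm_sub_rev (x t)] at n1
    have hzn : ‖z - x (t + 1)‖ = (1 - α) / α * r t := by
      rw [hz, add_sub_cancel_left, norm_smul,
        Real.norm_of_nonneg (div_nonneg (by linarith) hα.le)]
    rw [hzn] at n2
    -- The forcing is at most L r²/α, and 100 L ≤ M α² turns it into α (√M r/10)², the form required
    -- by the contraction.
    have n3 : (1 - α) * (L * r t ^ 2) + α * (L * ((1 - α) / α * r t) ^ 2)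
        ≤ L * r t ^ 2 / α := by
      have : (1 - α) * (L * r t ^ 2) + α * (L * ((1 - α) / α * r t) ^ 2)
        = (1 - α) * (L * r t ^ 2 / α) := by field_simp; ring
      rw [this]
      exact mul_le_of_le_one_left (by positivity) (by linarith)
    calc _ ≤ (1 - α) * (L * r t ^ 2) + α * (L * ((1 - α) / α * r t) ^ 2) := by
          refine (norm_add_le _ _).trans ?_
          rw [norm_smul, norm_smul, Real.norm_of_nonneg (by linarith), Real.norm_of_nonneg hα.le]
          have : 0 ≤ 1 - α := by linarith
          exact add_le_add (mul_le_mul_of_nonneg_left n1 this) (mul_le_mul_of_nonneg_left n2 hα.le)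
      _ ≤ L * r t ^ 2 / α := n3
      _ ≤ α * (√M * r t / 10) ^ 2 := by
        rw [div_le_iff₀ hα, div_pow, mul_pow, hmM]
        nlinarith [mul_le_mul_of_nonneg_right hLα (sq_nonneg (r t))]
  · refine sum_le_of_contraction hβ hβ1 (A := fun t => ‖bh t‖ ^ 3 / √M ^ 3)
      (C := fun t => √M ^ 3 * r t ^ 3 / 46 ^ 3) (by simp [bh, hH0, ema])
      (fun t => by positivity) (fun t => by have := hr t; positivity) T fun t ht => ?_
    -- There is no extrapolation for the Hessians: the forcing is linear in the step, and 46 L ≤ M β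
    -- is what makes it small relative to β.
    have e1 : bh (t + 1) = (1 - β) • bh t + (1 - β) • (hess f (x t) - hess f (x (t + 1))) := by
      simp only [bh, hHs t ht, ema]
      module
    have hc : 0 ≤ M * r t / 46 := by have := hr t; positivity
    have n1 := norm_rpow_contraction hβ.le hβ1 (p := 3) (by norm_num) hc e1 (by
      rw [norm_smul, Real.norm_of_nonneg (by linarith)]
      have := hL (x t) (x (t + 1))
      rw [norm_sub_rev (x t)] at this
      calc (1 - β) * ‖hess f (x t) - hess f (x (t + 1))‖
          ≤ 1 * (L * r t) := by gcongr; linarith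
        _ ≤ β * (M * r t / 46) := by
          nlinarith [mul_le_mul_of_nonneg_right hLβ (hr t)])
    have e3 : ∀ y : ℝ, y ^ (3 : ℝ) = y ^ 3 := fun y => by exact_mod_cast Real.rpow_natCast y 3
    rw [e3, e3, e3] at n1
    have e4 : √M ^ 3 * r t ^ 3 / 46 ^ 3 = (M * r t / 46) ^ 3 / √M ^ 3 := by
      have : M ^ 3 = √M ^ 3 * √M ^ 3 := by nth_rw 1 [← hmM]; ring
      rw [div_pow, mul_pow, this]
      field_simp
    rw [e4, ← mul_div_assoc, ← mul_div_assoc, ← add_div]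
    gcongr

end Pathwise

/-! ### Measurability of gradients, Hessians and the accuracy measure; independence of samples. -/

section Measurability

variable {d : ℕ} {Ξ : Type*} [MeasurableSpace Ξ]

lemma measurable_clm_of_apply {α E : Type*} [MeasurableSpace α] [NormedAddCommGroup E]
    [NormedSpace ℝ E] [FiniteDimensional ℝ E] [MeasurableSpace E] [BorelSpace E]
    {A : α → Vec d →L[ℝ] E} (h : ∀ v, Measurable fun a => A a v) : Measurable A := by
  have : ProperSpace E := FiniteDimensional.proper ℝ E
  have : ProperSpace (Vec d →L[ℝ] E) := FiniteDimensional.proper ℝ _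
  have e : A = fun a => ∑ i, (EuclideanSpace.proj i : Vec d →L[ℝ] ℝ).smulRight
      (A a (EuclideanSpace.single i 1)) := by
    funext a
    ext v
    have hv : v = ∑ i, v i • EuclideanSpace.single i (1 : ℝ) := by
      simpa using ((EuclideanSpace.basisFun (Fin d) ℝ).sum_repr v).symm
    conv_lhs => rw [hv]
    simp [map_sum]
  rw [e]
  refine Finset.measurable_sum _ fun i _ => ?_
  have hc : Continuous fun w : E => (EuclideanSpace.proj i : Vec d →L[ℝ] ℝ).smulRight w :=
    (ContinuousLinearMap.smulRightL ℝ (Vec d) E (EuclideanSpace.proj i)).continuous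
  exact hc.measurable.comp (h _)

/-- The derivative in a fixed direction is the limit of difference quotients with increments 1/n,
each jointly measurable. -/
lemma measurable_fderiv_uncurry {E : Type*} [NormedAddCommGroup E] [NormedSpace ℝ E]
    [FiniteDimensional ℝ E] [MeasurableSpace E] [BorelSpace E] {G : Ξ → Vec d → E}
    (hG : Measurable (Function.uncurry G)) (hd : ∀ ξ, Differentiable ℝ (G ξ)) :
    Measurable fun p : Ξ × Vec d => fderiv ℝ (G p.1) p.2 := by
  have : ProperSpace E := FiniteDimensional.proper ℝ E
  refine measurable_clm_of_apply fun v => ?_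
  refine measurable_of_tendsto_metrizable
    (f := fun (n : ℕ) (p : Ξ × Vec d) => (n : ℝ) • (G p.1 (p.2 + (n : ℝ)⁻¹ • v) - G p.1 p.2))
    (fun n => ?_) ?_
  · have h1 : Measurable fun p : Ξ × Vec d => G p.1 (p.2 + (n : ℝ)⁻¹ • v) :=
      hG.comp (measurable_fst.prodMk (measurable_snd.add_const _))
    exact (h1.sub hG).const_smul _
  · rw [tendsto_pi_nhds]
    intro p
    refine ((hd p.1) p.2).hasFDerivAt.lim v ?_
    simpa using tendsto_natCast_atTop_atTop (R := ℝ)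

lemma measurable_gradient_uncurry {F : Ξ → Vec d → ℝ} (hF : ∀ x, Measurable fun ξ => F ξ x)
    (hd : ∀ ξ, Differentiable ℝ (F ξ)) :
    Measurable fun p : Ξ × Vec d => gradient (F p.1) p.2 := by
  have h1 : Measurable (Function.uncurry fun (x : Vec d) (ξ : Ξ) => F ξ x) :=
    measurable_uncurry_of_continuous_of_measurable (fun ξ => (hd ξ).continuous) hF
  have h2 : Measurable (Function.uncurry F) := h1.comp measurable_swap
  exact ((InnerProductSpace.toDual ℝ (Vec d)).symm.continuous.measurable).comp
    (measurable_fderiv_uncurry h2 hd)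

lemma measurable_hess_uncurry {F : Ξ → Vec d → ℝ} (hF : ∀ x, Measurable fun ξ => F ξ x)
    (hd : ∀ ξ, TwiceDifferentiable (F ξ)) :
    Measurable fun p : Ξ × Vec d => hess (F p.1) p.2 :=
  measurable_fderiv_uncurry (measurable_gradient_uncurry hF fun ξ => (hd ξ).1) fun ξ => (hd ξ).2

lemma continuous_of_norm_sub_le {E G : Type*} [SeminormedAddCommGroup E]
    [SeminormedAddCommGroup G] {f : E → G} {L : ℝ} (hL : ∀ x y, ‖f x - f y‖ ≤ L * ‖x - y‖) :
    Continuous f :=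
  (LipschitzWith.of_dist_le_mul (K := L.toNNReal) fun x y => by
    rw [dist_eq_norm, dist_eq_norm]
    exact (hL x y).trans (mul_le_mul_of_nonneg_right (Real.le_coe_toNNReal L)
      (norm_nonneg _))).continuous

/-- Weyl's inequality: the Rayleigh quotient of A at an eigenvector of B bounds λ_min(A) from above.
Symmetry provides the variational characterization and the existence of eigenvalues. -/
lemma le_lambdaMin_add_norm_sub {A B : Op d} (hA : ∀ u v, inner ℝ (A u) v = inner ℝ u (A v))
    (hB : ∀ u v, inner ℝ (B u) v = inner ℝ u (B v)) :
    lambdaMin A ≤ lambdaMin B + ‖A - B‖ := by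
  cases subsingleton_or_nontrivial (Vec d) with
  | inl h =>
    have : A = B := ContinuousLinearMap.ext fun v => Subsingleton.elim _ _
    rw [this]; simp
  | inr h =>
    have hsymm : (B : Vec d →ₗ[ℝ] Vec d).IsSymmetric := hB
    have hsymmA : (A : Vec d →ₗ[ℝ] Vec d).IsSymmetric := hA
    have hbdd : ∀ C : Op d, ∀ l ∈ {l : ℝ | Module.End.HasEigenvalue (C : Vec d →ₗ[ℝ] Vec d) l},
        -‖C‖ ≤ l := by
      intro C l hl
      obtain ⟨v, hv⟩ := hl.exists_hasEigenvector
      have h1 : C v = l • v := hv.apply_eq_smul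
      have h2 := C.le_opNorm v
      rw [h1, norm_smul] at h2
      have h3 := le_of_mul_le_mul_right h2 (norm_pos_iff.2 hv.2)
      exact (abs_le.1 h3).1
    have hne := hsymm.hasEigenvalue_iInf_of_finiteDimensional
    rw [← sub_le_iff_le_add]
    refine le_csInf ⟨_, hne⟩ fun l hl => ?_
    obtain ⟨v, hv⟩ := hl.exists_hasEigenvector
    have h1 : B v = l • v := hv.apply_eq_smul
    have hn : 0 < ‖v‖ := norm_pos_iff.2 hv.2
    have h2 : lambdaMin A * ‖v‖ ^ 2 ≤ inner ℝ (A v) v := by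
      have hmin := hsymmA.hasEigenvalue_iInf_of_finiteDimensional
      have h3 : lambdaMin A ≤ _ := csInf_le ⟨_, hbdd A⟩ hmin
      have h4 : (⨅ x : { x : Vec d // x ≠ 0 }, RCLike.re (inner ℝ
          ((A : Vec d →ₗ[ℝ] Vec d) x) (x : Vec d)) / ‖(x : Vec d)‖ ^ 2 : ℝ)
          ≤ inner ℝ (A v) v / ‖v‖ ^ 2 := by
        refine ciInf_le (f := fun x : { x : Vec d // x ≠ 0 } => RCLike.re (inner ℝ
          ((A : Vec d →ₗ[ℝ] Vec d) x) (x : Vec d)) / ‖(x : Vec d)‖ ^ 2) ⟨-‖A‖, ?_⟩ ⟨v, hv.2⟩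
        rintro _ ⟨x, rfl⟩
        have hx : 0 < ‖(x : Vec d)‖ := norm_pos_iff.2 x.2
        simp only [RCLike.re_to_real]
        rw [le_div_iff₀ (by positivity)]
        have a1 := (abs_le.1 (abs_real_inner_le_norm (A x) (x : Vec d))).1
        have a2 := mul_le_mul_of_nonneg_right (A.le_opNorm (x : Vec d)) (norm_nonneg (x : Vec d))
        simp only [ContinuousLinearMap.coe_coe]
        nlinarith
      have h5 := h3.trans h4
      rwa [le_div_iff₀ (by positivity)] at h5
    have h6 : inner ℝ (A v) v ≤ l * ‖v‖ ^ 2 + ‖A - B‖ * ‖v‖ ^ 2 := by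
      have a1 := (abs_le.1 (abs_real_inner_le_norm ((A - B) v) v)).2
      have a2 := mul_le_mul_of_nonneg_right ((A - B).le_opNorm v) (norm_nonneg v)
      rw [_root_.sub_apply, inner_sub_left, h1, inner_smul_left, real_inner_self_eq_norm_sq,
        conj_trivial] at a1
      rw [_root_.sub_apply, h1] at a2
      nlinarith
    have h7 : 0 < ‖v‖ ^ 2 := by positivity
    nlinarith

lemma continuous_mu {f : Vec d → ℝ} {L : ℝ} (hf : TwiceDifferentiable f)
    (hL : ∀ x y, ‖hess f x - hess f y‖ ≤ L * ‖x - y‖) (c : ℝ) : Continuous (mu f c) := by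
  have h1 : Continuous fun x => lambdaMin (hess f x) := by
    refine continuous_of_norm_sub_le (L := L) fun x y => ?_
    rw [Real.norm_eq_abs, abs_le]
    have a1 := le_lambdaMin_add_norm_sub (hess_symm hf x) (hess_symm hf y)
    have a2 := le_lambdaMin_add_norm_sub (hess_symm hf y) (hess_symm hf x)
    have a3 := hL x y
    rw [norm_sub_rev] at a2
    constructor <;> linarith
  have h2 : Continuous fun x => ‖gradient f x‖ ^ (3 / 2 : ℝ) :=
    hf.2.continuous.norm.rpow_const fun _ => Or.inr (by norm_num)
  exact h2.max ((h1.pow 3).neg.div_const _)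

lemma mu_nonneg (f : Vec d → ℝ) (c : ℝ) (x : Vec d) : 0 ≤ mu f c x :=
  le_max_of_le_left (Real.rpow_nonneg (norm_nonneg _) _)

/-- Integration over a sample that is independent of the past. -/
lemma lintegral_comp_sample {Ω V : Type*} {m : MeasurableSpace Ω} [mΩ : MeasurableSpace Ω]
    [MeasurableSpace V] {μ : Measure Ω} [IsProbabilityMeasure μ] {P : Measure Ξ} (hm : m ≤ mΩ)
    {Y : Ω → V} (hY : Measurable[m] Y) {ξ : Ω → Ξ} (hξ : Measurable ξ) (hlaw : μ.map ξ = P)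
    (hind : Indep (MeasurableSpace.comap ξ inferInstance) m μ) {φ : V → Ξ → ENNReal}
    (hφ : Measurable (Function.uncurry φ)) :
    ∫⁻ ω, φ (Y ω) (ξ ω) ∂μ = ∫⁻ ω, ∫⁻ s, φ (Y ω) s ∂P ∂μ := by
  have hY' : Measurable Y := hY.mono hm le_rfl
  have hI : IndepFun Y ξ μ := (indep_of_indep_of_le_right hind hY.comap_le).symm
  have : IsProbabilityMeasure P := hlaw ▸ Measure.isProbabilityMeasure_map hξ.aemeasurable
  have h1 := (indepFun_iff_map_prod_eq_prod_map_map hY'.aemeasurable hξ.aemeasurable).1 hI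
  have h2 : ∫⁻ ω, φ (Y ω) (ξ ω) ∂μ
      = ∫⁻ p, Function.uncurry φ p ∂(μ.map fun ω => (Y ω, ξ ω)) :=
    (lintegral_map hφ (hY'.prodMk hξ)).symm
  rw [h2, h1, hlaw, lintegral_prod _ hφ.aemeasurable, lintegral_map hφ.lintegral_prod_right' hY']
  rfl

end Measurability

/-! ### Recursions for the moments of the averaged noise. -/

section Moments

/-- The exponential moving average of a sequence, started at `0`. -/
def emaTail {E : Type*} [AddCommGroup E] [Module ℝ E] (γ : ℝ) (ζ : ℕ → E) : ℕ → E
  | 0 => 0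
  | t + 1 => (1 - γ) • emaTail γ ζ t + γ • ζ (t + 1)

/-- The first sample enters with weight 1 instead of γ and has its own noise level, so it is treated
separately from the tail. -/
lemma ema_eq_add_emaTail {E : Type*} [AddCommGroup E] [Module ℝ E] (γ : ℝ) (ζ : ℕ → E) (t : ℕ) :
    ema γ ζ t = (1 - γ) ^ t • ζ 0 + emaTail γ ζ t := by
  induction t with
  | zero => simp [ema, emaTail]
  | succ t ih => rw [ema, emaTail, ih, smul_add, smul_smul, ← pow_succ', add_assoc]

variable {Ξ V Ω E : Type*} [MeasurableSpace Ξ] [MeasurableSpace V] [mΩ : MeasurableSpace Ω]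
  [NormedAddCommGroup E] [NormedSpace ℝ E] [FiniteDimensional ℝ E] [MeasurableSpace E]
  [BorelSpace E]

/-- A function that behaves like the square of a norm in a uniformly smooth space. -/
structure IsSmoothSq (κ : ℝ) (ψ : E → ℝ) : Prop where
  continuous : Continuous ψ
  nonneg : ∀ A, 0 ≤ ψ A
  smul : ∀ (t : ℝ) A, ψ (t • A) = t ^ 2 * ψ A
  convexOn : ConvexOn ℝ Set.univ ψ
  smooth : ∀ A X, ψ (A + X) + ψ (A - X) ≤ 2 * (ψ A + κ * ψ X)

lemma IsSmoothNormSq.isSmoothSq {d : ℕ} {κ : ℝ} {ψ : Op d → ℝ} (h : IsSmoothNormSq κ ψ) :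
    IsSmoothSq κ ψ :=
  ⟨h.continuous, fun A => (sq_nonneg _).trans (h.norm_sq_le A), h.smul, h.convexOn, h.smooth⟩

lemma isSmoothSq_norm_sq {d : ℕ} : IsSmoothSq 1 fun v : Vec d => ‖v‖ ^ 2 where
  continuous := by fun_prop
  nonneg _ := sq_nonneg _
  smul t A := by rw [norm_smul, mul_pow, Real.norm_eq_abs, sq_abs]
  convexOn := (convexOn_norm convex_univ).pow (fun _ _ => norm_nonneg _) 2
  smooth A X := by
    have := parallelogram_law_with_norm ℝ A X
    nlinarith

lemma integrable_and_integral_le_of_lintegral_le {P : Measure Ξ} {h : Ξ → ℝ} (h0 : ∀ ξ, 0 ≤ h ξ)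
    (hm : AEStronglyMeasurable h P) {s : ℝ} (hs : 0 ≤ s)
    (hle : ∫⁻ ξ, ENNReal.ofReal (h ξ) ∂P ≤ ENNReal.ofReal s) :
    Integrable h P ∧ ∫ ξ, h ξ ∂P ≤ s := by
  constructor
  · refine ⟨hm, ?_⟩
    rw [hasFiniteIntegral_iff_ofReal (Filter.Eventually.of_forall h0)]
    exact hle.trans_lt ENNReal.ofReal_lt_top
  · rw [integral_eq_lintegral_of_nonneg_ae (Filter.Eventually.of_forall h0) hm]
    exact ENNReal.toReal_le_of_le_ofReal hs hle

/-- Jensen's inequality gives Φ(S) ≤ E Φ(S - X) for centred X; subtracting this from the two-point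
inequality leaves E Φ(S + X). No derivative of Φ is involved. -/
lemma lintegral_convex_add_le {E : Type*} [NormedAddCommGroup E] [NormedSpace ℝ E]
    [CompleteSpace E] {P : Measure Ξ} [IsProbabilityMeasure P]
    {Φ : E → ℝ} (hc : Continuous Φ) (h0 : ∀ A, 0 ≤ Φ A) (hconv : ConvexOn ℝ Set.univ Φ) {X : Ξ → E}
    (hX : Integrable X P) (hX0 : ∫ ξ, X ξ ∂P = 0) {S : E} {D : Ξ → ℝ} (hD : Integrable D P)
    (hle : ∀ ξ, Φ (S + X ξ) + Φ (S - X ξ) ≤ 2 * D ξ) :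
    ∫⁻ ξ, ENNReal.ofReal (Φ (S + X ξ)) ∂P ≤ ENNReal.ofReal (2 * ∫ ξ, D ξ ∂P - Φ S) := by
  have hi : ∀ Z : Ξ → E, AEStronglyMeasurable Z P → (∀ ξ, Φ (Z ξ) ≤ 2 * D ξ) →
      Integrable (fun ξ => Φ (Z ξ)) P := fun Z hZ hZD =>
    (hD.const_mul 2).mono' (hc.comp_aestronglyMeasurable hZ)
      (Filter.Eventually.of_forall fun ξ => by
        rw [Real.norm_of_nonneg (h0 _)]; exact hZD ξ)
  have hS : Integrable (fun _ : Ξ => S) P := integrable_const S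
  have h1 := hi (fun ξ => S + X ξ) (hS.add hX).aestronglyMeasurable
    fun ξ => by linarith [hle ξ, h0 (S - X ξ)]
  have h2 := hi (fun ξ => S - X ξ) (hS.sub hX).aestronglyMeasurable
    fun ξ => by linarith [hle ξ, h0 (S + X ξ)]
  have h3 : Φ (∫ ξ, (S - X ξ) ∂P) ≤ ∫ ξ, Φ (S - X ξ) ∂P :=
    hconv.map_integral_le hc.continuousOn isClosed_univ
      (Filter.Eventually.of_forall fun _ => Set.mem_univ _) (hS.sub hX) h2
  rw [integral_sub hS hX, hX0, sub_zero, integral_const, probReal_univ, one_smul] at h3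
  have h5 := integral_mono (h1.add h2) (hD.const_mul 2) hle
  simp only [Pi.add_apply] at h5
  rw [integral_add h1 h2, integral_const_mul] at h5
  rw [← ofReal_integral_eq_lintegral_ofReal h1 (Filter.Eventually.of_forall fun _ => h0 _)]
  refine ENNReal.ofReal_le_ofReal ?_
  linarith

lemma IsSmoothSq.lintegral_add_le {E : Type*} [NormedAddCommGroup E] [NormedSpace ℝ E]
    [FiniteDimensional ℝ E] {κ : ℝ} {ψ : E → ℝ} (hψ : IsSmoothSq κ ψ) (hκ : 0 ≤ κ)
    {P : Measure Ξ} [IsProbabilityMeasure P] {X : Ξ → E} (hX : Integrable X P)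
    (hX0 : ∫ ξ, X ξ ∂P = 0) {s : ℝ} (hs : 0 ≤ s)
    (hXs : ∫⁻ ξ, ENNReal.ofReal (ψ (X ξ)) ∂P ≤ ENNReal.ofReal s) (S : E) :
    ∫⁻ ξ, ENNReal.ofReal (ψ (S + X ξ)) ∂P ≤ ENNReal.ofReal (ψ S + 2 * κ * s) := by
  obtain ⟨h1, h2⟩ := integrable_and_integral_le_of_lintegral_le (fun ξ => hψ.nonneg (X ξ))
    (hψ.continuous.comp_aestronglyMeasurable hX.aestronglyMeasurable) hs hXs
  have : CompleteSpace E := FiniteDimensional.complete ℝ E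
  refine (lintegral_convex_add_le hψ.continuous hψ.nonneg hψ.convexOn hX hX0
    ((integrable_const (ψ S)).add (h1.const_mul κ)) fun ξ => hψ.smooth S (X ξ)).trans ?_
  refine ENNReal.ofReal_le_ofReal ?_
  simp only [Pi.add_apply]
  rw [integral_add (integrable_const _) (h1.const_mul κ), integral_const_mul]
  simp only [integral_const, probReal_univ, one_smul]
  nlinarith [mul_le_mul_of_nonneg_left h2 hκ]

/-- The square (ψ S + κ ψ X)² is expanded; the second moment of the noise controls the cross term
and the fourth moment the last one. -/
lemma IsSmoothNormSq.lintegral_sq_add_le {d : ℕ} {κ : ℝ} {ψ : Op d → ℝ} (hψ : IsSmoothNormSq κ ψ)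
    (hκ : 0 ≤ κ) {P : Measure Ξ} [IsProbabilityMeasure P] {X : Ξ → Op d} (hX : Integrable X P)
    (hX0 : ∫ ξ, X ξ ∂P = 0) {s q : ℝ} (hs : 0 ≤ s) (hq : 0 ≤ q)
    (hXs : ∫⁻ ξ, ENNReal.ofReal (ψ (X ξ)) ∂P ≤ ENNReal.ofReal s)
    (hXq : ∫⁻ ξ, ENNReal.ofReal (ψ (X ξ) ^ 2) ∂P ≤ ENNReal.ofReal q) (S : Op d) :
    ∫⁻ ξ, ENNReal.ofReal (ψ (S + X ξ) ^ 2) ∂P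
      ≤ ENNReal.ofReal (ψ S ^ 2 + 4 * κ * s * ψ S + 2 * κ ^ 2 * q) := by
  have hn := hψ.isSmoothSq.nonneg
  have hm := hψ.continuous.comp_aestronglyMeasurable hX.aestronglyMeasurable
  obtain ⟨h1, h2⟩ := integrable_and_integral_le_of_lintegral_le (fun ξ => hn (X ξ)) hm hs hXs
  obtain ⟨h3, h4⟩ := integrable_and_integral_le_of_lintegral_le (fun ξ => sq_nonneg (ψ (X ξ)))
    (hm.pow 2) hq hXq
  refine (lintegral_convex_add_le (hψ.continuous.pow 2) (fun A => sq_nonneg (ψ A)) hψ.convexOn_sq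
    hX hX0 (D := fun ξ => ψ S ^ 2 + (2 * κ * ψ S * ψ (X ξ) + κ ^ 2 * ψ (X ξ) ^ 2))
    ((integrable_const _).add ((h1.const_mul _).add (h3.const_mul _)))
    fun ξ => (hψ.smooth_sq S (X ξ)).trans_eq (by ring)).trans ?_
  refine ENNReal.ofReal_le_ofReal ?_
  have h7 : ∫ ξ, (ψ S ^ 2 + (2 * κ * ψ S * ψ (X ξ) + κ ^ 2 * ψ (X ξ) ^ 2)) ∂P
      = ψ S ^ 2 + (2 * κ * ψ S * ∫ ξ, ψ (X ξ) ∂P + κ ^ 2 * ∫ ξ, ψ (X ξ) ^ 2 ∂P) := by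
    have a1 := h1.const_mul (2 * κ * ψ S)
    have a2 := h3.const_mul (κ ^ 2)
    have a3 : Integrable (fun ξ => 2 * κ * ψ S * ψ (X ξ) + κ ^ 2 * ψ (X ξ) ^ 2) P := a1.add a2
    rw [integral_add (integrable_const _) a3, integral_add a1 a2, integral_const_mul,
      integral_const_mul]
    simp
  rw [h7]
  simp only [Pi.pow_apply]
  have h5 := mul_le_mul_of_nonneg_left h2 (mul_nonneg hκ (hn S))
  have h6 := mul_le_mul_of_nonneg_left h4 (sq_nonneg κ)
  nlinarith

/-- `ξ_0, …, ξ_{T-1}` are samples from `P`, each of them independent of the past. -/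
structure IsSampling (P : Measure Ξ) (μ : Measure Ω) (ℱ : Filtration ℕ mΩ) (T : ℕ)
    (ξ : ℕ → Ω → Ξ) : Prop where
  adapted : ∀ t < T, Measurable[ℱ (t + 1)] (ξ t)
  law : ∀ t < T, μ.map (ξ t) = P
  indep : ∀ t < T, Indep (MeasurableSpace.comap (ξ t) inferInstance) (ℱ t) μ

variable {P : Measure Ξ} {μ : Measure Ω} {ℱ : Filtration ℕ mΩ} {T : ℕ} {ξ : ℕ → Ω → Ξ}
  {v : ℕ → Ω → V} {X : V → Ξ → E} {γ : ℝ}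

lemma measurable_emaTail (hξ : ∀ t < T, Measurable[ℱ (t + 1)] (ξ t))
    (hv : ∀ t < T, Measurable[ℱ t] (v t)) (hX : Measurable (Function.uncurry X)) :
    ∀ t < T, Measurable[ℱ (t + 1)] fun ω => emaTail γ (fun s => X (v s ω) (ξ s ω)) t := by
  have : ProperSpace E := FiniteDimensional.proper ℝ E
  intro t
  induction t with
  | zero => intro _; exact measurable_const
  | succ t ih =>
    intro ht
    have h1 := (ih (by omega)).mono (ℱ.mono (Nat.le_succ _)) le_rfl
    have h2 : Measurable[ℱ (t + 1 + 1)] fun ω => X (v (t + 1) ω) (ξ (t + 1) ω) :=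
      hX.comp (((hv _ ht).mono (ℱ.mono (Nat.le_succ _)) le_rfl).prodMk (hξ _ ht))
    exact (h1.const_smul (1 - γ)).add (h2.const_smul γ)

/-- Conditioning on `ℱ (t + 1)`: the earlier tail and the evaluation point are known, and the new
sample is independent of them. -/
lemma lintegral_emaTail_succ [IsProbabilityMeasure μ] (hξ : IsSampling P μ ℱ T ξ)
    (hv : ∀ t < T, Measurable[ℱ t] (v t)) (hX : Measurable (Function.uncurry X))
    {Φ : E → ENNReal} (hΦ : Measurable Φ) {t : ℕ} (ht : t + 1 < T) :
    ∫⁻ ω, Φ (emaTail γ (fun s => X (v s ω) (ξ s ω)) (t + 1)) ∂μ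
      = ∫⁻ ω, ∫⁻ s, Φ ((1 - γ) • emaTail γ (fun s => X (v s ω) (ξ s ω)) t
          + γ • X (v (t + 1) ω) s) ∂P ∂μ := by
  have : ProperSpace E := FiniteDimensional.proper ℝ E
  have h1 := measurable_emaTail (γ := γ) hξ.adapted hv hX t (by omega)
  refine lintegral_comp_sample (ℱ.le (t + 1))
    (Y := fun ω => (emaTail γ (fun s => X (v s ω) (ξ s ω)) t, v (t + 1) ω))
    (h1.prodMk (hv _ ht)) ((hξ.adapted _ ht).mono (ℱ.le _) le_rfl) (hξ.law _ ht)
    (hξ.indep _ ht) (φ := fun p s => Φ ((1 - γ) • p.1 + γ • X p.2 s)) ?_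
  have h2 : Measurable fun p : (E × V) × Ξ => X p.1.2 p.2 :=
    hX.comp ((measurable_snd.comp measurable_fst).prodMk measurable_snd)
  exact hΦ.comp (((measurable_fst.comp measurable_fst).const_smul (1 - γ)).add (h2.const_smul γ))

lemma lintegral_ofReal_affine_le [IsProbabilityMeasure μ] {h k : Ω → ℝ} (hh : Measurable h)
    (hh0 : ∀ ω, 0 ≤ h ω) (hk0 : ∀ ω, 0 ≤ k ω) {A B c e b : ℝ} (hc : 0 ≤ c) (he : 0 ≤ e)
    (hb : 0 ≤ b) (hA : 0 ≤ A) (hB : 0 ≤ B)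
    (hhA : ∫⁻ ω, ENNReal.ofReal (h ω) ∂μ ≤ ENNReal.ofReal A)
    (hkB : ∫⁻ ω, ENNReal.ofReal (k ω) ∂μ ≤ ENNReal.ofReal B) :
    ∫⁻ ω, ENNReal.ofReal (c * h ω + e * k ω + b) ∂μ ≤ ENNReal.ofReal (c * A + e * B + b) := by
  have e1 : ∀ ω, ENNReal.ofReal (c * h ω + e * k ω + b)
      = ENNReal.ofReal c * ENNReal.ofReal (h ω) + ENNReal.ofReal e * ENNReal.ofReal (k ω)
        + ENNReal.ofReal b := by
    intro ω
    have := hh0 ω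
    have := hk0 ω
    rw [ENNReal.ofReal_add (by positivity) hb, ENNReal.ofReal_add (by positivity) (by positivity),
      ENNReal.ofReal_mul hc, ENNReal.ofReal_mul he]
  simp only [e1]
  rw [lintegral_add_right _ measurable_const,
    lintegral_add_left (hh.ennreal_ofReal.const_mul _),
    lintegral_const_mul' _ _ ENNReal.ofReal_ne_top, lintegral_const_mul' _ _ ENNReal.ofReal_ne_top,
    ENNReal.ofReal_add (by positivity) hb, ENNReal.ofReal_add (by positivity) (by positivity),
    ENNReal.ofReal_mul hc, ENNReal.ofReal_mul he]
  simp only [lintegral_const, measure_univ, mul_one]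
  gcongr

/-- The second moment of the averaged noise. -/
theorem IsSmoothSq.lintegral_emaTail_le [IsProbabilityMeasure μ] [IsProbabilityMeasure P]
    {κ : ℝ} {ψ : E → ℝ} (hψ : IsSmoothSq κ ψ) (hκ : 0 ≤ κ) (hξ : IsSampling P μ ℱ T ξ)
    (hv : ∀ t < T, Measurable[ℱ t] (v t)) (hX : Measurable (Function.uncurry X))
    (hγ : 0 ≤ γ) (hγ1 : γ ≤ 1) (hXi : ∀ w, Integrable (X w) P) (hX0 : ∀ w, ∫ s, X w s ∂P = 0)
    {s : ℝ} (hs : 0 ≤ s)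
    (hXs : ∀ w, ∫⁻ z, ENNReal.ofReal (ψ (X w z)) ∂P ≤ ENNReal.ofReal s) :
    ∀ t < T, ∫⁻ ω, ENNReal.ofReal (ψ (emaTail γ (fun s => X (v s ω) (ξ s ω)) t)) ∂μ
      ≤ ENNReal.ofReal (2 * κ * γ * s) := by
  intro t
  induction t with
  | zero =>
    intro _
    have h0 : ψ 0 = 0 := by
      have := hψ.smul 0 0
      rwa [zero_smul, zero_pow two_ne_zero, zero_mul] at this
    simp [emaTail, h0]
  | succ t ih =>
    intro ht
    have hm : Measurable fun A : E => ENNReal.ofReal (ψ A) :=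
      hψ.continuous.measurable.ennreal_ofReal
    rw [lintegral_emaTail_succ hξ hv hX hm ht]
    have step : ∀ ω, ∫⁻ z, ENNReal.ofReal (ψ ((1 - γ) • emaTail γ (fun s => X (v s ω) (ξ s ω)) t
          + γ • X (v (t + 1) ω) z)) ∂P
        ≤ ENNReal.ofReal ((1 - γ) ^ 2 * ψ (emaTail γ (fun s => X (v s ω) (ξ s ω)) t)
          + 0 * ψ (emaTail γ (fun s => X (v s ω) (ξ s ω)) t) + 2 * κ * (γ ^ 2 * s)) := by
      intro ω
      refine (hψ.lintegral_add_le hκ ((hXi (v (t + 1) ω)).smul γ) ?_ (s := γ ^ 2 * s)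
        (by positivity) ?_ _).trans_eq ?_
      · simp only [Pi.smul_apply]
        rw [integral_smul, hX0, smul_zero]
      · simp only [Pi.smul_apply, hψ.smul, ENNReal.ofReal_mul (sq_nonneg γ)]
        rw [lintegral_const_mul' _ _ ENNReal.ofReal_ne_top]
        gcongr
        exact hXs _
      · rw [hψ.smul, zero_mul, add_zero]
    refine (lintegral_mono step).trans ((lintegral_ofReal_affine_le
      (hψ.continuous.measurable.comp ((measurable_emaTail hξ.adapted hv hX t (by omega)).mono
        (ℱ.le _) le_rfl)) (fun _ => hψ.nonneg _) (fun _ => hψ.nonneg _) (sq_nonneg _) le_rfl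
      (by positivity) (by positivity) (by positivity) (ih (by omega)) (ih (by omega))).trans ?_)
    refine ENNReal.ofReal_le_ofReal ?_
    -- This makes 2κγs stable under the recursion B ↦ (1 - γ)² B + 2κγ² s.
    have h1 : (1 - γ) ^ 2 + γ ≤ 1 := by nlinarith
    have h2 : 0 ≤ 2 * κ * γ * s := by positivity
    nlinarith [mul_le_mul_of_nonneg_right h1 h2]

/-- The fourth moment of the averaged noise. -/
theorem IsSmoothNormSq.lintegral_sq_emaTail_le {d : ℕ} {X : V → Ξ → Op d} [IsProbabilityMeasure μ]
    [IsProbabilityMeasure P] {κ : ℝ} {ψ : Op d → ℝ} (hψ : IsSmoothNormSq κ ψ) (hκ : 0 ≤ κ)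
    (hξ : IsSampling P μ ℱ T ξ) (hv : ∀ t < T, Measurable[ℱ t] (v t))
    (hX : Measurable (Function.uncurry X)) (hγ : 0 ≤ γ) (hγ1 : γ ≤ 1)
    (hXi : ∀ w, Integrable (X w) P) (hX0 : ∀ w, ∫ s, X w s ∂P = 0)
    {s q : ℝ} (hs : 0 ≤ s) (hq : 0 ≤ q)
    (hXs : ∀ w, ∫⁻ z, ENNReal.ofReal (ψ (X w z)) ∂P ≤ ENNReal.ofReal s)
    (hXq : ∀ w, ∫⁻ z, ENNReal.ofReal (ψ (X w z) ^ 2) ∂P ≤ ENNReal.ofReal q) :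
    ∀ t < T, ∫⁻ ω, ENNReal.ofReal (ψ (emaTail γ (fun s => X (v s ω) (ξ s ω)) t) ^ 2) ∂μ
      ≤ ENNReal.ofReal (8 * κ ^ 2 * γ ^ 2 * s ^ 2 + 2 * κ ^ 2 * γ ^ 3 * q) := by
  have hS := hψ.isSmoothSq
  intro t
  induction t with
  | zero =>
    intro _
    have h0 : ψ 0 = 0 := le_antisymm (by simpa using hψ.le_norm_sq 0) (hS.nonneg 0)
    simp [emaTail, h0]
  | succ t ih =>
    intro ht
    have hm : Measurable fun A : Op d => ENNReal.ofReal (ψ A ^ 2) :=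
      (hψ.continuous.measurable.pow_const 2).ennreal_ofReal
    rw [lintegral_emaTail_succ hξ hv hX hm ht]
    have step : ∀ ω, ∫⁻ z, ENNReal.ofReal (ψ ((1 - γ) • emaTail γ (fun s => X (v s ω) (ξ s ω)) t
          + γ • X (v (t + 1) ω) z) ^ 2) ∂P
        ≤ ENNReal.ofReal ((1 - γ) * ψ (emaTail γ (fun s => X (v s ω) (ξ s ω)) t) ^ 2
          + 4 * κ * (γ ^ 2 * s) * ψ (emaTail γ (fun s => X (v s ω) (ξ s ω)) t)
          + 2 * κ ^ 2 * (γ ^ 4 * q)) := by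
      intro ω
      refine (hψ.lintegral_sq_add_le hκ ((hXi (v (t + 1) ω)).smul γ) ?_ (s := γ ^ 2 * s)
        (q := γ ^ 4 * q) (by positivity) (by positivity) ?_ ?_ _).trans ?_
      · simp only [Pi.smul_apply]
        rw [integral_smul, hX0, smul_zero]
      · simp only [Pi.smul_apply, hψ.smul, ENNReal.ofReal_mul (sq_nonneg γ)]
        rw [lintegral_const_mul' _ _ ENNReal.ofReal_ne_top]
        gcongr
        exact hXs _
      · have e : ∀ z, ψ ((γ • X (v (t + 1) ω)) z) ^ 2 = γ ^ 4 * ψ (X (v (t + 1) ω) z) ^ 2 := by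
          intro z
          rw [Pi.smul_apply, hψ.smul]; ring
        simp only [e, ENNReal.ofReal_mul (by positivity : 0 ≤ γ ^ 4)]
        rw [lintegral_const_mul' _ _ ENNReal.ofReal_ne_top]
        gcongr
        exact hXq _
      · refine ENNReal.ofReal_le_ofReal ?_
        rw [hψ.smul]
        set a := ψ (emaTail γ (fun s => X (v s ω) (ξ s ω)) t)
        have ha : 0 ≤ a := hS.nonneg _
        have h1 : (1 - γ) ^ 2 ≤ 1 := by nlinarith
        have h2 : (1 - γ) ^ 4 ≤ 1 - γ := pow_le_of_le_one (by linarith) (by linarith) (by norm_num)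
        have h3 : 0 ≤ 4 * κ * (γ ^ 2 * s) * a := by positivity
        nlinarith [mul_le_mul_of_nonneg_left h1 h3, mul_le_mul_of_nonneg_right h2 (sq_nonneg a)]
    have hmt : Measurable fun ω => emaTail γ (fun s => X (v s ω) (ξ s ω)) t :=
      (measurable_emaTail hξ.adapted hv hX t (by omega)).mono (ℱ.le _) le_rfl
    refine (lintegral_mono step).trans ((lintegral_ofReal_affine_le
      ((hψ.continuous.measurable.comp hmt).pow_const 2) (fun _ => sq_nonneg _)
      (fun _ => hS.nonneg _) (by linarith) (by positivity) (by positivity) (by positivity)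
      (by positivity) (ih (by omega))
      (hS.lintegral_emaTail_le hκ hξ hv hX hγ hγ1 hXi hX0 hs hXs t (by omega))).trans ?_)
    -- The claimed bound is exactly the fixed point of this recursion, once the second moment is
    -- replaced by its bound 2κγs.
    refine ENNReal.ofReal_le_ofReal (le_of_eq ?_)
    ring

end Moments

/-! ### Accumulated moments of the gradient and Hessian noise. -/

section NoiseBounds

variable {Ξ V Ω : Type*} [MeasurableSpace Ξ] [MeasurableSpace V] [mΩ : MeasurableSpace Ω]
  {P : Measure Ξ} {μ : Measure Ω} {ℱ : Filtration ℕ mΩ} {T : ℕ} {ξ : ℕ → Ω → Ξ}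
  {v : ℕ → Ω → V} {γ : ℝ}

/-- Lyapunov's inequality between the moments of orders `3/2` and `2`. -/
lemma lintegral_rpow_three_halves_le [IsProbabilityMeasure μ] {E : Type*} [NormedAddCommGroup E]
    {Z : Ω → E} (hZ : AEStronglyMeasurable Z μ) {s : ℝ} (hs : 0 ≤ s)
    (h : ∫⁻ ω, ENNReal.ofReal (‖Z ω‖ ^ 2) ∂μ ≤ ENNReal.ofReal (s ^ 2)) :
    ∫⁻ ω, ENNReal.ofReal (‖Z ω‖ ^ (3 / 2 : ℝ)) ∂μ ≤ ENNReal.ofReal (s ^ (3 / 2 : ℝ)) := by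
  have h1 := eLpNorm'_le_eLpNorm'_of_exponent_le (p := 3 / 2) (q := 2) (by norm_num)
    (by norm_num) μ hZ
  have e : ∀ (p : ℝ), 0 ≤ p → ∫⁻ ω, ‖Z ω‖ₑ ^ p ∂μ = ∫⁻ ω, ENNReal.ofReal (‖Z ω‖ ^ p) ∂μ := by
    intro p hp
    refine lintegral_congr fun ω => ?_
    rw [← ofReal_norm, ENNReal.ofReal_rpow_of_nonneg (norm_nonneg _) hp]
  have h2 : eLpNorm' Z 2 μ ≤ ENNReal.ofReal s := by
    rw [eLpNorm', e 2 (by norm_num)]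
    have e2 : ENNReal.ofReal s = ENNReal.ofReal (s ^ 2) ^ (1 / 2 : ℝ) := by
      rw [ENNReal.ofReal_rpow_of_nonneg (sq_nonneg s) (by norm_num), ← Real.sqrt_eq_rpow,
        Real.sqrt_sq hs]
    rw [e2]
    refine ENNReal.rpow_le_rpow ?_ (by norm_num)
    simpa using h
  have h3 := ENNReal.rpow_le_rpow (h1.trans h2) (by norm_num : (0 : ℝ) ≤ 3 / 2)
  rw [eLpNorm', ← ENNReal.rpow_mul, ENNReal.ofReal_rpow_of_nonneg hs (by norm_num),
    e _ (by norm_num)] at h3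
  norm_num at h3 ⊢
  exact h3

lemma integrable_of_lintegral_sq_le {E : Type*} [NormedAddCommGroup E] [IsProbabilityMeasure P]
    {X : Ξ → E} (hX : AEStronglyMeasurable X P) {s : ℝ}
    (h : ∫⁻ z, ENNReal.ofReal (‖X z‖ ^ 2) ∂P ≤ ENNReal.ofReal s) : Integrable X P := by
  have h1 : Integrable (fun z => ‖X z‖ ^ 2) P :=
    ⟨(hX.norm.pow 2), by
      rw [hasFiniteIntegral_iff_ofReal (Filter.Eventually.of_forall fun z => sq_nonneg _)]
      exact h.trans_lt ENNReal.ofReal_lt_top⟩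
  refine ((integrable_const (1 : ℝ)).add h1).mono' hX (Filter.Eventually.of_forall fun z => ?_)
  simp only [Pi.add_apply]
  nlinarith [sq_nonneg (‖X z‖ - 1)]

lemma measurable_ema {E : Type*} [NormedAddCommGroup E] [NormedSpace ℝ E]
    [FiniteDimensional ℝ E] [MeasurableSpace E] [BorelSpace E] {X : V → Ξ → E}
    (hξ : IsSampling P μ ℱ T ξ) (hv : ∀ t < T, Measurable[ℱ t] (v t))
    (hX : Measurable (Function.uncurry X)) {t : ℕ} (ht : t < T) :
    Measurable fun ω => ema γ (fun s => X (v s ω) (ξ s ω)) t := by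
  have : ProperSpace E := FiniteDimensional.proper ℝ E
  simp only [ema_eq_add_emaTail]
  have hm : ∀ t < T, Measurable fun ω => X (v t ω) (ξ t ω) := fun t ht =>
    hX.comp (((hv t ht).mono (ℱ.le _) le_rfl).prodMk ((hξ.adapted t ht).mono (ℱ.le _) le_rfl))
  exact ((hm 0 (by omega)).const_smul ((1 - γ) ^ t)).add
    ((measurable_emaTail hξ.adapted hv hX t ht).mono (ℱ.le _) le_rfl)

/-- The accumulated moments of the exponential moving average of the noise, from the moment at
the initial point and the moments of the tails. -/
lemma lintegral_sum_rpow_ema_le [IsProbabilityMeasure μ] {E : Type*} [NormedAddCommGroup E]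
    [NormedSpace ℝ E] [FiniteDimensional ℝ E] [MeasurableSpace E] [BorelSpace E] {X : V → Ξ → E}
    (hξ : IsSampling P μ ℱ T ξ) (hv : ∀ t < T, Measurable[ℱ t] (v t))
    (hX : Measurable (Function.uncurry X)) (hγ : 0 < γ) (hγ1 : γ ≤ 1) (hT : 1 ≤ T) {p C : ℝ}
    (hp : 1 ≤ p) (hC : 0 ≤ C) (hpC : ∀ a b : ℝ, 0 ≤ a → 0 ≤ b → (a + b) ^ p ≤ C * (a ^ p + b ^ p))
    {w₀ : V} (hv0 : ∀ ω, v 0 ω = w₀) {A B : ℝ} (hA : 0 ≤ A) (hB : 0 ≤ B)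
    (hinit : ∫⁻ z, ENNReal.ofReal (‖X w₀ z‖ ^ p) ∂P ≤ ENNReal.ofReal A)
    (htail : ∀ t < T, ∫⁻ ω, ENNReal.ofReal
      (‖emaTail γ (fun s => X (v s ω) (ξ s ω)) t‖ ^ p) ∂μ ≤ ENNReal.ofReal B) :
    ∫⁻ ω, ENNReal.ofReal (∑ t ∈ Finset.range T, ‖ema γ (fun s => X (v s ω) (ξ s ω)) t‖ ^ p) ∂μ
      ≤ ENNReal.ofReal (C * (A / γ + T * B)) := by
  have hX0 : Measurable fun z => ‖X w₀ z‖ ^ p :=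
    ((hX.comp measurable_prodMk_left).norm).pow_const p
  have hξ0 : Measurable (ξ 0) := (hξ.adapted 0 hT).mono (ℱ.le _) le_rfl
  have hinit' : ∫⁻ ω, ENNReal.ofReal (‖X (v 0 ω) (ξ 0 ω)‖ ^ p) ∂μ ≤ ENNReal.ofReal A := by
    simp only [hv0]
    rw [← hξ.law 0 hT, lintegral_map hX0.ennreal_ofReal hξ0] at hinit
    exact hinit
  have hm0 : Measurable fun ω => X (v 0 ω) (ξ 0 ω) := by
    simp only [hv0]
    exact (hX.comp measurable_prodMk_left).comp hξ0
  have h1γ : 0 ≤ 1 - γ := by linarith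
  have hterm : ∀ t < T, ∫⁻ ω, ENNReal.ofReal (‖ema γ (fun s => X (v s ω) (ξ s ω)) t‖ ^ p) ∂μ
      ≤ ENNReal.ofReal (C * ((1 - γ) ^ t * A + B)) := by
    intro t ht
    have hpt : ∀ ω, ‖ema γ (fun s => X (v s ω) (ξ s ω)) t‖ ^ p
        ≤ C * (1 - γ) ^ t * ‖X (v 0 ω) (ξ 0 ω)‖ ^ p
          + C * ‖emaTail γ (fun s => X (v s ω) (ξ s ω)) t‖ ^ p + 0 := by
      intro ω
      rw [ema_eq_add_emaTail]
      set R := emaTail γ (fun s => X (v s ω) (ξ s ω)) t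
      set Z := X (v 0 ω) (ξ 0 ω)
      have hq : 0 ≤ (1 - γ) ^ t := pow_nonneg h1γ t
      have hq1 : (1 - γ) ^ t ≤ 1 := pow_le_one₀ h1γ (by linarith)
      have h1 : ‖(1 - γ) ^ t • Z + R‖ ≤ (1 - γ) ^ t * ‖Z‖ + ‖R‖ := by
        refine (norm_add_le _ _).trans_eq ?_
        rw [norm_smul, Real.norm_of_nonneg hq]
      have h2 : ((1 - γ) ^ t) ^ p ≤ (1 - γ) ^ t := by
        simpa using Real.rpow_le_rpow_of_exponent_ge' hq hq1 zero_le_one hp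
      have h3 : 0 ≤ ‖Z‖ ^ p := by positivity
      calc _ ≤ ((1 - γ) ^ t * ‖Z‖ + ‖R‖) ^ p :=
            Real.rpow_le_rpow (norm_nonneg _) h1 (by linarith)
        _ ≤ C * (((1 - γ) ^ t * ‖Z‖) ^ p + ‖R‖ ^ p) :=
            hpC _ _ (mul_nonneg hq (norm_nonneg _)) (norm_nonneg _)
        _ = C * (((1 - γ) ^ t) ^ p * ‖Z‖ ^ p + ‖R‖ ^ p) := by
            rw [Real.mul_rpow hq (norm_nonneg _)]
        _ ≤ C * ((1 - γ) ^ t * ‖Z‖ ^ p + ‖R‖ ^ p) := by gcongr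
        _ = _ := by ring
    refine (lintegral_mono fun ω => ENNReal.ofReal_le_ofReal (hpt ω)).trans ?_
    refine (lintegral_ofReal_affine_le (hm0.norm.pow_const p) (fun _ => by positivity)
      (fun _ => by positivity) (by positivity) hC le_rfl hA hB hinit' (htail t ht)).trans ?_
    exact ENNReal.ofReal_le_ofReal (le_of_eq (by ring))
  simp only [ENNReal.ofReal_sum_of_nonneg fun _ _ => Real.rpow_nonneg (norm_nonneg _) p]
  rw [lintegral_finsetSum _ fun t ht => ((measurable_ema hξ hv hX
    (Finset.mem_range.1 ht)).norm.pow_const p).ennreal_ofReal]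
  refine (Finset.sum_le_sum fun t ht => hterm t (Finset.mem_range.1 ht)).trans ?_
  rw [← ENNReal.ofReal_sum_of_nonneg fun t _ => by positivity]
  refine ENNReal.ofReal_le_ofReal ?_
  rw [← Finset.mul_sum, Finset.sum_add_distrib, ← Finset.sum_mul]
  -- The noise of the initial sample is forgotten geometrically; this is its total weight over the
  -- run.
  have hgeom : ∑ t ∈ Finset.range T, (1 - γ) ^ t ≤ 1 / γ := by
    have h1 := geom_sum_mul_neg (1 - γ) T
    rw [sub_sub_cancel] at h1
    rw [le_div_iff₀ hγ, h1]
    linarith [pow_nonneg h1γ T]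
  simp only [Finset.sum_const, Finset.card_range, nsmul_eq_mul]
  have h2 := mul_le_mul_of_nonneg_right hgeom hA
  refine mul_le_mul_of_nonneg_left ?_ hC
  have h3 : 1 / γ * A = A / γ := by ring
  linarith

/-- The accumulated `3/2`-moments of the averaged noise of the gradients. -/
theorem lintegral_sum_gradient_noise_le {d : ℕ} [IsProbabilityMeasure μ] [IsProbabilityMeasure P]
    {X : V → Ξ → Vec d} (hξ : IsSampling P μ ℱ T ξ) (hv : ∀ t < T, Measurable[ℱ t] (v t))
    (hX : Measurable (Function.uncurry X)) (hγ : 0 < γ) (hγ1 : γ ≤ 1) (hT : 1 ≤ T)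
    (hX0 : ∀ w, ∫ s, X w s ∂P = 0) {w₀ : V} (hv0 : ∀ ω, v 0 ω = w₀) {σ σ₀ : ℝ} (hσ : 0 ≤ σ)
    (hσ₀ : 0 ≤ σ₀)
    (hX2 : ∀ w, ∫⁻ z, ENNReal.ofReal (‖X w z‖ ^ 2) ∂P ≤ ENNReal.ofReal (σ ^ 2))
    (hinit : ∫⁻ z, ENNReal.ofReal (‖X w₀ z‖ ^ 2) ∂P ≤ ENNReal.ofReal (σ₀ ^ 2)) :
    ∫⁻ ω, ENNReal.ofReal (∑ t ∈ Finset.range T,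
        ‖ema γ (fun s => X (v s ω) (ξ s ω)) t‖ ^ (3 / 2 : ℝ)) ∂μ
      ≤ ENNReal.ofReal (12 * (σ₀ ^ (3 / 2 : ℝ) / γ + T * (γ ^ (3 / 4 : ℝ) * σ ^ (3 / 2 : ℝ)))) := by
  have hmX : ∀ w, Measurable (X w) := fun w => hX.comp measurable_prodMk_left
  have hXi : ∀ w, Integrable (X w) P := fun w =>
    integrable_of_lintegral_sq_le (hmX w).aestronglyMeasurable (hX2 w)
  have htail : ∀ t < T, ∫⁻ ω, ENNReal.ofReal
      (‖emaTail γ (fun s => X (v s ω) (ξ s ω)) t‖ ^ (3 / 2 : ℝ)) ∂μ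
        ≤ ENNReal.ofReal ((√(2 * γ) * σ) ^ (3 / 2 : ℝ)) := by
    intro t ht
    refine lintegral_rpow_three_halves_le ((measurable_emaTail hξ.adapted hv hX t ht).mono
      (ℱ.le _) le_rfl).aestronglyMeasurable (by positivity) ?_
    have h := isSmoothSq_norm_sq.lintegral_emaTail_le zero_le_one hξ hv hX hγ.le hγ1 hXi hX0
      (sq_nonneg σ) hX2 t ht
    rw [mul_pow, Real.sq_sqrt (by positivity)]
    simpa using h
  have hB : (√(2 * γ) * σ) ^ (3 / 2 : ℝ) ≤ 2 * (γ ^ (3 / 4 : ℝ) * σ ^ (3 / 2 : ℝ)) := by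
    rw [Real.mul_rpow (Real.sqrt_nonneg _) hσ, Real.sqrt_eq_rpow, ← Real.rpow_mul (by positivity),
      Real.mul_rpow (by norm_num) hγ.le, ← mul_assoc]
    norm_num
    gcongr
    calc (2 : ℝ) ^ (3 / 4 : ℝ) ≤ 2 ^ (1 : ℝ) :=
          Real.rpow_le_rpow_of_exponent_le (by norm_num) (by norm_num)
      _ = 2 := Real.rpow_one 2
  refine (lintegral_sum_rpow_ema_le hξ hv hX hγ hγ1 hT (p := 3 / 2) (C := 6) (by norm_num)
    (by norm_num) (fun a b ha hb => ?_) hv0 (by positivity) (by positivity)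
    (lintegral_rpow_three_halves_le (hmX w₀).aestronglyMeasurable hσ₀ hinit) htail).trans ?_
  · simpa using three_add_rpow_le ha hb le_rfl
  · refine ENNReal.ofReal_le_ofReal ?_
    have h1 : 0 ≤ σ₀ ^ (3 / 2 : ℝ) / γ := by positivity
    have h2 := mul_le_mul_of_nonneg_left hB (Nat.cast_nonneg (α := ℝ) T)
    nlinarith

/-- The third moment of the tails of the averaged noise of the Hessians. -/
theorem lintegral_norm_cube_emaTail_le {d : ℕ} [IsProbabilityMeasure μ] [IsProbabilityMeasure P]
    {X : V → Ξ → Op d} (hξ : IsSampling P μ ℱ T ξ) (hv : ∀ t < T, Measurable[ℱ t] (v t))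
    (hX : Measurable (Function.uncurry X)) (hγ : 0 < γ) (hγ1 : γ ≤ 1)
    (hX0 : ∀ w, ∫ s, X w s ∂P = 0) {σ δ : ℝ} (hσ : 0 < σ) (hδ : 0 ≤ δ)
    (hX2 : ∀ w, ∫⁻ z, ENNReal.ofReal (‖X w z‖ ^ 2) ∂P ≤ ENNReal.ofReal (σ ^ 2))
    (hXδ : ∀ w, ∀ᵐ z ∂P, ‖X w z‖ ≤ δ) :
    ∀ t < T, ∫⁻ ω, ENNReal.ofReal (‖emaTail γ (fun s => X (v s ω) (ξ s ω)) t‖ ^ 3) ∂μ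
      ≤ ENNReal.ofReal (50000 * ((√((1 + Real.log d) * γ) * σ) ^ 3
        + ((1 + Real.log d) * γ * δ) ^ 3)) := by
  obtain ⟨κ, ψ, hκ, hκl, hψ⟩ := exists_isSmoothNormSq d
  intro t ht
  set l := 1 + Real.log d with hl
  have hl1 : 1 ≤ l := by rw [hl]; linarith [Real.log_natCast_nonneg d]
  have hn := hψ.isSmoothSq.nonneg
  have hmX : ∀ w, Measurable (X w) := fun w => hX.comp measurable_prodMk_left
  have hXi : ∀ w, Integrable (X w) P := fun w =>
    integrable_of_lintegral_sq_le (hmX w).aestronglyMeasurable (hX2 w)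
  have hmul : ∀ (w : V) (c : ℝ), 0 ≤ c →
      ∫⁻ z, ENNReal.ofReal (c * ‖X w z‖ ^ 2) ∂P ≤ ENNReal.ofReal (c * σ ^ 2) := by
    intro w c hc
    simp only [ENNReal.ofReal_mul hc]
    rw [lintegral_const_mul' _ _ ENNReal.ofReal_ne_top]
    gcongr
    exact hX2 w
  have hXs : ∀ w, ∫⁻ z, ENNReal.ofReal (ψ (X w z)) ∂P ≤ ENNReal.ofReal (8 * σ ^ 2) := fun w =>
    (lintegral_mono fun z => ENNReal.ofReal_le_ofReal (hψ.le_norm_sq _)).trans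
      (hmul w 8 (by norm_num))
  have hXq : ∀ w, ∫⁻ z, ENNReal.ofReal (ψ (X w z) ^ 2) ∂P
      ≤ ENNReal.ofReal (64 * δ ^ 2 * σ ^ 2) := by
    intro w
    refine (lintegral_mono_ae ?_).trans (hmul w (64 * δ ^ 2) (by positivity))
    filter_upwards [hXδ w] with z hz
    refine ENNReal.ofReal_le_ofReal ?_
    have h1 := pow_le_pow_left₀ (hn _) (hψ.le_norm_sq (X w z)) 2
    have h2 := mul_le_mul_of_nonneg_right (pow_le_pow_left₀ (norm_nonneg _) hz 2)
      (sq_nonneg ‖X w z‖)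
    nlinarith
  have h2 := hψ.isSmoothSq.lintegral_emaTail_le hκ hξ hv hX hγ.le hγ1 hXi hX0 (by positivity)
    hXs t ht
  have h4 := hψ.lintegral_sq_emaTail_le hκ hξ hv hX hγ.le hγ1 hXi hX0 (by positivity)
    (by positivity) hXs hXq t ht
  -- `w` is the variance scale of the average and `Y` the scale produced by the almost sure bound on
  -- a single sample.
  set w := √(l * γ) * σ with hw
  set Y := l * γ * δ with hY
  have hw0 : 0 < w := mul_pos (Real.sqrt_pos.2 (by positivity)) hσ
  have hY0 : 0 ≤ Y := by positivity
  have hw2 : w ^ 2 = l * γ * σ ^ 2 := by rw [hw, mul_pow, Real.sq_sqrt (by positivity)]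
  have hmt : Measurable fun ω => emaTail γ (fun s => X (v s ω) (ξ s ω)) t :=
    (measurable_emaTail hξ.adapted hv hX t ht).mono (ℱ.le _) le_rfl
  -- The third moment is interpolated between the second and the fourth by the arithmetic-geometric
  -- inequality, weighted with the variance scale `w`.
  have hpt : ∀ A : Op d, ‖A‖ ^ 3 ≤ w / 2 * ψ A + 1 / (2 * w) * ψ A ^ 2 + 0 := by
    intro A
    have h1 := hψ.norm_sq_le A
    have h3 : ‖A‖ ^ 4 ≤ ψ A ^ 2 := by
      have := pow_le_pow_left₀ (sq_nonneg _) h1 2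
      rwa [← pow_mul] at this
    have h5 : ‖A‖ ^ 3 ≤ w / 2 * ‖A‖ ^ 2 + 1 / (2 * w) * ‖A‖ ^ 4 := by
      have e : w / 2 * ‖A‖ ^ 2 + 1 / (2 * w) * ‖A‖ ^ 4 - ‖A‖ ^ 3
          = (‖A‖ * (w - ‖A‖)) ^ 2 / (2 * w) := by field_simp; ring
      have : 0 ≤ (‖A‖ * (w - ‖A‖)) ^ 2 / (2 * w) := by positivity
      linarith
    have h6 := mul_le_mul_of_nonneg_left h1 (by positivity : 0 ≤ w / 2)
    have h7 := mul_le_mul_of_nonneg_left h3 (by positivity : 0 ≤ 1 / (2 * w))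
    linarith
  refine (lintegral_mono fun ω => ENNReal.ofReal_le_ofReal (hpt _)).trans ?_
  refine (lintegral_ofReal_affine_le (hψ.continuous.measurable.comp hmt) (fun _ => hn _)
    (fun _ => sq_nonneg _) (by positivity) (by positivity) le_rfl (by positivity) (by positivity)
    h2 h4).trans (ENNReal.ofReal_le_ofReal ?_)
  have b1 : 2 * κ * γ * (8 * σ ^ 2) ≤ 192 * w ^ 2 := by
    rw [hw2]
    nlinarith [mul_le_mul_of_nonneg_right hκl (by positivity : 0 ≤ γ * σ ^ 2)]
  have hκ2 : κ ^ 2 ≤ 144 * l ^ 2 := by nlinarith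
  have b2 : 8 * κ ^ 2 * γ ^ 2 * (8 * σ ^ 2) ^ 2 ≤ 73728 * w ^ 4 := by
    have : w ^ 4 = l ^ 2 * (γ ^ 2 * σ ^ 4) := by
      rw [show w ^ 4 = (w ^ 2) ^ 2 by ring, hw2]; ring
    rw [this]
    nlinarith [mul_le_mul_of_nonneg_right hκ2 (by positivity : 0 ≤ γ ^ 2 * σ ^ 4)]
  have b3 : 2 * κ ^ 2 * γ ^ 3 * (64 * δ ^ 2 * σ ^ 2) ≤ 18432 * (w ^ 2 * Y ^ 2) := by
    have e : w ^ 2 * Y ^ 2 = l * (l ^ 2 * (γ ^ 3 * δ ^ 2 * σ ^ 2)) := by rw [hw2, hY]; ring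
    have h1 := mul_le_mul_of_nonneg_right hκ2 (by positivity : 0 ≤ γ ^ 3 * δ ^ 2 * σ ^ 2)
    -- A factor l ≥ 1 is given away to reach the form w² Y².
    have h3 : l ^ 2 * (γ ^ 3 * δ ^ 2 * σ ^ 2) ≤ l * (l ^ 2 * (γ ^ 3 * δ ^ 2 * σ ^ 2)) :=
      le_mul_of_one_le_left (by positivity) hl1
    rw [e]
    nlinarith
  calc w / 2 * (2 * κ * γ * (8 * σ ^ 2)) + 1 / (2 * w) * (8 * κ ^ 2 * γ ^ 2 * (8 * σ ^ 2) ^ 2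
        + 2 * κ ^ 2 * γ ^ 3 * (64 * δ ^ 2 * σ ^ 2)) + 0
      ≤ w / 2 * (192 * w ^ 2) + 1 / (2 * w) * (73728 * w ^ 4 + 18432 * (w ^ 2 * Y ^ 2)) + 0 := by
        gcongr
    _ = 36960 * w ^ 3 + 9216 * (w * Y ^ 2) := by field_simp; ring
    _ ≤ 50000 * (w ^ 3 + Y ^ 3) := by
        have : w * Y ^ 2 ≤ w ^ 3 + Y ^ 3 := by
          nlinarith [mul_nonneg (add_nonneg hw0.le hY0) (sq_nonneg (w - Y)),
            mul_nonneg hw0.le (sq_nonneg (w - Y)), pow_nonneg hY0 3, pow_nonneg hw0.le 3]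
        have h1 : 0 ≤ w ^ 3 := by positivity
        have h3 : 0 ≤ Y ^ 3 := by positivity
        linarith

/-- The accumulated third moments of the averaged noise of the Hessians. -/
theorem lintegral_sum_hess_noise_le {d : ℕ} [IsProbabilityMeasure μ] [IsProbabilityMeasure P]
    {X : V → Ξ → Op d} (hξ : IsSampling P μ ℱ T ξ) (hv : ∀ t < T, Measurable[ℱ t] (v t))
    (hX : Measurable (Function.uncurry X)) (hγ : 0 < γ) (hγ1 : γ ≤ 1) (hT : 1 ≤ T)
    (hX0 : ∀ w, ∫ s, X w s ∂P = 0) {w₀ : V} (hv0 : ∀ ω, v 0 ω = w₀) {σ σ₀ δ : ℝ} (hσ : 0 < σ)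
    (hδ : 0 ≤ δ) (hσ₀ : 0 ≤ σ₀)
    (hX2 : ∀ w, ∫⁻ z, ENNReal.ofReal (‖X w z‖ ^ 2) ∂P ≤ ENNReal.ofReal (σ ^ 2))
    (hXδ : ∀ w, ∀ᵐ z ∂P, ‖X w z‖ ≤ δ)
    (hinit : ∫⁻ z, ENNReal.ofReal (‖X w₀ z‖ ^ 3) ∂P ≤ ENNReal.ofReal (σ₀ ^ 3)) :
    ∫⁻ ω, ENNReal.ofReal (∑ t ∈ Finset.range T,
        ‖ema γ (fun s => X (v s ω) (ξ s ω)) t‖ ^ 3) ∂μ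
      ≤ ENNReal.ofReal (200000 * (σ₀ ^ 3 / γ + T * ((√((1 + Real.log d) * γ) * σ) ^ 3
        + ((1 + Real.log d) * γ * δ) ^ 3))) := by
  have hl : 0 ≤ Real.log d := Real.log_natCast_nonneg d
  have e3 : ∀ y : ℝ, y ^ (3 : ℝ) = y ^ 3 := fun y => by exact_mod_cast Real.rpow_natCast y 3
  have h := lintegral_sum_rpow_ema_le hξ hv hX hγ hγ1 hT (p := 3) (C := 4) (by norm_num)
    (by norm_num) (fun a b ha hb => ?_) hv0 (A := σ₀ ^ 3) (B := 50000 *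
      ((√((1 + Real.log d) * γ) * σ) ^ 3 + ((1 + Real.log d) * γ * δ) ^ 3)) (by positivity)
    (by positivity) (by simpa only [e3] using hinit)
    (by simpa only [e3] using lintegral_norm_cube_emaTail_le hξ hv hX hγ hγ1 hX0 hσ hδ hX2 hXδ)
  · simp only [e3] at h
    refine h.trans (ENNReal.ofReal_le_ofReal ?_)
    have h1 : 0 ≤ σ₀ ^ 3 / γ := by positivity
    linarith
  · simp only [e3]
    nlinarith [mul_nonneg (add_nonneg ha hb) (sq_nonneg (a - b))]

end NoiseBounds

/-! ### Inserting the momentum parameters into the moment bounds. -/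

section RateArithmetic

/-- Applied with the first entry of the maximum that defines α or β: it makes the cost 1/(γT) of the
initial noise as small as the corresponding part of the steady noise. -/
lemma rpow_div_mul_le {a T γ q r s s' : ℝ} (ha : 0 ≤ a) (hT : 0 < T) (hγ : 0 < γ) (hq : 0 ≤ q)
    (hr : 0 ≤ r) (hs : s + s' = 1) (h : a ^ r / T ^ s ≤ γ) :
    a ^ (q + r) / (γ * T) ≤ a ^ q / T ^ s' := by
  have hTs : 0 < T ^ s := Real.rpow_pos_of_pos hT _
  have hTs' : 0 < T ^ s' := Real.rpow_pos_of_pos hT _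
  have e : T = T ^ s * T ^ s' := by rw [← Real.rpow_add hT, hs, Real.rpow_one]
  rw [div_le_iff₀ hTs] at h
  rw [div_le_div_iff₀ (by positivity) hTs', Real.rpow_add_of_nonneg ha hq hr]
  calc a ^ q * a ^ r * T ^ s' ≤ a ^ q * (γ * T ^ s) * T ^ s' := by gcongr
    _ = a ^ q * (γ * (T ^ s * T ^ s')) := by ring
    _ = a ^ q * (γ * T) := by rw [← e]

lemma max_rpow_le_add {a b p : ℝ} (ha : 0 ≤ a) (hb : 0 ≤ b) :
    max a b ^ p ≤ a ^ p + b ^ p := by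
  have h1 : 0 ≤ a ^ p := by positivity
  have h2 : 0 ≤ b ^ p := by positivity
  rcases max_choice a b with h | h <;> rw [h] <;> linarith

lemma div_rpow_rpow {a T r s p : ℝ} (ha : 0 ≤ a) (hT : 0 ≤ T) :
    (a ^ r / T ^ s) ^ p = a ^ (r * p) / T ^ (s * p) := by
  rw [Real.div_rpow (by positivity) (by positivity), ← Real.rpow_mul ha, ← Real.rpow_mul hT]

variable {c : Constants}

lemma Constants.sigmaTilde_cube (c : Constants) (d : ℕ) (hσ : 0 ≤ c.σh) (hδ : 0 ≤ c.δh) {b : ℝ}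
    (hb : 0 ≤ b) : c.sigmaTilde d b ^ 3 = (1 + Real.log d) ^ (3 / 2 : ℝ) * c.σh ^ 3
      + (1 + Real.log d) ^ 3 * b ^ (3 / 2 : ℝ) * c.δh ^ 3 := by
  have hl : 0 ≤ Real.log d := Real.log_natCast_nonneg d
  rw [Constants.sigmaTilde, ← Real.rpow_natCast, ← Real.rpow_mul (by positivity)]
  norm_num

/-- The effective noise level is defined so that the third moment of the averaged Hessian noise
factors as b^{3/2} times its cube. -/
lemma Constants.noise_eq (c : Constants) (d : ℕ) (hσ : 0 ≤ c.σh) (hδ : 0 ≤ c.δh) {b : ℝ}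
    (hb : 0 ≤ b) : (√((1 + Real.log d) * b) * c.σh) ^ 3 + ((1 + Real.log d) * b * c.δh) ^ 3
      = b ^ (3 / 2 : ℝ) * c.sigmaTilde d b ^ 3 := by
  have hl : 0 ≤ Real.log d := Real.log_natCast_nonneg d
  have e : b ^ 3 = b ^ (3 / 2 : ℝ) * b ^ (3 / 2 : ℝ) := by
    rw [← Real.rpow_add_of_nonneg hb (by norm_num) (by norm_num), ← Real.rpow_natCast]
    norm_num
  rw [c.sigmaTilde_cube d hσ hδ hb, mul_pow, mul_pow, mul_pow, e,
    ← rpow_three_halves_eq_sqrt (by positivity), Real.mul_rpow (by positivity) hb]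
  ring

lemma Constants.sigmaTilde_nonneg (c : Constants) (d : ℕ) (hσ : 0 ≤ c.σh) (hδ : 0 ≤ c.δh) {b : ℝ}
    (hb : 0 ≤ b) : 0 ≤ c.sigmaTilde d b := by
  have hl : 0 ≤ Real.log d := Real.log_natCast_nonneg d
  unfold Constants.sigmaTilde
  positivity

lemma Constants.σh_cube_le (c : Constants) (d : ℕ) (hσ : 0 ≤ c.σh) (hδ : 0 ≤ c.δh) {b : ℝ}
    (hb : 0 ≤ b) : c.σh ^ 3 ≤ c.sigmaTilde d b ^ 3 := by
  have hl : 0 ≤ Real.log d := Real.log_natCast_nonneg d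
  rw [c.sigmaTilde_cube d hσ hδ hb]
  have h1 : 1 ≤ (1 + Real.log d) ^ (3 / 2 : ℝ) := Real.one_le_rpow (by linarith) (by norm_num)
  have h2 : 0 ≤ (1 + Real.log d) ^ 3 * b ^ (3 / 2 : ℝ) * c.δh ^ 3 := by positivity
  have h3 : c.σh ^ 3 ≤ (1 + Real.log d) ^ (3 / 2 : ℝ) * c.σh ^ 3 :=
    le_mul_of_one_le_left (by positivity) h1
  linarith

lemma Constants.alpha_le_one (hag : 0 ≤ c.ag) (hag1 : c.ag ≤ 1) {M : ℝ} (hM : 0 < M)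
    (hLM : 100 * c.L ≤ M) {T : ℕ} (hT : 1 ≤ T) : c.alpha M T ≤ 1 := by
  have hT' : (1 : ℝ) ≤ T := by exact_mod_cast hT
  refine max_le ?_ ?_
  · rw [div_le_one (by positivity)]
    exact (Real.rpow_le_one hag hag1 (by norm_num)).trans (Real.one_le_rpow hT' (by norm_num))
  · have h1 : c.L / M ≤ (1 / 10) ^ 2 := by rw [div_le_iff₀ hM]; linarith
    have h2 : √(c.L / M) ≤ 1 / 10 := Real.sqrt_le_iff.2 ⟨by norm_num, h1⟩
    linarith

lemma Constants.le_alpha_sq (hL : 0 ≤ c.L) {M : ℝ} (hM : 0 < M) (T : ℕ) :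
    100 * c.L ≤ M * c.alpha M T ^ 2 := by
  have h1 : 10 * √(c.L / M) ≤ c.alpha M T := le_max_right _ _
  have h2 := pow_le_pow_left₀ (by positivity) h1 2
  rw [mul_pow, Real.sq_sqrt (by positivity)] at h2
  calc 100 * c.L = M * (10 ^ 2 * (c.L / M)) := by field_simp; ring
    _ ≤ _ := by gcongr

lemma Constants.beta_le_one (hah : 0 ≤ c.ah) (hah1 : c.ah ≤ 1) {M : ℝ} (hM : 0 < M)
    (hLM : 100 * c.L ≤ M) {T : ℕ} (hT : 1 ≤ T) : c.beta M T ≤ 1 := by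
  have hT' : (1 : ℝ) ≤ T := by exact_mod_cast hT
  refine max_le ?_ ?_
  · rw [div_le_one (by positivity)]
    exact (Real.rpow_le_one hah hah1 (by norm_num)).trans (Real.one_le_rpow hT' (by norm_num))
  · have h1 : c.L / M ≤ 1 / 100 := by rw [div_le_iff₀ hM]; linarith
    linarith

lemma forty_six_rpow_le : (46 : ℝ) ^ (3 / 2 : ℝ) ≤ 399 := by
  rw [rpow_three_halves_eq_sqrt (by norm_num)]
  have h1 : √(46 : ℝ) ≤ 7 := Real.sqrt_le_iff.2 (by norm_num)
  have h2 := pow_le_pow_left₀ (Real.sqrt_nonneg 46) h1 3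
  linarith

lemma Constants.le_beta {M : ℝ} (hM : 0 < M) (T : ℕ) : 46 * c.L ≤ M * c.beta M T := by
  have h1 : 46 * (c.L / M) ≤ c.beta M T := le_max_right _ _
  calc 46 * c.L = M * (46 * (c.L / M)) := by field_simp
    _ ≤ _ := by gcongr

/-- The accumulated moment bounds, evaluated at the prescribed momentum parameters. -/
lemma Constants.le_rate (c : Constants) (d : ℕ) {F₀ M : ℝ} {T : ℕ} (hT : 1 ≤ T) (hM : 0 < M)
    (hL : 0 ≤ c.L) (hF : 0 ≤ F₀) (hσg : 0 < c.σg) (hσh : 0 < c.σh) (hδ : 0 ≤ c.δh)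
    (hσg₀ : 0 ≤ c.σg₀) (hσh₀ : 0 ≤ c.σh₀) (hα : 0 < c.alpha M T) (hβ : 0 < c.beta M T) :
    (√M * F₀ + (c.σg₀ ^ (3 / 2 : ℝ) / c.alpha M T
        + T * (c.alpha M T ^ (3 / 4 : ℝ) * c.σg ^ (3 / 2 : ℝ)))
      + (c.σh₀ ^ 3 / c.beta M T + T * (c.beta M T ^ (3 / 2 : ℝ) *
        c.sigmaTilde d (c.beta M T) ^ 3)) / √M ^ 3) / T ≤ 400 * c.rate d F₀ M T := by
  have hT0 : (0 : ℝ) < T := by exact_mod_cast hT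
  have hag : 0 ≤ c.ag := div_nonneg hσg₀ hσg.le
  have hah : 0 ≤ c.ah := div_nonneg hσh₀ hσh.le
  have hM3 : √M ^ 3 = M ^ (3 / 2 : ℝ) := (rpow_three_halves_eq_sqrt hM.le).symm
  set S := c.sigmaTilde d (c.beta M T) ^ 3 with hS
  have hσS : c.σh ^ 3 ≤ S := c.σh_cube_le d hσh.le hδ hβ.le
  have hS0 : 0 ≤ S := (by positivity : 0 ≤ c.σh ^ 3).trans hσS
  have hG : 0 ≤ c.σg ^ (3 / 2 : ℝ) := by positivity
  have hLM : 0 ≤ c.L / M := by positivity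
  have a2 : c.σg₀ ^ (3 / 2 : ℝ) / c.alpha M T / T
      ≤ c.ag ^ (9 / 14 : ℝ) * c.σg ^ (3 / 2 : ℝ) / (T : ℝ) ^ (3 / 7 : ℝ) := by
    have h := rpow_div_mul_le hag hT0 hα (q := 9 / 14) (r := 6 / 7) (s := 4 / 7) (s' := 3 / 7)
      (by norm_num) (by norm_num) (by norm_num) (le_max_left _ _)
    have e : c.σg₀ = c.ag * c.σg := by rw [Constants.ag]; field_simp
    rw [e, Real.mul_rpow hag hσg.le]
    norm_num at h
    calc _ = c.ag ^ (3 / 2 : ℝ) / (c.alpha M T * T) * c.σg ^ (3 / 2 : ℝ) := by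
          field_simp
      _ ≤ c.ag ^ (9 / 14 : ℝ) / (T : ℝ) ^ (3 / 7 : ℝ) * c.σg ^ (3 / 2 : ℝ) := by gcongr
      _ = _ := by ring
  have a3 : c.alpha M T ^ (3 / 4 : ℝ) * c.σg ^ (3 / 2 : ℝ)
      ≤ c.ag ^ (9 / 14 : ℝ) * c.σg ^ (3 / 2 : ℝ) / (T : ℝ) ^ (3 / 7 : ℝ)
        + 10 * ((c.L / M) ^ (3 / 8 : ℝ) * c.σg ^ (3 / 2 : ℝ)) := by
    have h := max_rpow_le_add (a := c.ag ^ (6 / 7 : ℝ) / (T : ℝ) ^ (4 / 7 : ℝ))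
      (b := 10 * √(c.L / M)) (p := 3 / 4) (by positivity) (by positivity)
    rw [div_rpow_rpow hag hT0.le, Real.mul_rpow (by norm_num) (by positivity), Real.sqrt_eq_rpow,
      ← Real.rpow_mul hLM] at h
    norm_num at h
    have h10 : (10 : ℝ) ^ (3 / 4 : ℝ) ≤ 10 := by
      simpa using Real.rpow_le_rpow_of_exponent_le (by norm_num : (1 : ℝ) ≤ 10)
        (by norm_num : (3 / 4 : ℝ) ≤ 1)
    calc _ ≤ (c.ag ^ (9 / 14 : ℝ) / (T : ℝ) ^ (3 / 7 : ℝ) + 10 * (c.L / M) ^ (3 / 8 : ℝ))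
          * c.σg ^ (3 / 2 : ℝ) := by
          refine mul_le_mul_of_nonneg_right ?_ hG
          rw [Constants.alpha, Real.sqrt_eq_rpow]
          refine h.trans ?_
          gcongr
      _ = _ := by ring
  -- The initial noise is σ_h³ a_h³ with 3 = 9/5 + 6/5; the part a_h^{6/5} is spent against the
  -- lower bound on β.
  have a4 : c.σh₀ ^ 3 / c.beta M T / √M ^ 3 / T
      ≤ c.ah ^ (9 / 5 : ℝ) * S / (M ^ (3 / 2 : ℝ) * (T : ℝ) ^ (3 / 5 : ℝ)) := by
    have h := rpow_div_mul_le hah hT0 hβ (q := 9 / 5) (r := 6 / 5) (s := 2 / 5) (s' := 3 / 5)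
      (by norm_num) (by norm_num) (by norm_num) (le_max_left _ _)
    have e : c.σh₀ = c.ah * c.σh := by rw [Constants.ah]; field_simp
    norm_num at h
    rw [e, hM3, mul_pow]
    calc _ = c.ah ^ 3 / (c.beta M T * T) * c.σh ^ 3 / M ^ (3 / 2 : ℝ) := by field_simp
      _ ≤ c.ah ^ (9 / 5 : ℝ) / (T : ℝ) ^ (3 / 5 : ℝ) * S / M ^ (3 / 2 : ℝ) := by gcongr
      _ = _ := by field_simp
  have a5 : c.beta M T ^ (3 / 2 : ℝ) * S / √M ^ 3
      ≤ c.ah ^ (9 / 5 : ℝ) * S / (M ^ (3 / 2 : ℝ) * (T : ℝ) ^ (3 / 5 : ℝ))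
        + 399 * (c.L ^ (3 / 2 : ℝ) * S / M ^ 3) := by
    have h := max_rpow_le_add (a := c.ah ^ (6 / 5 : ℝ) / (T : ℝ) ^ (2 / 5 : ℝ))
      (b := 46 * (c.L / M)) (p := 3 / 2) (by positivity) (by positivity)
    rw [div_rpow_rpow hah hT0.le, Real.mul_rpow (by norm_num) hLM] at h
    norm_num at h
    have h46 := forty_six_rpow_le
    have eM : M ^ 3 = M ^ (3 / 2 : ℝ) * M ^ (3 / 2 : ℝ) := by
      rw [← Real.rpow_add hM, ← Real.rpow_natCast]; norm_num
    rw [hM3, eM]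
    calc _ ≤ (c.ah ^ (9 / 5 : ℝ) / (T : ℝ) ^ (3 / 5 : ℝ) + 399 * (c.L / M) ^ (3 / 2 : ℝ)) * S
          / M ^ (3 / 2 : ℝ) := by
          refine div_le_div_of_nonneg_right (mul_le_mul_of_nonneg_right ?_ hS0) (by positivity)
          rw [Constants.beta]
          refine h.trans ?_
          gcongr
      _ = _ := by
        rw [Real.div_rpow hL hM.le]
        field_simp
  have e : (√M * F₀ + (c.σg₀ ^ (3 / 2 : ℝ) / c.alpha M T
        + T * (c.alpha M T ^ (3 / 4 : ℝ) * c.σg ^ (3 / 2 : ℝ)))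
      + (c.σh₀ ^ 3 / c.beta M T + T * (c.beta M T ^ (3 / 2 : ℝ) * S)) / √M ^ 3) / T
      = √M * F₀ / T + c.σg₀ ^ (3 / 2 : ℝ) / c.alpha M T / T
        + c.alpha M T ^ (3 / 4 : ℝ) * c.σg ^ (3 / 2 : ℝ)
        + c.σh₀ ^ 3 / c.beta M T / √M ^ 3 / T + c.beta M T ^ (3 / 2 : ℝ) * S / √M ^ 3 := by
    field_simp
    ring
  rw [e, Constants.rate, ← hS]
  have p1 : 0 ≤ √M * F₀ / T := by positivity
  have p2 : 0 ≤ c.L ^ (3 / 2 : ℝ) * S / M ^ 3 := by positivity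
  have p3 : 0 ≤ (c.L / M) ^ (3 / 8 : ℝ) * c.σg ^ (3 / 2 : ℝ) := by positivity
  have p4 : 0 ≤ c.ag ^ (9 / 14 : ℝ) * c.σg ^ (3 / 2 : ℝ) / (T : ℝ) ^ (3 / 7 : ℝ) := by positivity
  have p5 : 0 ≤ c.ah ^ (9 / 5 : ℝ) * S / (M ^ (3 / 2 : ℝ) * (T : ℝ) ^ (3 / 5 : ℝ)) := by
    positivity
  linarith

end RateArithmetic

/-! ### The uniformly random output. -/

section Output

variable {d : ℕ} {Ξ Ω : Type*} [MeasurableSpace Ξ] [mΩ : MeasurableSpace Ω] {μ : Measure Ω}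

/-- The output is expanded as a sum of indicators of τ = t + 1 times φ(x_{t+1}), and independence
factors each term. Only almost surely does τ lie in {1, …, T}, so the expansion holds almost
everywhere. -/
lemma lintegral_uniformIndex_le {T : ℕ} {x : ℕ → Ω → Vec d} {τ : Ω → ℕ}
    (hτ : IsUniformIndex T μ x τ) (hx : ∀ t ≤ T, Measurable (x t)) {φ : Vec d → ℝ}
    (hφ : Measurable φ) (hφ0 : ∀ y, 0 ≤ φ y) :
    AEStronglyMeasurable (fun ω => φ (x (τ ω) ω)) μ ∧
    ∫⁻ ω, ENNReal.ofReal (φ (x (τ ω) ω)) ∂μ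
      = (T : ENNReal)⁻¹ * ∫⁻ ω, ENNReal.ofReal (∑ t ∈ Finset.range T, φ (x (t + 1) ω)) ∂μ := by
  have hcount : Measure.count (Set.Icc 1 T) = (T : ENNReal) := by
    rw [← Finset.coe_Icc, Measure.count_apply_finset]; simp
  have hlaw : ∀ A : Set ℕ, μ (τ ⁻¹' A) = (T : ENNReal)⁻¹ * Measure.count (Set.Icc 1 T ∩ A) := by
    intro A
    rw [← Measure.map_apply hτ.measurable (MeasurableSet.of_discrete), hτ.law, uniformOn,
      cond_apply (MeasurableSet.of_discrete), hcount]
  have hae : ∀ᵐ ω ∂μ, τ ω ∈ Set.Icc 1 T := by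
    have h := hlaw (Set.Icc 1 T)ᶜ
    rw [Set.inter_compl_self, measure_empty, mul_zero] at h
    exact h
  let ι : ℕ → ℕ → ℝ := fun t n => if n = t + 1 then 1 else 0
  have hexp : ∀ᵐ ω ∂μ, φ (x (τ ω) ω)
      = ∑ t ∈ Finset.range T, ι t (τ ω) * φ (x (t + 1) ω) := by
    filter_upwards [hae] with ω hω
    have h1 : τ ω - 1 + 1 = τ ω := Nat.sub_add_cancel hω.1
    rw [Finset.sum_eq_single (τ ω - 1)]
    · simp [ι, h1]
    · intro b _ hb
      have : τ ω ≠ b + 1 := by omega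
      simp [ι, this]
    · intro h
      exact absurd (Finset.mem_range.2 (by have := hω.1; have := hω.2; omega)) h
  have hιm : ∀ t, Measurable fun ω => ι t (τ ω) := fun t =>
    (Measurable.of_discrete (f := ι t)).comp hτ.measurable
  have hι0 : ∀ t n, 0 ≤ ι t n := fun t n => by simp only [ι]; split_ifs <;> norm_num
  have hxm : ∀ t ∈ Finset.range T, Measurable fun ω => φ (x (t + 1) ω) := fun t ht =>
    hφ.comp (hx _ (Finset.mem_range.1 ht))
  refine ⟨⟨fun ω => ∑ t ∈ Finset.range T, ι t (τ ω) * φ (x (t + 1) ω),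
    (Finset.measurable_sum _ fun t ht => (hιm t).mul (hxm t ht)).stronglyMeasurable, hexp⟩, ?_⟩
  rw [lintegral_congr_ae (hexp.mono fun ω h => congrArg ENNReal.ofReal h)]
  simp only [ENNReal.ofReal_sum_of_nonneg fun t _ => mul_nonneg (hι0 t _) (hφ0 _),
    ENNReal.ofReal_sum_of_nonneg fun t _ => hφ0 _, ENNReal.ofReal_mul (hι0 _ _)]
  have hprod : ∀ t ∈ Finset.range T, Measurable fun ω =>
      ENNReal.ofReal (ι t (τ ω)) * ENNReal.ofReal (φ (x (t + 1) ω)) := fun t ht =>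
    (hιm t).ennreal_ofReal.mul (hxm t ht).ennreal_ofReal
  rw [lintegral_finsetSum _ hprod,
    lintegral_finsetSum _ fun t ht => (hxm t ht).ennreal_ofReal, Finset.mul_sum]
  refine Finset.sum_congr rfl fun t ht => ?_
  have ht' : t + 1 ≤ T := Finset.mem_range.1 ht
  have hind : IndepFun (fun ω => ENNReal.ofReal (ι t (τ ω)))
      (fun ω => ENNReal.ofReal (φ (x (t + 1) ω))) μ :=
    hτ.indep.comp (φ := fun n => ENNReal.ofReal (ι t n))
      (ψ := fun y : Fin (T + 1) → Vec d => ENNReal.ofReal (φ (y ⟨t + 1, by omega⟩)))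
      Measurable.of_discrete
      ((hφ.comp (measurable_pi_apply (⟨t + 1, by omega⟩ : Fin (T + 1)))).ennreal_ofReal)
  have hmul := lintegral_mul_eq_lintegral_mul_lintegral_of_indepFun (hιm t).ennreal_ofReal
    (hxm t ht).ennreal_ofReal hind
  simp only [Pi.mul_apply] at hmul
  rw [hmul]
  congr 1
  have hs : MeasurableSet (τ ⁻¹' {t + 1}) := hτ.measurable (MeasurableSet.of_discrete)
  have e : (fun ω => ENNReal.ofReal (ι t (τ ω))) = (τ ⁻¹' {t + 1}).indicator 1 := by
    funext ω
    by_cases h : τ ω = t + 1 <;> simp [ι, Set.indicator, h]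
  rw [e, lintegral_indicator_one hs, hlaw,
    Set.inter_eq_right.2 (by simpa using ht'), Measure.count_singleton, mul_one]

end Output

/-! ### The rate for a run of the method at a fixed M. -/

section Run

variable {d : ℕ} {Ξ : Type u} {Ω : Type v} [MeasurableSpace Ξ] [mΩ : MeasurableSpace Ω]
  {P : Measure Ξ} {F : Ξ → Vec d → ℝ} {x₀ : Vec d} {c : Constants} {M α β : ℝ} {T : ℕ}
  {μ : Measure Ω} {ℱ : Filtration ℕ mΩ} {ξg ξh : ℕ → Ω → Ξ} {x g : ℕ → Ω → Vec d}
  {H : ℕ → Ω → Op d}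

/-- The points at which the stochastic gradients are evaluated. -/
def extrapolated (α : ℝ) (x : ℕ → Ω → Vec d) : ℕ → Ω → Vec d
  | 0 => x 0
  | t + 1 => fun ω => x (t + 1) ω + ((1 - α) / α) • (x (t + 1) ω - x t ω)

/-- The error of the stochastic gradient. -/
def gradientNoise (P : Measure Ξ) (F : Ξ → Vec d → ℝ) (w : Vec d) (s : Ξ) : Vec d :=
  gradient (F s) w - gradient (objective P F) w

/-- The error of the stochastic Hessian. -/
def hessNoise (P : Measure Ξ) (F : Ξ → Vec d → ℝ) (w : Vec d) (s : Ξ) : Op d :=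
  hess (F s) w - hess (objective P F) w

lemma Assumptions.measurable_gradientNoise (h : Assumptions P F x₀ c) :
    Measurable (Function.uncurry (gradientNoise P F)) :=
  ((measurable_gradient_uncurry h.sample_measurable
    fun ξ => (h.sample_twiceDifferentiable ξ).1).comp measurable_swap).sub
    (h.twiceDifferentiable.2.continuous.measurable.comp measurable_fst)

lemma Assumptions.measurable_hessNoise (h : Assumptions P F x₀ c) :
    Measurable (Function.uncurry (hessNoise P F)) := by
  have : ProperSpace (Op d) := FiniteDimensional.proper ℝ _
  exact ((measurable_hess_uncurry h.sample_measurable h.sample_twiceDifferentiable).comp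
    measurable_swap).sub
    ((continuous_of_norm_sub_le h.hess_lipschitz).measurable.comp measurable_fst)

lemma integral_sub_const_eq_zero {E : Type*} [NormedAddCommGroup E] [NormedSpace ℝ E]
    [CompleteSpace E] [IsProbabilityMeasure P] {X : Ξ → E} {a : E}
    (hX : Integrable (fun s => X s - a) P) (ha : ∫ s, X s ∂P = a) : ∫ s, (X s - a) ∂P = 0 := by
  have h1 : Integrable X P := (hX.add (integrable_const a)).congr
    (Filter.Eventually.of_forall fun s => by simp)
  rw [integral_sub h1 (integrable_const a), ha]
  simp

lemma Assumptions.integral_gradientNoise [IsProbabilityMeasure P] (h : Assumptions P F x₀ c)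
    (w : Vec d) : ∫ s, gradientNoise P F w s ∂P = 0 :=
  integral_sub_const_eq_zero (integrable_of_lintegral_sq_le
    (h.measurable_gradientNoise.comp measurable_prodMk_left).aestronglyMeasurable
    (h.grad_noise w)) (h.grad_unbiased w)

lemma Assumptions.integral_hessNoise [IsProbabilityMeasure P] (h : Assumptions P F x₀ c)
    (w : Vec d) : ∫ s, hessNoise P F w s ∂P = 0 := by
  have : ProperSpace (Op d) := FiniteDimensional.proper ℝ _
  exact integral_sub_const_eq_zero (integrable_of_lintegral_sq_le
    (h.measurable_hessNoise.comp measurable_prodMk_left).aestronglyMeasurable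
    (h.hess_noise w)) (h.hess_unbiased w)

namespace IsCubicNewtonRun

/-- Only the independence of the gradient sample from the past is kept. Gradient and Hessian noise
are estimated separately, so dependence between the two samples is harmless. -/
lemma isSampling_ξg (hr : IsCubicNewtonRun P F x₀ M α β T μ ℱ ξg ξh x g H) :
    IsSampling P μ ℱ T ξg where
  adapted := hr.ξg_adapted
  law := hr.ξg_law
  indep t ht := indep_of_indep_of_le_left (hr.sample_indep t ht) (by
    rw [show ξg t = Prod.fst ∘ fun ω => (ξg t ω, ξh t ω) from rfl, ← MeasurableSpace.comap_comp]
    exact MeasurableSpace.comap_mono measurable_fst.comap_le)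

lemma isSampling_ξh (hr : IsCubicNewtonRun P F x₀ M α β T μ ℱ ξg ξh x g H) :
    IsSampling P μ ℱ T ξh where
  adapted := hr.ξh_adapted
  law := hr.ξh_law
  indep t ht := indep_of_indep_of_le_left (hr.sample_indep t ht) (by
    rw [show ξh t = Prod.snd ∘ fun ω => (ξg t ω, ξh t ω) from rfl, ← MeasurableSpace.comap_comp]
    exact MeasurableSpace.comap_mono measurable_snd.comap_le)

lemma measurable_extrapolated (hr : IsCubicNewtonRun P F x₀ M α β T μ ℱ ξg ξh x g H) :
    ∀ t < T, Measurable[ℱ t] (extrapolated α x t) := by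
  intro t ht
  cases t with
  | zero => exact hr.x_adapted 0 (by omega)
  | succ t =>
    have h1 := hr.x_adapted (t + 1) (by omega)
    have h2 := (hr.x_adapted t (by omega)).mono (ℱ.mono (Nat.le_succ t)) le_rfl
    have h3 : Measurable[ℱ (t + 1)] fun ω => ((1 - α) / α) • (x (t + 1) ω - x t ω) :=
      (h1.sub h2).const_smul ((1 - α) / α)
    exact h1.add h3

/-- H_t is a linear combination of Hessians of the f_ξ, each symmetric; the first-order condition of
the cubic model depends on this. -/
lemma hess_symm (h : Assumptions P F x₀ c)
    (hr : IsCubicNewtonRun P F x₀ M α β T μ ℱ ξg ξh x g H) (ω : Ω) :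
    ∀ t < T, ∀ u v, inner ℝ (H t ω u) v = inner ℝ u (H t ω v) := by
  intro t
  induction t with
  | zero =>
    intro _ u v
    rw [hr.H_zero]
    exact CubicMomentum.hess_symm (h.sample_twiceDifferentiable _) _ u v
  | succ t ih =>
    intro ht u v
    rw [hr.H_succ t ht]
    simp only [add_apply, smul_apply, inner_add_left, inner_add_right,
      inner_smul_left, inner_smul_right, conj_trivial, ih (by omega) u v,
      CubicMomentum.hess_symm (h.sample_twiceDifferentiable _) _ u v]

/-- The pathwise bound for the accumulated accuracy of a run. -/
lemma sum_mu_le (h : Assumptions P F x₀ c)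
    (hr : IsCubicNewtonRun P F x₀ M α β T μ ℱ ξg ξh x g H) (hα1 : α ≤ 1) (hβ1 : β ≤ 1)
    (hLα : 100 * c.L ≤ M * α ^ 2) (hLβ : 46 * c.L ≤ M * β) (ω : Ω) :
    ∑ t ∈ Finset.range T, mu (objective P F) M (x (t + 1) ω)
      ≤ 10 ^ 4 * (√M * initialGap (objective P F) x₀
      + 400 * ∑ t ∈ Finset.range T, ‖ema α (fun s => gradientNoise P F
          (extrapolated α x s ω) (ξg s ω)) t‖ ^ (3 / 2 : ℝ)
      + 400 * ∑ t ∈ Finset.range T, ‖ema β (fun s => hessNoise P F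
          (x s ω) (ξh s ω)) t‖ ^ 3 / √M ^ 3) := by
  refine (sum_mu_le_of_path h.twiceDifferentiable h.L_nonneg h.hess_lipschitz hr.M_pos hr.α_pos
    hα1 hr.β_pos hβ1 hLα hLβ T (x := fun t => x t ω) (g := fun t => g t ω) (H := fun t => H t ω)
    (ζg := fun s => gradientNoise P F (extrapolated α x s ω) (ξg s ω))
    (ζh := fun s => hessNoise P F (x s ω) (ξh s ω)) (hr.hess_symm h ω)
    (fun t ht => hr.x_succ t ht ω) ?_ ?_ (fun t ht => ?_) (fun t ht => ?_)).trans ?_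
  · simp [hr.g_zero, gradientNoise, extrapolated]
  · simp [hr.H_zero, hessNoise]
  · simp only [hr.g_succ t ht, gradientNoise, extrapolated, add_sub_cancel]
  · simp only [hr.H_succ t ht, hessNoise, add_sub_cancel]
  · have h1 : objective P F (x 0 ω) - objective P F (x T ω)
        ≤ initialGap (objective P F) x₀ := by
      rw [initialGap, hr.x_zero]
      linarith [ciInf_le h.bddBelow (x T ω)]
    gcongr

end IsCubicNewtonRun

/-- The rate of the method for every regularization parameter `M ≥ 100 L`. -/
theorem outputBound_rate [IsProbabilityMeasure P] (h : Assumptions P F x₀ c) (hT : 1 ≤ T)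
    (hLM : 100 * c.L ≤ M) :
    OutputBound.{u, v} P F x₀ c M T (4 * 10 ^ 14 * c.rate d (initialGap (objective P F) x₀) M T) := by
  intro Ω mΩ μ _ ℱ ξg ξh x g H τ hr hτ
  set f := objective P F with hf
  have hM := hr.M_pos
  have hT0 : (0 : ℝ) < T := by exact_mod_cast hT
  have hag : 0 ≤ c.ag := div_nonneg h.σg₀_nonneg h.σg_pos.le
  have hag1 : c.ag ≤ 1 := (div_le_one h.σg_pos).2 h.σg₀_le
  have hah : 0 ≤ c.ah := div_nonneg h.σh₀_nonneg h.σh_pos.le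
  have hah1 : c.ah ≤ 1 := (div_le_one h.σh_pos).2 h.σh₀_le
  have hα1 := Constants.alpha_le_one hag hag1 hM hLM hT
  have hβ1 := Constants.beta_le_one hah hah1 hM hLM hT
  have hF : 0 ≤ initialGap f x₀ := sub_nonneg.2 (ciInf_le h.bddBelow x₀)
  have hx : ∀ t ≤ T, Measurable (x t) := fun t ht => (hr.x_adapted t ht).mono (ℱ.le t) le_rfl
  obtain ⟨hmeas, hout⟩ := lintegral_uniformIndex_le hτ hx
    (continuous_mu h.twiceDifferentiable h.hess_lipschitz M).measurable (mu_nonneg f M)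
  have hmg := h.measurable_gradientNoise
  have hG := lintegral_sum_gradient_noise_le hr.isSampling_ξg hr.measurable_extrapolated hmg
    hr.α_pos hα1 hT h.integral_gradientNoise (w₀ := x₀) (fun ω => hr.x_zero ω) h.σg_pos.le
    h.σg₀_nonneg h.grad_noise h.grad_noise_init
  have hH := lintegral_sum_hess_noise_le hr.isSampling_ξh (fun t ht => hr.x_adapted t ht.le)
    h.measurable_hessNoise hr.β_pos hβ1 hT h.integral_hessNoise (w₀ := x₀)
    (fun ω => hr.x_zero ω) h.σh_pos h.δh_pos.le h.σh₀_nonneg h.hess_noise h.hess_noise_bdd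
    h.hess_noise_init
  rw [c.noise_eq d h.σh_pos.le h.δh_pos.le hr.β_pos.le] at hH
  set α := c.alpha M T
  set β := c.beta M T
  set A := c.σg₀ ^ (3 / 2 : ℝ) / α + T * (α ^ (3 / 4 : ℝ) * c.σg ^ (3 / 2 : ℝ)) with hA
  set B := c.σh₀ ^ 3 / β + T * (β ^ (3 / 2 : ℝ) * c.sigmaTilde d β ^ 3) with hB
  have hα := hr.α_pos
  have hβ := hr.β_pos
  have hS := c.sigmaTilde_nonneg d h.σh_pos.le h.δh_pos.le hβ.le
  have hσ1 := h.σg₀_nonneg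
  have hσ2 := h.σh₀_nonneg
  have hσ3 := h.σg_pos
  have hA0 : 0 ≤ A := by positivity
  have hB0 : 0 ≤ B := by positivity
  have hsm := Real.sqrt_pos.2 hM
  have hpath := hr.sum_mu_le h hα1 hβ1 (Constants.le_alpha_sq h.L_nonneg hM T)
    (Constants.le_beta hM T)
  -- The constants multiply: 10⁴ · 400 from the pathwise estimate, times 12 for gradients and 200000
  -- for Hessians, all below 10¹².
  have htotal : ∫⁻ ω, ENNReal.ofReal (∑ t ∈ Finset.range T, mu f M (x (t + 1) ω)) ∂μ
      ≤ ENNReal.ofReal (10 ^ 12 * (√M * initialGap f x₀ + A + B / √M ^ 3)) := by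
    have h1 : ∀ ω, ∑ t ∈ Finset.range T, mu f M (x (t + 1) ω)
        ≤ 4 * 10 ^ 6 * (∑ t ∈ Finset.range T, ‖ema α (fun s => gradientNoise P F
            (extrapolated α x s ω) (ξg s ω)) t‖ ^ (3 / 2 : ℝ))
          + 4 * 10 ^ 6 / √M ^ 3 * (∑ t ∈ Finset.range T, ‖ema β (fun s => hessNoise P F
            (x s ω) (ξh s ω)) t‖ ^ 3)
          + 10 ^ 4 * (√M * initialGap f x₀) := by
      intro ω
      refine (hpath ω).trans (le_of_eq ?_)
      rw [← Finset.sum_div]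
      ring
    refine (lintegral_mono fun ω => ENNReal.ofReal_le_ofReal (h1 ω)).trans ?_
    refine (lintegral_ofReal_affine_le (Finset.measurable_sum _ fun t ht =>
      ((measurable_ema hr.isSampling_ξg hr.measurable_extrapolated hmg
        (Finset.mem_range.1 ht)).norm.pow_const _)) (fun ω => by positivity)
      (fun ω => by positivity) (by positivity) (by positivity) (by positivity) (by positivity)
      (by positivity) hG hH).trans (ENNReal.ofReal_le_ofReal ?_)
    have e : 4 * 10 ^ 6 / √M ^ 3 * (200000 * B) = 8 * 10 ^ 11 * (B / √M ^ 3) := by ring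
    have h2 : 0 ≤ B / √M ^ 3 := by positivity
    have h3 : 0 ≤ √M * initialGap f x₀ := by positivity
    rw [e]
    linarith
  have hfinal : ∫⁻ ω, ENNReal.ofReal (mu f M (x (τ ω) ω)) ∂μ
      ≤ ENNReal.ofReal (4 * 10 ^ 14 * c.rate d (initialGap f x₀) M T) := by
    rw [hout]
    have e : (T : ENNReal)⁻¹ = ENNReal.ofReal ((T : ℝ)⁻¹) := by
      rw [ENNReal.ofReal_inv_of_pos hT0, ENNReal.ofReal_natCast]
    refine (mul_le_mul_right htotal _).trans ?_
    rw [e, ← ENNReal.ofReal_mul (by positivity)]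
    refine ENNReal.ofReal_le_ofReal ?_
    have h1 := c.le_rate d hT hM h.L_nonneg hF h.σg_pos h.σh_pos h.δh_pos.le h.σg₀_nonneg
      h.σh₀_nonneg hα hβ
    calc _ = 10 ^ 12 * ((√M * initialGap f x₀ + A + B / √M ^ 3) / T) := by
          field_simp
      _ ≤ 10 ^ 12 * (400 * c.rate d (initialGap f x₀) M T) := by gcongr
      _ = _ := by ring
  have hrate : 0 ≤ 4 * 10 ^ 14 * c.rate d (initialGap f x₀) M T := by
    have h1 := c.le_rate d hT hM h.L_nonneg hF h.σg_pos h.σh_pos h.δh_pos.le h.σg₀_nonneg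
      h.σh₀_nonneg hα hβ
    have h2 : 0 ≤ (√M * initialGap f x₀ + A + B / √M ^ 3) / T := by positivity
    linarith
  exact integrable_and_integral_le_of_lintegral_le (fun ω => mu_nonneg f M _) hmeas hrate hfinal

end Run

/-! ### The balanced choice of M. -/

section Balanced

lemma rpow_quotient {a b t f p q r s e : ℝ} (ha : 0 ≤ a) (hb : 0 ≤ b) (ht : 0 ≤ t) (hf : 0 ≤ f) :
    (a ^ p * b ^ q * t ^ r / f ^ s) ^ e
      = a ^ (p * e) * b ^ (q * e) * t ^ (r * e) / f ^ (s * e) := by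
  rw [Real.div_rpow (by positivity) (by positivity), Real.mul_rpow (by positivity) (by positivity),
    Real.mul_rpow (by positivity) (by positivity), ← Real.rpow_mul ha, ← Real.rpow_mul hb,
    ← Real.rpow_mul ht, ← Real.rpow_mul hf]

lemma rpow_split {a p q r : ℝ} (ha : 0 < a) (h : p = q + r) : a ^ p = a ^ q * a ^ r := by
  rw [h, Real.rpow_add ha]

/-- Division by a power of the quotient of monomials. -/
lemma mul_div_rpow_quotient_le {a b t f M p q r s e p' q' r' p₁ q₁ : ℝ} (ha : 0 < a) (hb : 0 < b)
    (ht : 0 < t) (hf : 0 < f) (he : 0 ≤ e) (hM : a ^ p * b ^ q * t ^ r / f ^ s ≤ M)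
    (hp : p₁ = p * e + p') (hq : q₁ = q * e + q') (r₁ : ℝ) (hr : r' = r * e + r₁) :
    a ^ p₁ * b ^ q₁ / t ^ r₁ / M ^ e ≤ a ^ p' * f ^ (s * e) * b ^ q' / t ^ r' := by
  have h1 := Real.rpow_le_rpow (by positivity) hM he
  rw [rpow_quotient ha.le hb.le ht.le hf.le] at h1
  calc a ^ p₁ * b ^ q₁ / t ^ r₁ / M ^ e
      ≤ a ^ p₁ * b ^ q₁ / t ^ r₁ / (a ^ (p * e) * b ^ (q * e) * t ^ (r * e) / f ^ (s * e)) := by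
        gcongr
    _ = a ^ p' * f ^ (s * e) * b ^ q' / t ^ r' := by
        rw [rpow_split ha hp, rpow_split hb hq, rpow_split ht hr]
        field_simp

variable (c : Constants) (d : ℕ) {F₀ : ℝ} {T : ℕ}

lemma Constants.sigmaTilde_mono (hσ : 0 ≤ c.σh) (hδ : 0 ≤ c.δh) {b b' : ℝ} (hb : 0 ≤ b)
    (h : b ≤ b') : c.sigmaTilde d b ≤ c.sigmaTilde d b' := by
  have hl : 0 ≤ Real.log d := Real.log_natCast_nonneg d
  unfold Constants.sigmaTilde
  gcongr

lemma Constants.σh_le_sigmaTilde (hσ : 0 ≤ c.σh) (hδ : 0 ≤ c.δh) {b : ℝ} (hb : 0 ≤ b) :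
    c.σh ≤ c.sigmaTilde d b :=
  (pow_le_pow_iff_left₀ hσ (c.sigmaTilde_nonneg d hσ hδ hb) three_ne_zero).1
    (c.σh_cube_le d hσ hδ hb)

/-- In the regime β = 46 L/M only L/M is compared with the argument of σ̃₁; the factor 46 costs
46^{3/2} ≤ 399. -/
lemma Constants.sigmaTilde_cube_mul_le (hσ : 0 ≤ c.σh) (hδ : 0 ≤ c.δh) {b b' : ℝ} (hb : 0 ≤ b)
    (h : b ≤ b') : c.sigmaTilde d (46 * b) ^ 3 ≤ 399 * c.sigmaTilde d b' ^ 3 := by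
  have hl : 0 ≤ Real.log d := Real.log_natCast_nonneg d
  have hb' : 0 ≤ b' := hb.trans h
  rw [c.sigmaTilde_cube d hσ hδ (by positivity), c.sigmaTilde_cube d hσ hδ hb',
    Real.mul_rpow (by norm_num) hb]
  have h1 : 46 ^ (3 / 2 : ℝ) * b ^ (3 / 2 : ℝ) ≤ 399 * b' ^ (3 / 2 : ℝ) := by
    gcongr
    exact forty_six_rpow_le
  have h2 : 0 ≤ (1 + Real.log d) ^ (3 / 2 : ℝ) * c.σh ^ 3 := by positivity
  have h3 := mul_le_mul_of_nonneg_right h1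
    (by positivity : 0 ≤ (1 + Real.log d) ^ 3 * c.δh ^ 3)
  nlinarith

lemma sqrt_mul_div_eq {a b t f p q r s r' s' : ℝ} (ha : 0 ≤ a) (hb : 0 ≤ b) (ht : 0 < t)
    (hf : 0 < f) (hr : 1 = r / 2 + r') (hs : 1 = s / 2 + s') :
    √(a ^ p * b ^ q * t ^ r / f ^ s) * f / t
      = a ^ (p / 2) * f ^ s' * b ^ (q / 2) / t ^ r' := by
  have h1 : f = f ^ (s / 2) * f ^ s' := by rw [← Real.rpow_add hf, ← hs, Real.rpow_one]
  have h2 : t = t ^ (r / 2) * t ^ r' := by rw [← Real.rpow_add ht, ← hr, Real.rpow_one]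
  have h3 : √(a ^ p * b ^ q * t ^ r / f ^ s)
      = a ^ (p / 2) * b ^ (q / 2) * t ^ (r / 2) / f ^ (s / 2) := by
    rw [Real.sqrt_eq_rpow, rpow_quotient ha hb ht.le hf.le]
    simp only [mul_one_div]
  rw [h3]
  conv_lhs => rw [mul_div_assoc]; arg 2; rw [h1, h2]
  field_simp

lemma sqrt_max_le (a b : ℝ) : √(max a b) ≤ √a + √b := by
  have h1 := Real.sqrt_nonneg a
  have h2 := Real.sqrt_nonneg b
  rcases max_choice a b with h | h <;> rw [h] <;> linarith

/-- The rate for the balanced choice of the regularization parameter. -/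
theorem Constants.rate_optM_le (hT : 1 ≤ T) (hF : 0 < F₀) (hM : 0 < c.optM d F₀ T)
    (hL : 0 ≤ c.L) (hσg : 0 < c.σg) (hσh : 0 < c.σh) (hδ : 0 ≤ c.δh) (hag : 0 ≤ c.ag)
    (hah : 0 ≤ c.ah) :
    c.rate d F₀ (c.optM d F₀ T) T ≤ 10 ^ 6 * c.optRate d F₀ T := by
  have hT0 : (0 : ℝ) < T := by exact_mod_cast hT
  set b₁ := c.L ^ (4 / 7 : ℝ) * F₀ ^ (2 / 7 : ℝ) / (c.σh ^ (6 / 7 : ℝ) * (T : ℝ) ^ (2 / 7 : ℝ))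
    with hb₁
  set b₂ := c.ah ^ (6 / 5 : ℝ) / (T : ℝ) ^ (2 / 5 : ℝ) with hb₂
  have hb₁0 : 0 ≤ b₁ := by positivity
  have hb₂0 : 0 ≤ b₂ := by positivity
  set S₁ := c.sigmaTilde₁ d F₀ T with hS₁
  set S₂ := c.sigmaTilde₂ d T with hS₂
  have hσS₁ : c.σh ≤ S₁ := c.σh_le_sigmaTilde d hσh.le hδ hb₁0
  have hσS₂ : c.σh ≤ S₂ := c.σh_le_sigmaTilde d hσh.le hδ hb₂0
  have hS₁0 : 0 < S₁ := hσh.trans_le hσS₁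
  have hS₂0 : 0 < S₂ := hσh.trans_le hσS₂
  set M := c.optM d F₀ T with hMdef
  set M₂ := c.L ^ (3 / 7 : ℝ) * c.σg ^ (12 / 7 : ℝ) * (T : ℝ) ^ (8 / 7 : ℝ) / F₀ ^ (8 / 7 : ℝ)
    with hM₂
  set M₃ := c.L ^ (3 / 7 : ℝ) * S₁ ^ (6 / 7 : ℝ) * (T : ℝ) ^ (2 / 7 : ℝ) / F₀ ^ (2 / 7 : ℝ)
    with hM₃
  set M₄ := c.ah ^ (9 / 10 : ℝ) * S₂ ^ (3 / 2 : ℝ) * (T : ℝ) ^ (1 / 5 : ℝ) / F₀ ^ (1 / 2 : ℝ)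
    with hM₄
  have eM : M = max (max (100 * c.L) M₂) (max M₃ M₄) := rfl
  have hMM₂ : M₂ ≤ M := eM ▸ le_max_of_le_left (le_max_right _ _)
  have hMM₃ : M₃ ≤ M := eM ▸ le_max_of_le_right (le_max_left _ _)
  have hMM₄ : M₄ ≤ M := eM ▸ le_max_of_le_right (le_max_right _ _)
  set T₁ := √c.L * F₀ / T with hT₁
  set T₂ := c.L ^ (3 / 14 : ℝ) * F₀ ^ (6 / 7 : ℝ) * S₁ ^ (3 / 7 : ℝ) / (T : ℝ) ^ (6 / 7 : ℝ)
    with hT₂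
  set T₃ := c.L ^ (3 / 14 : ℝ) * F₀ ^ (3 / 7 : ℝ) * c.σg ^ (6 / 7 : ℝ) / (T : ℝ) ^ (3 / 7 : ℝ)
    with hT₃
  set T₄ := c.ag ^ (9 / 14 : ℝ) * c.σg ^ (3 / 2 : ℝ) / (T : ℝ) ^ (3 / 7 : ℝ) with hT₄
  set T₅ := c.ah ^ (9 / 20 : ℝ) * S₂ ^ (3 / 4 : ℝ) * F₀ ^ (3 / 4 : ℝ) / (T : ℝ) ^ (9 / 10 : ℝ)
    with hT₅
  have p₁ : 0 ≤ T₁ := by positivity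
  have p₂ : 0 ≤ T₂ := by positivity
  have p₃ : 0 ≤ T₃ := by positivity
  have p₄ : 0 ≤ T₄ := by positivity
  have p₅ : 0 ≤ T₅ := by positivity
  -- Each entry of the maximum defining M contributes one term of the balanced rate to √M F₀/T. In
  -- the remaining terms M is bounded below by the entry that balances them.
  have q1 : √M * F₀ / T ≤ 10 * T₁ + T₃ + T₂ + T₅ := by
    have e2 : √M₂ * F₀ / T = T₃ := by
      rw [hM₂, sqrt_mul_div_eq hL hσg.le hT0 hF (r' := 3 / 7) (s' := 3 / 7) (by norm_num)
        (by norm_num), hT₃]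
      norm_num
    have e3 : √M₃ * F₀ / T = T₂ := by
      rw [hM₃, sqrt_mul_div_eq hL hS₁0.le hT0 hF (r' := 6 / 7) (s' := 6 / 7) (by norm_num)
        (by norm_num), hT₂]
      norm_num
    have e4 : √M₄ * F₀ / T = T₅ := by
      rw [hM₄, sqrt_mul_div_eq hah hS₂0.le hT0 hF (r' := 9 / 10) (s' := 3 / 4) (by norm_num)
        (by norm_num), hT₅]
      norm_num
      ring
    have e1 : √(100 * c.L) = 10 * √c.L := by
      rw [Real.sqrt_mul (by norm_num), show (100 : ℝ) = 10 ^ 2 by norm_num,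
        Real.sqrt_sq (by norm_num)]
    have h1 : √M ≤ 10 * √c.L + √M₂ + (√M₃ + √M₄) := by
      rw [eM, ← e1]
      exact (sqrt_max_le _ _).trans (add_le_add (sqrt_max_le _ _) (sqrt_max_le _ _))
    calc √M * F₀ / T ≤ (10 * √c.L + √M₂ + (√M₃ + √M₄)) * F₀ / T := by gcongr
      _ = 10 * T₁ + √M₂ * F₀ / T + (√M₃ * F₀ / T + √M₄ * F₀ / T) := by rw [hT₁]; ring
      _ = _ := by rw [e2, e3, e4]; ring
  have q3 : (c.L / M) ^ (3 / 8 : ℝ) * c.σg ^ (3 / 2 : ℝ) ≤ T₃ := by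
    rcases hL.eq_or_lt with h0 | hL0
    · rw [← h0, zero_div, Real.zero_rpow (by norm_num), zero_mul]
      exact p₃
    · have h := mul_div_rpow_quotient_le hL0 hσg hT0 hF (e := 3 / 8) (p₁ := 3 / 8) (q₁ := 3 / 2)
        (p' := 3 / 14) (q' := 6 / 7) (r' := 3 / 7) (by norm_num) hMM₂ (by norm_num) (by norm_num)
        0 (by norm_num)
      rw [Real.div_rpow hL hM.le, hT₃]
      norm_num at h ⊢
      rwa [div_mul_eq_mul_div]
  have hLM0 : 0 ≤ c.L / M := by positivity
  have eM3 : M ^ 3 = M ^ (3 : ℝ) := by exact_mod_cast (Real.rpow_natCast M 3).symm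
  have eM3' : M ^ 3 = M ^ (3 / 2 : ℝ) * M ^ (3 / 2 : ℝ) := by
    rw [← Real.rpow_add hM, ← Real.rpow_natCast]; norm_num
  have eS : ∀ S : ℝ, S ^ 3 = S ^ (3 : ℝ) := fun S => by exact_mod_cast (Real.rpow_natCast S 3).symm
  have eb₂ : b₂ ^ (3 / 2 : ℝ) = c.ah ^ (9 / 5 : ℝ) / (T : ℝ) ^ (3 / 5 : ℝ) := by
    rw [hb₂, div_rpow_rpow hah hT0.le]; norm_num
  set S := c.sigmaTilde d (c.beta M T) with hS
  have e2 : c.L ^ (3 / 2 : ℝ) * S ^ 3 / M ^ 3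
      = (c.L / M) ^ (3 / 2 : ℝ) * S ^ 3 / M ^ (3 / 2 : ℝ) := by
    rw [Real.div_rpow hL hM.le, eM3']; field_simp
  have e5 : c.ah ^ (9 / 5 : ℝ) * S ^ 3 / (M ^ (3 / 2 : ℝ) * (T : ℝ) ^ (3 / 5 : ℝ))
      = b₂ ^ (3 / 2 : ℝ) * S ^ 3 / M ^ (3 / 2 : ℝ) := by
    rw [eb₂]; field_simp
  have q25 : c.L ^ (3 / 2 : ℝ) * S ^ 3 / M ^ 3
      + c.ah ^ (9 / 5 : ℝ) * S ^ 3 / (M ^ (3 / 2 : ℝ) * (T : ℝ) ^ (3 / 5 : ℝ))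
      ≤ 2 * T₅ + 159600 * T₂ := by
    -- The two Hessian terms share σ̃_h(β), so the argument splits by the entry that realizes β; in
    -- each case one term dominates the other up to a constant. In the second case the total is 399
    -- + 399² = 159600.
    rcases le_total (46 * (c.L / M)) b₂ with hle | hle
    · have eβ : c.beta M T = b₂ := max_eq_left hle
      have eSS : S = S₂ := by rw [hS, eβ]; rfl
      have h5 : b₂ ^ (3 / 2 : ℝ) * S ^ 3 / M ^ (3 / 2 : ℝ) ≤ T₅ := by
        rw [eb₂, eSS, eS]
        rcases hah.eq_or_lt with h0 | hah0
        · rw [← h0, Real.zero_rpow (by norm_num), zero_div, zero_mul, zero_div]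
          exact p₅
        · have h := mul_div_rpow_quotient_le hah0 hS₂0 hT0 hF (e := 3 / 2) (p₁ := 9 / 5) (q₁ := 3)
            (p' := 9 / 20) (q' := 3 / 4) (r' := 9 / 10) (by norm_num) hMM₄ (by norm_num)
            (by norm_num) (3 / 5) (by norm_num)
          have e : c.ah ^ (9 / 5 : ℝ) / (T : ℝ) ^ (3 / 5 : ℝ) * S₂ ^ (3 : ℝ)
              = c.ah ^ (9 / 5 : ℝ) * S₂ ^ (3 : ℝ) / (T : ℝ) ^ (3 / 5 : ℝ) := by ring
          rw [e]
          refine h.trans (le_of_eq ?_)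
          rw [hT₅]
          norm_num
          ring
      have h2 : (c.L / M) ^ (3 / 2 : ℝ) * S ^ 3 / M ^ (3 / 2 : ℝ)
          ≤ b₂ ^ (3 / 2 : ℝ) * S ^ 3 / M ^ (3 / 2 : ℝ) := by
        have : c.L / M ≤ b₂ := by linarith
        have : 0 ≤ S ^ 3 := by rw [eSS]; positivity
        gcongr
      rw [e2, e5]
      linarith
    · have eβ : c.beta M T = 46 * (c.L / M) := max_eq_right hle
      -- Replacing σ̃₁ by the smaller σ_h in M₃ gives a lower bound for M free of σ̃₁, which is how
      -- the argument b₁ of σ̃₁ can be fixed before M.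
      have hLb : c.L / M ≤ b₁ := by
        rcases hL.eq_or_lt with h0 | hL0
        · rw [← h0, zero_div]; exact hb₁0
        · have h1 : c.L ^ (3 / 7 : ℝ) * c.σh ^ (6 / 7 : ℝ) * (T : ℝ) ^ (2 / 7 : ℝ)
              / F₀ ^ (2 / 7 : ℝ) ≤ M := le_trans (by rw [hM₃]; gcongr) hMM₃
          calc c.L / M ≤ c.L / (c.L ^ (3 / 7 : ℝ) * c.σh ^ (6 / 7 : ℝ) * (T : ℝ) ^ (2 / 7 : ℝ)
                / F₀ ^ (2 / 7 : ℝ)) := by gcongr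
            _ = b₁ := by
              have : c.L = c.L ^ (3 / 7 : ℝ) * c.L ^ (4 / 7 : ℝ) := by
                rw [← Real.rpow_add hL0]; norm_num
              rw [hb₁]
              nth_rw 1 [this]
              field_simp
      have hSS : S ^ 3 ≤ 399 * S₁ ^ 3 := by
        rw [hS, eβ]
        exact c.sigmaTilde_cube_mul_le d hσh.le hδ hLM0 hLb
      have hS0 : 0 ≤ S := c.sigmaTilde_nonneg d hσh.le hδ (hb₂0.trans (le_max_left _ _))
      have h2 : c.L ^ (3 / 2 : ℝ) * S₁ ^ 3 / M ^ 3 ≤ T₂ := by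
        rcases hL.eq_or_lt with h0 | hL0
        · rw [← h0, Real.zero_rpow (by norm_num), zero_mul, zero_div]
          exact p₂
        · have h := mul_div_rpow_quotient_le hL0 hS₁0 hT0 hF (e := 3) (p₁ := 3 / 2) (q₁ := 3)
            (p' := 3 / 14) (q' := 3 / 7) (r' := 6 / 7) (by norm_num) hMM₃ (by norm_num)
            (by norm_num) 0 (by norm_num)
          rw [eM3, eS, hT₂]
          norm_num at h ⊢
          exact h
      have h3 : c.L ^ (3 / 2 : ℝ) * S ^ 3 / M ^ 3 ≤ 399 * T₂ := by
        calc c.L ^ (3 / 2 : ℝ) * S ^ 3 / M ^ 3 ≤ c.L ^ (3 / 2 : ℝ) * (399 * S₁ ^ 3) / M ^ 3 := by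
              gcongr
          _ = 399 * (c.L ^ (3 / 2 : ℝ) * S₁ ^ 3 / M ^ 3) := by ring
          _ ≤ 399 * T₂ := by gcongr
      have h4 : b₂ ^ (3 / 2 : ℝ) * S ^ 3 / M ^ (3 / 2 : ℝ)
          ≤ 399 * (c.L ^ (3 / 2 : ℝ) * S ^ 3 / M ^ 3) := by
        rw [e2]
        calc b₂ ^ (3 / 2 : ℝ) * S ^ 3 / M ^ (3 / 2 : ℝ)
            ≤ (46 * (c.L / M)) ^ (3 / 2 : ℝ) * S ^ 3 / M ^ (3 / 2 : ℝ) := by gcongr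
          _ = 46 ^ (3 / 2 : ℝ) * ((c.L / M) ^ (3 / 2 : ℝ) * S ^ 3 / M ^ (3 / 2 : ℝ)) := by
            rw [Real.mul_rpow (by norm_num) hLM0]; ring
          _ ≤ _ := by
            gcongr
            exact forty_six_rpow_le
      rw [e5]
      linarith
  have er : c.rate d F₀ M T = √M * F₀ / T + c.L ^ (3 / 2 : ℝ) * S ^ 3 / M ^ 3
      + (c.L / M) ^ (3 / 8 : ℝ) * c.σg ^ (3 / 2 : ℝ) + T₄
      + c.ah ^ (9 / 5 : ℝ) * S ^ 3 / (M ^ (3 / 2 : ℝ) * (T : ℝ) ^ (3 / 5 : ℝ)) := rfl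
  have eo : c.optRate d F₀ T = T₁ + T₂ + T₃ + T₄ + T₅ := rfl
  rw [er, eo]
  linarith

/-- The balanced rate is of the order `T^{-3/7}`. -/
theorem Constants.exists_optRate_le (hF : 0 < F₀) (hL : 0 ≤ c.L)
    (hσh : 0 < c.σh) (hδ : 0 ≤ c.δh) (hah : 0 ≤ c.ah) :
    ∃ K : ℝ, ∀ T : ℕ, 1 ≤ T → c.optRate d F₀ T ≤ K / (T : ℝ) ^ (3 / 7 : ℝ) := by
  -- The arguments of both effective noise levels decrease in T, so their values at T = 1 are
  -- uniform bounds.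
  set S₁ := c.sigmaTilde₁ d F₀ 1 with hS₁
  set S₂ := c.sigmaTilde₂ d 1 with hS₂
  refine ⟨√c.L * F₀ + c.L ^ (3 / 14 : ℝ) * F₀ ^ (6 / 7 : ℝ) * S₁ ^ (3 / 7 : ℝ)
    + c.L ^ (3 / 14 : ℝ) * F₀ ^ (3 / 7 : ℝ) * c.σg ^ (6 / 7 : ℝ)
    + c.ag ^ (9 / 14 : ℝ) * c.σg ^ (3 / 2 : ℝ)
    + c.ah ^ (9 / 20 : ℝ) * S₂ ^ (3 / 4 : ℝ) * F₀ ^ (3 / 4 : ℝ), fun T hT => ?_⟩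
  have hT1 : (1 : ℝ) ≤ T := by exact_mod_cast hT
  have hT0 : (0 : ℝ) < T := by linarith
  have h1 : c.sigmaTilde₁ d F₀ T ≤ S₁ := by
    refine c.sigmaTilde_mono d hσh.le hδ (by positivity) ?_
    rw [Nat.cast_one]
    gcongr
  have h2 : c.sigmaTilde₂ d T ≤ S₂ := by
    refine c.sigmaTilde_mono d hσh.le hδ (by positivity) ?_
    rw [Nat.cast_one]
    gcongr
  have h10 : 0 ≤ c.sigmaTilde₁ d F₀ T := c.sigmaTilde_nonneg d hσh.le hδ (by positivity)
  have h20 : 0 ≤ c.sigmaTilde₂ d T := c.sigmaTilde_nonneg d hσh.le hδ (by positivity)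
  have hS₁0 := h10.trans h1
  have hS₂0 := h20.trans h2
  have hpow : ∀ r : ℝ, 3 / 7 ≤ r → (T : ℝ) ^ (3 / 7 : ℝ) ≤ (T : ℝ) ^ r := fun r hr =>
    Real.rpow_le_rpow_of_exponent_le hT1 hr
  have hp1 : (T : ℝ) ^ (3 / 7 : ℝ) ≤ T := by simpa using hpow 1 (by norm_num)
  rw [Constants.optRate]
  simp only [add_div]
  have hp2 := hpow (6 / 7) (by norm_num)
  have hp3 := hpow (9 / 10) (by norm_num)
  gcongr

end Balanced

end CubicMomentum

end

theorem mainTheorem2 :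
    -- the rate for every `M ≥ 100 L`, with a universal constant `C`
    (∃ C : ℝ, 0 < C ∧
      ∀ (d : ℕ) (Ξ : Type u) (_ : MeasurableSpace Ξ) (P : Measure Ξ) (_ : IsProbabilityMeasure P)
        (F : Ξ → Vec d → ℝ) (x₀ : Vec d) (c : Constants) (M : ℝ) (T : ℕ),
        Assumptions P F x₀ c → 1 ≤ T → 100 * c.L ≤ M →
        OutputBound.{u, v} P F x₀ c M T
          (C * c.rate d (initialGap (objective P F) x₀) M T)) ∧
    -- the rate for the balanced choice of `M`, with a universal constant `C`
    (∃ C : ℝ, 0 < C ∧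
      ∀ (d : ℕ) (Ξ : Type u) (_ : MeasurableSpace Ξ) (P : Measure Ξ) (_ : IsProbabilityMeasure P)
        (F : Ξ → Vec d → ℝ) (x₀ : Vec d) (c : Constants) (T : ℕ),
        Assumptions P F x₀ c → 1 ≤ T → 0 < initialGap (objective P F) x₀ →
        OutputBound.{u, v} P F x₀ c (c.optM d (initialGap (objective P F) x₀) T) T
          (C * c.optRate d (initialGap (objective P F) x₀) T)) ∧
    -- convergence, for each fixed problem, with one sample per iteration
    (∀ (d : ℕ) (Ξ : Type u) (_ : MeasurableSpace Ξ) (P : Measure Ξ) (_ : IsProbabilityMeasure P)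
        (F : Ξ → Vec d → ℝ) (x₀ : Vec d) (c : Constants),
        Assumptions P F x₀ c → 0 < initialGap (objective P F) x₀ →
        ∀ ε : ℝ, 0 < ε → ∃ T₀ : ℕ, 1 ≤ T₀ ∧ ∀ T : ℕ, T₀ ≤ T →
          OutputBound.{u, v} P F x₀ c (c.optM d (initialGap (objective P F) x₀) T) T ε) := by
  have ag_nonneg : ∀ {d : ℕ} {Ξ : Type u} [MeasurableSpace Ξ] {P : Measure Ξ} {F : Ξ → Vec d → ℝ}
      {x₀ : Vec d} {c : Constants}, Assumptions P F x₀ c → 0 ≤ c.ag ∧ 0 ≤ c.ah :=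
    fun h => ⟨div_nonneg h.σg₀_nonneg h.σg_pos.le, div_nonneg h.σh₀_nonneg h.σh_pos.le⟩
  have balanced : ∀ (d : ℕ) (Ξ : Type u) (_ : MeasurableSpace Ξ) (P : Measure Ξ)
      (_ : IsProbabilityMeasure P) (F : Ξ → Vec d → ℝ) (x₀ : Vec d) (c : Constants) (T : ℕ),
      Assumptions P F x₀ c → 1 ≤ T → 0 < initialGap (objective P F) x₀ →
      OutputBound.{u, v} P F x₀ c (c.optM d (initialGap (objective P F) x₀) T) T
        (4 * 10 ^ 20 * c.optRate d (initialGap (objective P F) x₀) T) := by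
    intro d Ξ _ P _ F x₀ c T h hT hF Ω mΩ μ hμ ℱ ξg ξh x g H τ hr hτ
    have hLM : 100 * c.L ≤ c.optM d (initialGap (objective P F) x₀) T :=
      le_max_of_le_left (le_max_left _ _)
    obtain ⟨h1, h2⟩ := outputBound_rate h hT hLM Ω mΩ μ hμ ℱ ξg ξh x g H τ hr hτ
    refine ⟨h1, h2.trans ?_⟩
    -- Positivity of M_T is read off the run, whose existence presupposes it.
    have h3 := c.rate_optM_le d hT hF hr.M_pos h.L_nonneg h.σg_pos h.σh_pos h.δh_pos.le
      (ag_nonneg h).1 (ag_nonneg h).2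
    linarith
  refine ⟨⟨4 * 10 ^ 14, by norm_num, fun d Ξ _ P _ F x₀ c M T h hT hLM =>
    outputBound_rate h hT hLM⟩, ⟨4 * 10 ^ 20, by norm_num, balanced⟩, ?_⟩
  intro d Ξ _ P _ F x₀ c h hF ε hε
  obtain ⟨K, hK⟩ := c.exists_optRate_le d hF h.L_nonneg h.σh_pos h.δh_pos.le
    (ag_nonneg h).2
  have hlim : Filter.Tendsto (fun T : ℕ => 4 * 10 ^ 20 * (K / (T : ℝ) ^ (3 / 7 : ℝ)))
      Filter.atTop (nhds 0) := by
    have h1 := ((tendsto_rpow_atTop (by norm_num : (0 : ℝ) < 3 / 7)).comp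
      (tendsto_natCast_atTop_atTop (R := ℝ))).const_div_atTop K
    simpa using h1.const_mul (4 * 10 ^ 20)
  obtain ⟨N, hN⟩ := Filter.eventually_atTop.1 (hlim.eventually_le_const hε)
  refine ⟨max N 1, le_max_right _ _, fun T hT => ?_⟩
  have hT1 : 1 ≤ T := (le_max_right N 1).trans hT
  intro Ω mΩ μ hμ ℱ ξg ξh x g H τ hr hτ
  obtain ⟨h1, h2⟩ := balanced d Ξ inferInstance P inferInstance F x₀ c T h hT1 hF Ω mΩ μ hμ ℱ ξg ξh x g H τ hr hτ
  refine ⟨h1, h2.trans (le_trans ?_ (hN T ((le_max_left N 1).trans hT)))⟩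
  exact mul_le_mul_of_nonneg_left (hK T hT1) (by norm_num)
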